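/- Let $G$ be a finitely generated group. An \emph{agrarian embedding} of $G$ is an injective unital ring homomorphism $\alpha\colon \mathbb{Z}G\hookrightarrow D$ from the integral group ring of $G$ to a skew field $D$; it is \emph{epic} if $g_1\circ\alpha=g_2\circ\alpha$ implies $g_1=g_2$ for all ring homomorphisms $g_1,g_2\colon D\to T$ to a ring $T$. Two agrarian embeddings $\alpha_i\colon\mathbb{Z}G\hookrightarrow D_i$, $i=1,2$, are \emph{isomorphic} if there is an isomorphism of skew fields $e\colon D_1\to D_2$ with $e\circ\alpha_1=\alpha_2$. Assume that $G$ is \emph{agrarian}, i.e. that it has an agrarian embedding. A \emph{$G$-CW-complex} is a CW-complex $X$ with an action of the (discrete) group $G$ by homeomorphisms that maps $n$-cells to $n$-cells for every $n$ and such that any cell mapped into itself by an element of $G$ is fixed pointwise by this element. It is \emph{free} if the action of $G$ is free, \emph{finite} if it has only finitely many $G$-orbits of cells, and \emph{connected} if the underlying CW-complex is connected. For an agrarian embedding $\alpha\colon \mathbb{Z}G\hookrightarrow D$ and $p\ge 0$, the \emph{$p$-th agrarian Betti number} of $X$ with respect to $\alpha$ is $$b_p^{\alpha}(X)=\dim_D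 H_p\bigl(D\otimes_{\mathbb{Z}G} C_*(X)\bigr)\in\mathbb{N}\sqcup\{\infty\},$$ where $C_*(X)$ is the cellular $\mathbb{Z}G$-chain complex of $X$ and $D$ is viewed as a $D$-$\mathbb{Z}G$-bimodule via $\alpha$. Then the following are equivalent: \begin{enumerate} \item for every connected finite free $G$-CW-complex $X$, any two agrarian embeddings $\alpha_1,\alpha_2$ of $G$ and every $p\ge 0$ one has $b_p^{\alpha_1}(X)=b_p^{\alpha_2}(X)$; \item there exists an epic agrarian embedding of $G$ that is unique up to isomorphism, i.e. one to which every epic agrarian embedding of $G$ is isomorphic. \end{enumerate} -/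

import Mathlib

open CategoryTheory TensorProduct Topology
open scoped Pointwise

universe u

/-! ### Agrarian maps -/

/-- A ring homomorphism is *epic* if it is right cancellable among ring homomorphisms. -/
def IsEpic {R S : Type u} [Ring R] [Ring S] (f : R →+* S) : Prop :=
  ∀ (T : Type u) [Ring T] (g₁ g₂ : S →+* T), g₁.comp f = g₂.comp f → g₁ = g₂

/-- An agrarian map for `G` is a ring homomorphism from the integral group ring `ℤG` to a skew
field. -/
abbrev AgrarianMap (G D : Type u) [Group G] [DivisionRing D] : Type u :=
  MonoidAlgebra ℤ G →+* D

/-- An agrarian embedding is an injective agrarian map. -/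
def IsAgrarianEmbedding {G D : Type u} [Group G] [DivisionRing D] (α : AgrarianMap G D) : Prop :=
  Function.Injective α

/-- A group is agrarian if its integral group ring embeds into some skew field. -/
def IsAgrarian (G : Type u) [Group G] : Prop :=
  ∃ (D : Type u) (_ : DivisionRing D) (α : AgrarianMap G D), IsAgrarianEmbedding α

/-- Two agrarian maps are isomorphic if there is an isomorphism of skew fields between their targets
forming a commutative triangle with the maps from `ℤG`. -/
def AgrarianIso {G D₁ D₂ : Type u} [Group G] [DivisionRing D₁] [DivisionRing D₂]
    (α₁ : AgrarianMap G D₁) (α₂ : AgrarianMap G D₂) : Prop :=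
  ∃ e : D₁ ≃+* D₂, e.toRingHom.comp α₁ = α₂

/-! ### The tensor product `D ⊗_R M` over a noncommutative ring `R` -/

section Extension

variable {R D : Type u} [Ring R] [Ring D] (α : R →+* D)

/-- The relations `(d * α r) ⊗ m = d ⊗ (r • m)` defining `D ⊗_R M` as a quotient of `D ⊗_ℤ M`. -/
def balancingRelations (M : Type u) [AddCommGroup M] [Module R M] : Submodule D (D ⊗[ℤ] M) :=
  Submodule.span D {t | ∃ (d : D) (r : R) (m : M), t = (d * α r) ⊗ₜ[ℤ] m - d ⊗ₜ[ℤ] (r • m)}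

/-- The left `D`-module `D ⊗_R M`, where `D` is a `D`-`R`-bimodule via `α`. -/
abbrev BalancedTensor (M : Type u) [AddCommGroup M] [Module R M] : Type u :=
  (D ⊗[ℤ] M) ⧸ balancingRelations α M

/-- The `D`-linear map `D ⊗_R f : D ⊗_R M → D ⊗_R N` induced by an `R`-linear map `f`. -/
noncomputable def BalancedTensor.map {M N : Type u} [AddCommGroup M] [Module R M] [AddCommGroup N]
    [Module R N] (f : M →ₗ[R] N) : BalancedTensor α M →ₗ[D] BalancedTensor α N :=
  Submodule.mapQ _ _
    (AlgebraTensorModule.map (LinearMap.id : D →ₗ[D] D) f.toAddMonoidHom.toIntLinearMap)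
    (by
      refine Submodule.span_le.2 ?_
      rintro _ ⟨d, r, m, rfl⟩
      refine Submodule.subset_span ⟨d, r, f m, ?_⟩
      simp)

lemma BalancedTensor.map_mk_tmul {M N : Type u} [AddCommGroup M] [Module R M] [AddCommGroup N]
    [Module R N] (f : M →ₗ[R] N) (d : D) (m : M) :
    BalancedTensor.map α f (Submodule.Quotient.mk (d ⊗ₜ[ℤ] m)) =
      Submodule.Quotient.mk (d ⊗ₜ[ℤ] f m) := rfl

lemma BalancedTensor.hom_ext {M N : Type u} [AddCommGroup M] [Module R M] [AddCommGroup N]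
    [Module D N] {f g : BalancedTensor α M →ₗ[D] N}
    (h : ∀ (d : D) (m : M), f (Submodule.Quotient.mk (d ⊗ₜ[ℤ] m)) =
      g (Submodule.Quotient.mk (d ⊗ₜ[ℤ] m))) : f = g := by
  refine LinearMap.ext fun x ↦ ?_
  obtain ⟨x, rfl⟩ := Submodule.Quotient.mk_surjective _ x
  induction x using TensorProduct.induction_on with
  | zero => rw [Submodule.Quotient.mk_zero, map_zero, map_zero]
  | tmul d m => exact h d m
  | add x y hx hy => rw [Submodule.Quotient.mk_add, map_add, map_add, hx, hy]

lemma BalancedTensor.map_id (M : Type u) [AddCommGroup M] [Module R M] :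
    BalancedTensor.map α (LinearMap.id : M →ₗ[R] M) = LinearMap.id :=
  BalancedTensor.hom_ext α fun _ _ ↦ rfl

lemma BalancedTensor.map_comp {M N P : Type u} [AddCommGroup M] [Module R M] [AddCommGroup N]
    [Module R N] [AddCommGroup P] [Module R P] (g : N →ₗ[R] P) (f : M →ₗ[R] N) :
    BalancedTensor.map α (g ∘ₗ f) = BalancedTensor.map α g ∘ₗ BalancedTensor.map α f :=
  BalancedTensor.hom_ext α fun _ _ ↦ rfl

lemma BalancedTensor.map_add {M N : Type u} [AddCommGroup M] [Module R M] [AddCommGroup N]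
    [Module R N] (f g : M →ₗ[R] N) :
    BalancedTensor.map α (f + g) = BalancedTensor.map α f + BalancedTensor.map α g :=
  BalancedTensor.hom_ext α fun d m ↦ by
    rw [LinearMap.add_apply, map_mk_tmul, map_mk_tmul, map_mk_tmul, LinearMap.add_apply,
      TensorProduct.tmul_add, Submodule.Quotient.mk_add]

/-- Extension of scalars `M ↦ D ⊗_R M` as a functor. -/
noncomputable def extensionFunctor : ModuleCat.{u} R ⥤ ModuleCat.{u} D where
  obj M := ModuleCat.of D (BalancedTensor α M)
  map f := ModuleCat.ofHom (BalancedTensor.map α f.hom)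
  map_id M := ModuleCat.hom_ext (BalancedTensor.map_id α M)
  map_comp f g := ModuleCat.hom_ext (BalancedTensor.map_comp α g.hom f.hom)

instance : (extensionFunctor α).Additive where
  map_add {_ _ f g} := ModuleCat.hom_ext (BalancedTensor.map_add α f.hom g.hom)

end Extension

/-- The `n`-th Betti number `dim_D H_n(D ⊗_R C)` of a chain complex `C` of left `R`-modules with
respect to a ring homomorphism `α : R → D` to a skew field. -/
noncomputable def bettiNumber {R D : Type u} [Ring R] [DivisionRing D] (α : R →+* D)
    (C : ChainComplex (ModuleCat.{u} R) ℕ) (n : ℕ) : ℕ∞ :=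
  Cardinal.toENat (Module.rank D
    ((((extensionFunctor α).mapHomologicalComplex (ComplexShape.down ℕ)).obj C).homology n))

/-! ### Singular chains of a `G`-space -/

/-- The singular chain complex of a space with integral coefficients. -/
noncomputable abbrev singularComplex (X : Type u) [TopologicalSpace X] :
    ChainComplex (ModuleCat.{u} ℤ) ℕ :=
  ((AlgebraicTopology.singularChainComplexFunctor (ModuleCat.{u} ℤ)).obj
    (ModuleCat.of ℤ (ULift.{u} ℤ))).obj (TopCat.of X)

/-- The chain map induced by a continuous map. -/
noncomputable abbrev singularComplexMap {X Y : Type u} [TopologicalSpace X] [TopologicalSpace Y]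
    (f : C(X, Y)) : singularComplex X ⟶ singularComplex Y :=
  ((AlgebraicTopology.singularChainComplexFunctor (ModuleCat.{u} ℤ)).obj
    (ModuleCat.of ℤ (ULift.{u} ℤ))).map (TopCat.ofHom f)

section Equivariant

variable (G : Type u) [Group G]

/-- The action of `G` on the singular `n`-chains of a `G`-space. -/
noncomputable def singularRep (X : Type u) [TopologicalSpace X] [MulAction G X]
    [ContinuousConstSMul G X] (n : ℕ) : Representation ℤ G ((singularComplex X).X n) where
  toFun g := ((singularComplexMap (ContinuousMap.mk (fun x : X ↦ g • x)
    (continuous_const_smul g))).f n).hom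
  map_one' := by
    have h : TopCat.ofHom (ContinuousMap.mk (fun x : X ↦ (1 : G) • x) (continuous_const_smul 1)) =
        𝟙 (TopCat.of X) := by ext x; simp
    simp only [singularComplexMap, h, CategoryTheory.Functor.map_id, HomologicalComplex.id_f]
    rfl
  map_mul' g k := by
    have h : TopCat.ofHom (ContinuousMap.mk (fun x : X ↦ (g * k) • x)
        (continuous_const_smul (g * k))) =
        TopCat.ofHom (ContinuousMap.mk (fun x : X ↦ k • x) (continuous_const_smul k)) ≫
        TopCat.ofHom (ContinuousMap.mk (fun x : X ↦ g • x) (continuous_const_smul g)) := by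
      ext x; simp [mul_smul]
    simp only [singularComplexMap, h, CategoryTheory.Functor.map_comp, HomologicalComplex.comp_f]
    rfl

/-- The left `ℤG`-module of singular `n`-chains of a `G`-space. -/
abbrev SingularChains (X : Type u) [TopologicalSpace X] [MulAction G X]
    [ContinuousConstSMul G X] (n : ℕ) : Type u :=
  (singularRep G X n).asModule

/-- The `ℤG`-linear map on singular chains induced by a continuous `G`-equivariant map. -/
noncomputable def singularChainsMap {X Y : Type u} [TopologicalSpace X] [MulAction G X]
    [ContinuousConstSMul G X] [TopologicalSpace Y] [MulAction G Y] [ContinuousConstSMul G Y]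
    (f : C(X, Y)) (hf : ∀ (g : G) (x : X), f (g • x) = g • f x) (n : ℕ) :
    SingularChains G X n →ₗ[MonoidAlgebra ℤ G] SingularChains G Y n :=
  Representation.IntertwiningMap.equivLinearMapAsModule _ _
    { toLinearMap := ((singularComplexMap f).f n).hom
      isIntertwining' g := by
        have h : TopCat.ofHom (ContinuousMap.mk (fun x : X ↦ g • x) (continuous_const_smul g)) ≫
            TopCat.ofHom f = TopCat.ofHom f ≫
            TopCat.ofHom (ContinuousMap.mk (fun y : Y ↦ g • y) (continuous_const_smul g)) := by
          ext x; exact hf g x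
        have h' := congrArg (fun k ↦ (((AlgebraicTopology.singularChainComplexFunctor
          (ModuleCat.{u} ℤ)).obj (ModuleCat.of ℤ (ULift.{u} ℤ))).map k).f n) h
        simp only [CategoryTheory.Functor.map_comp, HomologicalComplex.comp_f] at h'
        exact congrArg ModuleCat.Hom.hom h' }

/-- The differentials of the singular chain complex of a `G`-space, as `ℤG`-linear maps. -/
noncomputable def singularBoundary (X : Type u) [TopologicalSpace X] [MulAction G X]
    [ContinuousConstSMul G X] (i j : ℕ) :
    SingularChains G X i →ₗ[MonoidAlgebra ℤ G] SingularChains G X j :=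
  Representation.IntertwiningMap.equivLinearMapAsModule _ _
    { toLinearMap := ((singularComplex X).d i j).hom
      isIntertwining' g := congrArg ModuleCat.Hom.hom ((singularComplexMap (ContinuousMap.mk
        (fun x : X ↦ g • x) (continuous_const_smul g))).comm i j) }

lemma singularBoundary_comp (X : Type u) [TopologicalSpace X] [MulAction G X]
    [ContinuousConstSMul G X] (i j k : ℕ) (c : SingularChains G X i) :
    singularBoundary G X j k (singularBoundary G X i j c) = 0 :=
  congrArg (fun f ↦ f.hom c) ((singularComplex X).d_comp_d i j k)

lemma singularBoundary_eq_zero (X : Type u) [TopologicalSpace X] [MulAction G X]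
    [ContinuousConstSMul G X] {i j : ℕ} (h : j + 1 ≠ i) (c : SingularChains G X i) :
    singularBoundary G X i j c = 0 :=
  congrArg (fun f ↦ f.hom c) ((singularComplex X).shape i j h)

instance {X : Type u} [TopologicalSpace X] [MulAction G X] [ContinuousConstSMul G X]
    (A : SubMulAction G X) : ContinuousConstSMul G A where
  continuous_const_smul g := by
    refine Continuous.subtype_mk (f := fun x : A ↦ g • (x : X)) ?_ _
    fun_prop

variable {G}

/-- For a `G`-invariant subspace `A` of `X`, the submodule of the singular `n`-chains of `X`
consisting of the chains in `A`, that is, the image of the singular `n`-chains of `A`. -/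
noncomputable def chainsIn {X : Type u} [TopologicalSpace X] [MulAction G X]
    [ContinuousConstSMul G X] (A : SubMulAction G X) (n : ℕ) :
    Submodule (MonoidAlgebra ℤ G) (SingularChains G X n) :=
  LinearMap.range (singularChainsMap G (X := A) (Y := X)
    (ContinuousMap.mk Subtype.val continuous_subtype_val) (fun _ _ ↦ rfl) n)

lemma singularBoundary_mem_chainsIn {X : Type u} [TopologicalSpace X] [MulAction G X]
    [ContinuousConstSMul G X] (A : SubMulAction G X) (i j : ℕ) {c : SingularChains G X i}
    (hc : c ∈ chainsIn A i) : singularBoundary G X i j c ∈ chainsIn A j := by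
  obtain ⟨b, rfl⟩ := hc
  exact ⟨singularBoundary G A i j b, (congrArg (fun f ↦ f.hom b) ((singularComplexMap
    (ContinuousMap.mk (Subtype.val : A → X) continuous_subtype_val)).comm i j)).symm⟩

end Equivariant

/-! ### `G`-CW-complexes -/

open Topology.CWComplex in
/-- The action of `G` on the (Hausdorff) CW-complex `X` is cellular, i.e. it turns `X` into a
`G`-CW-complex: `G` acts by homeomorphisms mapping `n`-cells to `n`-cells, and any cell mapped into
itself by an element of `G` is fixed pointwise by this element. -/
class IsGCWComplex (G X : Type u) [Group G] [TopologicalSpace X] [MulAction G X]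
    [T2Space X] [CWComplex (Set.univ : Set X)] : Prop extends ContinuousConstSMul G X where
  exists_smul_openCell_eq (g : G) (n : ℕ) (e : cell (Set.univ : Set X) n) :
    ∃ e' : cell (Set.univ : Set X) n, g • openCell n e = openCell n e'
  smul_eq_of_smul_openCell_subset (g : G) (n : ℕ) (e : cell (Set.univ : Set X) n) :
    g • openCell n e ⊆ openCell n e → ∀ x ∈ openCell n e, g • x = x

section Cellular

variable (G X : Type u) [Group G] [TopologicalSpace X] [MulAction G X]
  [CWComplex (Set.univ : Set X)]

/-- The action of `G` on `X` is free. -/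
def IsFreeGSpace : Prop := ∀ (g : G) (x : X), g • x = x → g = 1

open Topology.CWComplex in
/-- A `G`-CW-complex is finite if it has only finitely many `G`-cells, i.e. `G`-orbits of (open)
cells. -/
def IsFiniteGCWComplex : Prop :=
  {O : Set (Set X) | ∃ (n : ℕ) (e : cell (Set.univ : Set X) n),
    O = MulAction.orbit G (openCell n e)}.Finite

variable [T2Space X] [IsGCWComplex G X]

open Topology.CWComplex in
/-- The union of the cells of dimension less than `n`, as a `G`-invariant subspace. Thus the
`n`-skeleton is `gSkeletonLT G X (n + 1)`. -/
def gSkeletonLT (n : ℕ) : SubMulAction G X where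
  carrier := (skeletonLT (Set.univ : Set X) (n : ℕ∞) : Set X)
  smul_mem' g x hx := by
    rw [← CWComplex.iUnion_openCell_eq_skeletonLT] at hx ⊢
    simp only [Set.mem_iUnion] at hx ⊢
    obtain ⟨m, hm, e, he⟩ := hx
    obtain ⟨e', he'⟩ := IsGCWComplex.exists_smul_openCell_eq g m e
    exact ⟨m, hm, e', he' ▸ Set.smul_mem_smul_set he⟩

/-- The relative singular `n`-cycles of the pair `(X_n, X_{n-1})`: chains in `X_n` whose boundary
lies in `X_{n-1}`. (The boundary from degree `n` to degree `j` is zero unless `j + 1 = n`.) -/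
noncomputable def cellularCycles (n : ℕ) :
    Submodule (MonoidAlgebra ℤ G) (SingularChains G X n) :=
  chainsIn (gSkeletonLT G X (n + 1)) n ⊓
    ⨅ j : ℕ, (chainsIn (gSkeletonLT G X (j + 1)) j).comap (singularBoundary G X n j)

/-- The relative singular `n`-boundaries of the pair `(X_n, X_{n-1})`: sums of a chain in `X_{n-1}`
and the boundary of an `(n + 1)`-chain in `X_n`. -/
noncomputable def cellularBoundaries (n : ℕ) :
    Submodule (MonoidAlgebra ℤ G) (SingularChains G X n) :=
  chainsIn (gSkeletonLT G X n) n ⊔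
    (chainsIn (gSkeletonLT G X (n + 1)) (n + 1)).map (singularBoundary G X (n + 1) n)

/-- The `n`-th cellular chain module, i.e. the relative singular homology group
`H_n(X_n, X_{n-1}; ℤ)` with its induced left `G`-action. -/
abbrev CellularChains (n : ℕ) : Type u :=
  cellularCycles G X n ⧸ (cellularBoundaries G X n).submoduleOf (cellularCycles G X n)

lemma singularBoundary_mem_cellularCycles (i j : ℕ) {c : SingularChains G X i}
    (hc : c ∈ cellularCycles G X i) : singularBoundary G X i j c ∈ cellularCycles G X j := by
  refine ⟨(Submodule.mem_iInf _).1 hc.2 j, (Submodule.mem_iInf _).2 fun k ↦ ?_⟩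
  rw [Submodule.mem_comap, singularBoundary_comp]
  exact Submodule.zero_mem _

lemma singularBoundary_mem_cellularBoundaries (i j : ℕ) {c : SingularChains G X i}
    (hc : c ∈ cellularBoundaries G X i) :
    singularBoundary G X i j c ∈ cellularBoundaries G X j := by
  by_cases h : j + 1 = i
  · subst h
    obtain ⟨a, ha, b, ⟨b, hb, rfl⟩, rfl⟩ := Submodule.mem_sup.1 hc
    rw [map_add, singularBoundary_comp, add_zero]
    exact Submodule.mem_sup_right ⟨a, ha, rfl⟩
  · rw [singularBoundary_eq_zero G X h]
    exact Submodule.zero_mem _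

/-- The cellular differential, induced by the singular boundary. In degrees `n` and `n - 1` it is the
boundary map `H_n(X_n, X_{n-1}) → H_{n-1}(X_{n-1}, X_{n-2})` of the triple. -/
noncomputable def cellularBoundary (i j : ℕ) :
    CellularChains G X i →ₗ[MonoidAlgebra ℤ G] CellularChains G X j :=
  Submodule.mapQ _ _
    ((singularBoundary G X i j).restrict fun _ ↦ singularBoundary_mem_cellularCycles G X i j)
    fun _ ↦ singularBoundary_mem_cellularBoundaries G X i j

/-- The cellular `ℤG`-chain complex of a `G`-CW-complex. -/
noncomputable def cellularComplex : ChainComplex (ModuleCat.{u} (MonoidAlgebra ℤ G)) ℕ where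
  X n := ModuleCat.of _ (CellularChains G X n)
  d i j := ModuleCat.ofHom (cellularBoundary G X i j)
  shape i j h := by
    refine ModuleCat.hom_ext (LinearMap.ext fun x ↦ ?_)
    obtain ⟨x, rfl⟩ := Submodule.Quotient.mk_surjective _ x
    exact congrArg (Submodule.Quotient.mk (p := (cellularBoundaries G X j).submoduleOf _))
      (Subtype.ext (singularBoundary_eq_zero G X h x.1))
  d_comp_d' i j k _ _ := by
    refine ModuleCat.hom_ext (LinearMap.ext fun x ↦ ?_)
    obtain ⟨x, rfl⟩ := Submodule.Quotient.mk_surjective _ x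
    exact congrArg (Submodule.Quotient.mk (p := (cellularBoundaries G X k).submoduleOf _))
      (Subtype.ext (singularBoundary_comp G X i j k x.1))

/-- The `p`-th agrarian Betti number of the `G`-CW-complex `X` with respect to the agrarian map
`α`. -/
noncomputable def agrarianBetti {D : Type u} [DivisionRing D] (α : AgrarianMap G D) (p : ℕ) : ℕ∞ :=
  bettiNumber α (cellularComplex G X) p

end Cellular

/-!
Write an agrarian map as `α : ℤG → D`.

**Uniqueness implies equality of Betti numbers.** Every agrarian embedding factors through the skew
field generated by its image, and the resulting embedding is epic (`isEpic_codRestrict_closure`), hence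
isomorphic to the universal one. So every agrarian embedding is the universal one followed by an
extension of skew fields, and such extensions do not change Betti numbers (`bettiNumber_comp`), because
every complex of vector spaces splits.

**Equality of Betti numbers implies uniqueness.** The target of an epic embedding is generated by the
image as a skew field (`IsEpic.closure_range_eq_top`). Elements of such a skew field are values of
rational expressions `c A⁻¹ b` over `ℤG`, and such a value vanishes if and only if a bordered matrix
over `ℤG` fails to become invertible. Therefore two such embeddings are isomorphic as soon as the same
square matrices over `ℤG` become invertible under both (`exists_ringEquiv_of_isUnit_iff`). It remains
to see that the Betti numbers detect whether a matrix `A` becomes invertible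
(`isUnit_map_iff_of_betti`).

The row space of `A` over `D` is the whole of `Dⁿ` if and only if every `D`-linear functional killing
the rows kills the basis vectors. Linear maps on `(ℤG)ⁿ` occur as derivations of the semidirect product
of `(ℤG)ⁿ` and `G`, and for a given matrix finitely many products in this group are enough to make a
map defined on a finite set behave linearly on the rows (`exists_finite_forcesLinearAt`). Invertibility
of `A` is thus a question of whether finitely many derivation equations
`q x + α (g) q y = q z`, where `g` is the component of `x` in `G`, imply certain others
(`exists_mul_eq_one_iff`).

Such equations are encoded by a finite free `G`-complex of dimension two (`ColouredComplex.encode`):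
each element `e` of the finite set gives arcs joining base points translated by the group component of
`e`, and each equation gives triangles filling the loop formed by three arcs. Equivariant simplicial
`1`-cocycles on this complex with values in `D`-modules are the same as solutions of the equations up
to choices at the base points, so that an equation is implied by the others if and only if the
dimension of the module `CocycleModule` carrying the universal cocycle does not drop when one more
triangle is filled in (`ColouredComplex.finrank_eq_iff_derivationImplies`).

Finally, the dimension of this module is determined by the Betti numbers in degrees zero and one
(`ColouredComplex.Realization.finrank_cocycleModule_eq`), since it is isomorphic to the cokernel of the
second differential of `D ⊗ C_*` (`ColouredComplex.Realization.cokerEquivCocycle`), and `D ⊗ C₀` is free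
on the orbits of vertices. As cellular chains are defined by singular chains, this isomorphism needs
the simplicial approximation of singular chains in low degrees: a path is homologous to a combination
of edges (`ColouredComplex.Realization.mk_mem_edgeSubgroup`), and a simplicial cocycle is evaluated on
a path by lifting the path to the covering space which the cocycle classifies
(`ColouredComplex.Realization.exists_isPrimitive`).
-/

/-! ### Singular simplices as generators of the singular chains -/

section SingularSimplices

variable {X Y : Type u} [TopologicalSpace X] [TopologicalSpace Y]

/-- The standard topological `n`-simplex. -/
abbrev StdSimp (n : ℕ) : Type := stdSimplex ℝ (Fin (n + 1))

/-- A continuous map `Δⁿ → X` as an `n`-simplex of the singular simplicial set of `X`. -/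
noncomputable def toSing {n : ℕ} (σ : C(StdSimp n, X)) :
    (TopCat.toSSet.obj (TopCat.of X)).obj (Opposite.op (SimplexCategory.mk n)) :=
  ((TopCat.of X).toSSetObjEquiv (Opposite.op (SimplexCategory.mk n))).symm σ

/-- The generator of the singular `n`-chains given by a singular simplex. -/
noncomputable def singGen {n : ℕ} (σ : C(StdSimp n, X)) : (singularComplex X).X n :=
  ((TopCat.toSSet.obj (TopCat.of X)).ιChainComplex
    (R := ModuleCat.of ℤ (ULift.{u} ℤ)) (toSing σ)).hom (ULift.up 1)

/-- The `i`-th face of a singular simplex. -/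
noncomputable def singFace {n : ℕ} (σ : C(StdSimp (n + 1), X)) (i : Fin (n + 2)) :
    C(StdSimp n, X) :=
  σ.comp ⟨stdSimplex.map i.succAbove, stdSimplex.continuous_map _⟩

lemma toSing_surjective {n : ℕ} : Function.Surjective (toSing (X := X) (n := n)) :=
  Equiv.surjective _

lemma singularComplex_d_singGen {n : ℕ} (σ : C(StdSimp (n + 1), X)) :
    ((singularComplex X).d (n + 1) n).hom (singGen σ) =
      ∑ i : Fin (n + 2), (-1 : ℤ) ^ i.val • singGen (singFace σ i) := by
  have h := SSet.ιChainComplex_d (TopCat.toSSet.obj (TopCat.of X))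
    (ModuleCat.of ℤ (ULift.{u} ℤ)) (toSing σ)
  have h' := congrArg (fun f ↦ f.hom (ULift.up 1)) h
  simp only [ModuleCat.hom_sum, LinearMap.sum_apply] at h'
  exact h'

lemma singularComplexMap_singGen (f : C(X, Y)) {n : ℕ} (σ : C(StdSimp n, X)) :
    ((singularComplexMap f).f n).hom (singGen σ) = singGen (f.comp σ) := by
  have h := SSet.ι_chainComplexMap_f _ _
    (TopCat.toSSet.map (TopCat.ofHom f)) (ModuleCat.of ℤ (ULift.{u} ℤ)) (toSing σ)
  exact congrArg (fun f ↦ f.hom (ULift.up 1)) h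

/-- Additive maps out of the singular chains are determined by their values on simplices. -/
lemma singularComplex_addHom_ext {N : Type u} [AddCommGroup N] {n : ℕ}
    {f g : (singularComplex X).X n →+ N} (h : ∀ σ : C(StdSimp n, X), f (singGen σ) = g (singGen σ)) :
    f = g := by
  let F (f : (singularComplex X).X n →+ N) : (singularComplex X).X n ⟶ ModuleCat.of ℤ N :=
    ModuleCat.ofHom { f with map_smul' := fun k x ↦ map_intCast_smul f ℤ ℤ k x }
  have : F f = F g := by
    refine SSet.chainComplex_hom_ext fun x ↦ ?_
    obtain ⟨σ, rfl⟩ := toSing_surjective x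
    refine ModuleCat.hom_ext (LinearMap.ext fun ⟨k⟩ ↦ ?_)
    have hk : (ULift.up k : ULift.{u} ℤ) = k • (ULift.up 1 : ULift.{u} ℤ) := by
      ext; simp
    rw [hk, map_zsmul, map_zsmul]
    exact congrArg (k • ·) (h σ)
  ext x
  exact congrArg (fun f ↦ f.hom x) this

/-- The additive map on singular chains with prescribed values on simplices. -/
noncomputable def singularLift {N : Type u} [AddCommGroup N] {n : ℕ} (φ : C(StdSimp n, X) → N) :
    (singularComplex X).X n →+ N :=
  ((((TopCat.toSSet.obj (TopCat.of X)).isColimitChainComplexXCofan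
    (ModuleCat.of ℤ (ULift.{u} ℤ)) n).desc
      (Limits.Cofan.mk (ModuleCat.of ℤ N) fun x ↦ ModuleCat.ofHom
        ((LinearMap.toSpanSingleton ℤ N (φ ((TopCat.of X).toSSetObjEquiv _ x))).comp
          (ULift.moduleEquiv : ULift.{u} ℤ ≃ₗ[ℤ] ℤ).toLinearMap))).hom : _ →ₗ[ℤ] N).toAddMonoidHom

lemma singularLift_singGen {N : Type u} [AddCommGroup N] {n : ℕ} (φ : C(StdSimp n, X) → N)
    (σ : C(StdSimp n, X)) : singularLift φ (singGen σ) = φ σ := by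
  have h := ((TopCat.toSSet.obj (TopCat.of X)).isColimitChainComplexXCofan
    (ModuleCat.of ℤ (ULift.{u} ℤ)) n).fac
      (Limits.Cofan.mk (ModuleCat.of ℤ N) fun x ↦ ModuleCat.ofHom
        ((LinearMap.toSpanSingleton ℤ N (φ ((TopCat.of X).toSSetObjEquiv _ x))).comp
          (ULift.moduleEquiv : ULift.{u} ℤ ≃ₗ[ℤ] ℤ).toLinearMap)) ⟨toSing σ⟩
  have h' := congrArg (fun f ↦ f.hom (ULift.up 1)) h
  refine h'.trans ?_
  change (1 : ℤ) • φ (((TopCat.of X).toSSetObjEquiv _ (toSing σ))) = φ σ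
  rw [one_smul, toSing, Equiv.apply_symm_apply]

/-- The singular chains are generated by the singular simplices. -/
lemma singularComplex_induction {n : ℕ} {p : (singularComplex X).X n → Prop} (zero : p 0)
    (gen : ∀ σ : C(StdSimp n, X), p (singGen σ)) (add : ∀ a b, p a → p b → p (a + b))
    (neg : ∀ a, p a → p (-a)) (c : (singularComplex X).X n) : p c := by
  let S : AddSubgroup ((singularComplex X).X n) :=
    { carrier := {c | p c}
      zero_mem' := zero
      add_mem' := add _ _
      neg_mem' := neg _ }
  have : QuotientAddGroup.mk' S = 0 :=
    singularComplex_addHom_ext fun σ ↦ (QuotientAddGroup.eq_zero_iff _).2 (gen σ)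
  exact (QuotientAddGroup.eq_zero_iff c).1 (DFunLike.congr_fun this c)

end SingularSimplices

section EquivariantSimplices

variable (G : Type u) [Group G] {X Y : Type u} [TopologicalSpace X] [MulAction G X]
  [ContinuousConstSMul G X] [TopologicalSpace Y] [MulAction G Y] [ContinuousConstSMul G Y]

/-- The class of a singular simplex in the `ℤG`-module of singular chains. -/
noncomputable def chainGen {n : ℕ} (σ : C(StdSimp n, X)) : SingularChains G X n :=
  (singularRep G X n).asModuleEquiv.symm (singGen σ)

/-- Translation of a singular simplex by a group element. -/
def smulSimplex {n : ℕ} (g : G) (σ : C(StdSimp n, X)) : C(StdSimp n, X) :=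
  (ContinuousMap.mk (fun x : X ↦ g • x) (continuous_const_smul g)).comp σ

lemma single_smul_chainGen {n : ℕ} (g : G) (σ : C(StdSimp n, X)) :
    MonoidAlgebra.single g (1 : ℤ) • chainGen G σ = chainGen G (smulSimplex G g σ) := by
  have h := Representation.single_smul (singularRep G X n) (1 : ℤ) g (chainGen G σ)
  exact h.trans ((@one_smul ℤ _ _ (_) _).trans (singularComplexMap_singGen _ σ))

lemma singularBoundary_chainGen {n : ℕ} (σ : C(StdSimp (n + 1), X)) :
    singularBoundary G X (n + 1) n (chainGen G σ) =
      ∑ i : Fin (n + 2), (-1 : ℤ) ^ i.val • chainGen G (singFace σ i) :=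
  singularComplex_d_singGen σ

lemma singularChainsMap_chainGen (f : C(X, Y)) (hf : ∀ (g : G) (x : X), f (g • x) = g • f x)
    {n : ℕ} (σ : C(StdSimp n, X)) :
    singularChainsMap G f hf n (chainGen G σ) = chainGen G (f.comp σ) :=
  singularComplexMap_singGen f σ

lemma singularChains_induction {n : ℕ} {p : SingularChains G X n → Prop} (zero : p 0)
    (gen : ∀ σ : C(StdSimp n, X), p (chainGen G σ)) (add : ∀ a b, p a → p b → p (a + b))
    (neg : ∀ a, p a → p (-a)) (c : SingularChains G X n) : p c :=
  singularComplex_induction (p := p) zero gen add neg c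

/-- The additive map on the singular chains of a `G`-space with prescribed values on simplices. -/
noncomputable def chainLift {N : Type u} [AddCommGroup N] {n : ℕ} (φ : C(StdSimp n, X) → N) :
    SingularChains G X n →+ N :=
  (singularLift φ : (singularComplex X).X n →+ N)

lemma chainLift_chainGen {N : Type u} [AddCommGroup N] {n : ℕ} (φ : C(StdSimp n, X) → N)
    (σ : C(StdSimp n, X)) : chainLift G φ (chainGen G σ) = φ σ :=
  singularLift_singGen φ σ

lemma chainLift_single_smul {N : Type u} [AddCommGroup N] {n : ℕ} {φ : C(StdSimp n, X) → N}
    (a : G → N →+ N) (h : ∀ g σ, φ (smulSimplex G g σ) = a g (φ σ)) (g : G)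
    (c : SingularChains G X n) :
    chainLift G φ (MonoidAlgebra.single g (1 : ℤ) • c) = a g (chainLift G φ c) := by
  induction c using singularChains_induction with
  | zero => simp
  | gen σ => rw [single_smul_chainGen, chainLift_chainGen, chainLift_chainGen, h]
  | add x y hx hy => rw [smul_add, map_add, map_add, map_add, hx, hy]
  | neg x hx => rw [smul_neg, map_neg, map_neg, map_neg, hx]

variable {G}

lemma chainGen_mem_chainsIn (A : SubMulAction G X) {n : ℕ} {σ : C(StdSimp n, X)}
    (h : ∀ t, σ t ∈ A) : chainGen G σ ∈ chainsIn A n :=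
  ⟨chainGen G (X := A) (n := n) ⟨fun t ↦ ⟨σ t, h t⟩, by fun_prop⟩,
    singularChainsMap_chainGen G _ _ _⟩

lemma chainsIn_induction (A : SubMulAction G X) {n : ℕ} {p : SingularChains G X n → Prop}
    (zero : p 0) (gen : ∀ σ : C(StdSimp n, X), (∀ t, σ t ∈ A) → p (chainGen G σ))
    (add : ∀ a b, p a → p b → p (a + b)) (neg : ∀ a, p a → p (-a))
    {c : SingularChains G X n} (hc : c ∈ chainsIn A n) : p c := by
  obtain ⟨b, rfl⟩ := hc
  induction b using singularChains_induction with
  | zero => rwa [map_zero]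
  | gen σ =>
    rw [singularChainsMap_chainGen]
    exact gen _ fun t ↦ (σ t).2
  | add x y hx hy => rw [map_add]; exact add _ _ hx hy
  | neg x hx => rw [map_neg]; exact neg _ hx

lemma chainsIn_eq_top {A : SubMulAction G X} (h : ∀ x, x ∈ A) (n : ℕ) : chainsIn A n = ⊤ := by
  refine eq_top_iff.2 fun c _ ↦ ?_
  induction c using singularChains_induction with
  | zero => exact zero_mem _
  | gen σ => exact chainGen_mem_chainsIn A fun t ↦ h _
  | add x y hx hy => exact add_mem (hx trivial) (hy trivial)
  | neg x hx => exact neg_mem (hx trivial)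

end EquivariantSimplices

/-! ### Coloured `G`-complexes and their realizations -/

/-- The vertex set `G × I` of a free `G`-complex whose orbits of vertices are indexed by the set `I`
of colours. It is a copy of the product carrying the left translation action of `G`. -/
@[ext]
structure Vertex (G I : Type u) : Type u where
  /-- The group component of a vertex. -/
  elt : G
  /-- The colour of a vertex. -/
  colour : I

namespace Vertex

variable {G I : Type u} [Group G]

instance : MulAction G (Vertex G I) where
  smul g v := ⟨g * v.elt, v.colour⟩
  one_smul _ := Vertex.ext (one_mul _) rfl
  mul_smul _ _ _ := Vertex.ext (mul_assoc _ _ _) rfl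

@[simp] lemma smul_elt (g : G) (v : Vertex G I) : (g • v).elt = g * v.elt := rfl

@[simp] lemma smul_colour (g : G) (v : Vertex G I) : (g • v).colour = v.colour := rfl

lemma smul_mk (g k : G) (i : I) : g • (⟨k, i⟩ : Vertex G I) = ⟨g * k, i⟩ := rfl

/-- Left translation of a finite set of vertices. -/
def translate (g : G) (s : Finset (Vertex G I)) : Finset (Vertex G I) :=
  s.map ⟨(g • ·), MulAction.injective g⟩

lemma mem_translate {g : G} {s : Finset (Vertex G I)} {v : Vertex G I} :
    v ∈ translate g s ↔ g⁻¹ • v ∈ s := by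
  simp only [translate, Finset.mem_map, Function.Embedding.coeFn_mk]
  exact ⟨fun ⟨w, hw, h⟩ ↦ by rwa [← h, inv_smul_smul], fun h ↦ ⟨_, h, smul_inv_smul _ _⟩⟩

lemma smul_mem_translate {g : G} {s : Finset (Vertex G I)} {v : Vertex G I} :
    g • v ∈ translate g s ↔ v ∈ s := by rw [mem_translate, inv_smul_smul]

end Vertex

/-- A locally finite simplicial complex of dimension at most two with vertex set `G × I` which is
invariant under `G` and in which the vertices of each simplex have distinct colours. -/
structure ColouredComplex (G I : Type u) [Group G] where
  /-- The (nonempty) simplices. -/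
  simplices : Set (Finset (Vertex G I))
  nonempty : ∀ {s}, s ∈ simplices → s.Nonempty
  mono : ∀ {s t}, s ∈ simplices → t ⊆ s → t.Nonempty → t ∈ simplices
  translate_mem : ∀ (g : G) {s}, s ∈ simplices → Vertex.translate g s ∈ simplices
  singleton_mem : ∀ v, {v} ∈ simplices
  colour_injOn : ∀ {s}, s ∈ simplices → ∀ v ∈ s, ∀ w ∈ s, v.colour = w.colour → v = w
  card_le : ∀ {s}, s ∈ simplices → s.card ≤ 3
  finite_star : ∀ v, {s | s ∈ simplices ∧ v ∈ s}.Finite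

namespace ColouredComplex

variable {G I : Type u} [Group G] (K : ColouredComplex G I)

/-- Two vertices are adjacent if they lie in a common simplex; every vertex is adjacent to itself. -/
def Adj (v w : Vertex G I) : Prop := ∃ s ∈ K.simplices, v ∈ s ∧ w ∈ s

/-- The points of the geometric realization, by barycentric coordinates. -/
@[ext]
structure Realization : Type u where
  /-- The barycentric coordinates. -/
  coord : Vertex G I → ℝ
  nonneg' : ∀ v, 0 ≤ coord v
  exists_simplex : ∃ s ∈ K.simplices, (∀ v ∉ s, coord v = 0) ∧ ∑ v ∈ s, coord v = 1

variable {K}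

namespace Realization

/-- The topology of pointwise convergence of barycentric coordinates. It is the weak topology, since
the complex is locally finite. -/
instance : TopologicalSpace K.Realization := TopologicalSpace.induced coord inferInstance

instance : CoeFun K.Realization (fun _ ↦ Vertex G I → ℝ) := ⟨coord⟩

lemma ext_apply {x y : K.Realization} (h : ∀ v, x v = y v) : x = y := Realization.ext (funext h)

lemma continuous_coe : Continuous (coord : K.Realization → Vertex G I → ℝ) :=
  continuous_induced_dom

instance : T2Space K.Realization :=
  T2Space.of_injective_continuous (fun _ _ ↦ Realization.ext) continuous_coe

lemma continuous_apply (v : Vertex G I) : Continuous (fun x : K.Realization ↦ x v) :=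
  (_root_.continuous_apply v).comp continuous_coe

lemma continuous_iff {T : Type*} [TopologicalSpace T] {f : T → K.Realization} :
    Continuous f ↔ ∀ v, Continuous fun t ↦ f t v :=
  continuous_induced_rng.trans continuous_pi_iff

lemma nonneg (x : K.Realization) (v : Vertex G I) : 0 ≤ x v := x.nonneg' v

lemma finite_support (x : K.Realization) : {v | 0 < x v}.Finite := by
  obtain ⟨s, -, h, -⟩ := x.exists_simplex
  exact s.finite_toSet.subset fun v hv ↦ by_contra fun hs ↦ (hv : 0 < x v).ne' (h v hs)

/-- The vertices of the carrier of a point: those with positive barycentric coordinate. -/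
noncomputable def supp (x : K.Realization) : Finset (Vertex G I) := x.finite_support.toFinset

@[simp] lemma mem_supp {x : K.Realization} {v : Vertex G I} : v ∈ x.supp ↔ 0 < x v := by
  simp [supp]

lemma eq_zero_of_notMem {x : K.Realization} {v : Vertex G I} (h : v ∉ x.supp) : x v = 0 :=
  le_antisymm (not_lt.1 (mem_supp.not.1 h)) (x.nonneg v)

lemma sum_eq_one_of_supp_subset {x : K.Realization} {s : Finset (Vertex G I)} (h : x.supp ⊆ s) :
    ∑ v ∈ s, x v = 1 := by
  obtain ⟨t, -, h0, h1⟩ := x.exists_simplex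
  have ht : x.supp ⊆ t := fun v hv ↦ by_contra fun hs ↦ (mem_supp.1 hv).ne' (h0 v hs)
  rw [← h1, ← Finset.sum_subset h fun v _ hv ↦ eq_zero_of_notMem hv,
    ← Finset.sum_subset ht fun v _ hv ↦ eq_zero_of_notMem hv]

lemma supp_nonempty (x : K.Realization) : x.supp.Nonempty := by
  by_contra h
  have := sum_eq_one_of_supp_subset (x := x) (s := ∅) (by simp [Finset.not_nonempty_iff_eq_empty.1 h])
  simp at this

lemma supp_mem (x : K.Realization) : x.supp ∈ K.simplices := by
  obtain ⟨t, ht, h0, -⟩ := x.exists_simplex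
  exact K.mono ht (fun v hv ↦ by_contra fun hs ↦ (mem_supp.1 hv).ne' (h0 v hs))
    x.supp_nonempty

/-- The point with given nonnegative weights of sum one on the vertices of a simplex. -/
def ofWeights {s : Finset (Vertex G I)} (hs : s ∈ K.simplices) (x : Vertex G I → ℝ) (h0 : ∀ v, 0 ≤ x v)
    (h : ∀ v ∉ s, x v = 0) (h1 : ∑ v ∈ s, x v = 1) : K.Realization := ⟨x, h0, s, hs, h, h1⟩

lemma supp_ofWeights_subset {s : Finset (Vertex G I)} (hs : s ∈ K.simplices) (x : Vertex G I → ℝ)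
    (h0 : ∀ v, 0 ≤ x v) (h : ∀ v ∉ s, x v = 0) (h1 : ∑ v ∈ s, x v = 1) :
    (ofWeights hs x h0 h h1).supp ⊆ s := fun v hv ↦ by_contra fun hn ↦
      (mem_supp.1 hv).ne' (h v hn)

instance : MulAction G K.Realization where
  smul g x := ⟨fun v ↦ x (g⁻¹ • v), fun _ ↦ x.nonneg _, Vertex.translate g x.supp,
    K.translate_mem g x.supp_mem,
    fun v hv ↦ eq_zero_of_notMem fun h ↦ hv (Vertex.mem_translate.2 h), by
      rw [Vertex.translate, Finset.sum_map]
      simpa using sum_eq_one_of_supp_subset (subset_refl x.supp)⟩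
  one_smul x := by refine ext_apply fun v ↦ ?_; change x ((1 : G)⁻¹ • v) = x v; simp
  mul_smul g k x := by
    refine ext_apply fun v ↦ ?_; change x ((g * k)⁻¹ • v) = x (k⁻¹ • g⁻¹ • v); rw [mul_inv_rev, mul_smul]

lemma smul_apply (g : G) (x : K.Realization) (v : Vertex G I) : (g • x) v = x (g⁻¹ • v) := rfl

instance : ContinuousConstSMul G K.Realization where
  continuous_const_smul g := continuous_iff.2 fun v ↦ continuous_apply (g⁻¹ • v)

lemma supp_smul (g : G) (x : K.Realization) : (g • x).supp = Vertex.translate g x.supp := by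
  ext v; rw [Vertex.mem_translate, mem_supp, mem_supp, smul_apply]

open Classical in
/-- A vertex as a point of the realization. -/
noncomputable def vertex (K : ColouredComplex G I) (v : Vertex G I) : K.Realization :=
  ofWeights (K.singleton_mem v) (Pi.single v 1)
    (fun w ↦ by by_cases h : w = v <;> simp [h])
    (fun w hw ↦ Pi.single_eq_of_ne (Finset.mem_singleton.not.1 hw) _) (by simp)

lemma supp_vertex (v : Vertex G I) : (vertex K v).supp = {v} := by
  classical
  ext w
  rw [mem_supp, Finset.mem_singleton]
  change 0 < (Pi.single v 1 : Vertex G I → ℝ) w ↔ _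
  by_cases h : w = v <;> simp [h]

lemma vertex_apply_self (v : Vertex G I) : vertex K v v = 1 := by
  classical
  change (Pi.single v 1 : Vertex G I → ℝ) v = 1
  simp

lemma eq_vertex_of_supp_subset {x : K.Realization} {v : Vertex G I} (h : x.supp ⊆ {v}) :
    x = vertex K v := by
  refine ext_apply fun w ↦ ?_
  by_cases hw : w = v
  · subst hw
    rw [vertex_apply_self]
    simpa using sum_eq_one_of_supp_subset h
  · rw [eq_zero_of_notMem fun h' ↦ hw (Finset.mem_singleton.1 (h h')),
      eq_zero_of_notMem fun h' ↦ hw (Finset.mem_singleton.1 (supp_vertex (K := K) v ▸ h'))]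

lemma smul_vertex (g : G) (v : Vertex G I) : g • vertex K v = vertex K (g • v) :=
  eq_vertex_of_supp_subset (by
    rw [supp_smul, supp_vertex]; simp [Vertex.translate])

lemma exists_base [LinearOrder I] (x : K.Realization) :
    ∃ v ∈ x.supp, ∀ w ∈ x.supp, v.colour ≤ w.colour :=
  Finset.exists_min_image _ _ x.supp_nonempty

/-- The vertex of smallest colour of the carrier of a point; this is an equivariant choice. -/
noncomputable def base [LinearOrder I] (x : K.Realization) : Vertex G I := x.exists_base.choose

lemma base_mem [LinearOrder I] (x : K.Realization) : x.base ∈ x.supp := x.exists_base.choose_spec.1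

lemma base_colour_le [LinearOrder I] (x : K.Realization) {w : Vertex G I} (h : w ∈ x.supp) :
    x.base.colour ≤ w.colour := x.exists_base.choose_spec.2 w h

lemma base_smul [LinearOrder I] (g : G) (x : K.Realization) : (g • x).base = g • x.base := by
  have h1 : g⁻¹ • (g • x).base ∈ x.supp := by
    have := (g • x).base_mem
    rwa [supp_smul, Vertex.mem_translate] at this
  have h2 : g • x.base ∈ (g • x).supp := by
    rw [supp_smul, Vertex.smul_mem_translate]; exact x.base_mem
  exact K.colour_injOn (g • x).supp_mem _ (g • x).base_mem _ h2
    (le_antisymm ((g • x).base_colour_le h2) (by simpa using x.base_colour_le h1))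

lemma base_vertex [LinearOrder I] (v : Vertex G I) : (vertex K v).base = v := by
  have := (vertex K v).base_mem
  rwa [supp_vertex, Finset.mem_singleton] at this

/-- The open star of a vertex. -/
def star (K : ColouredComplex G I) (v : Vertex G I) : Set K.Realization := {x | 0 < x v}

lemma isOpen_star (v : Vertex G I) : IsOpen (star K v) :=
  isOpen_lt continuous_const (continuous_apply v)

lemma smul_eq_self {g : G} {x : K.Realization} (h : (g • x).supp = x.supp) : g = 1 := by
  obtain ⟨v, hv⟩ := x.supp_nonempty
  have h2 : g • v ∈ x.supp := by
    rw [← h, supp_smul, Vertex.smul_mem_translate]; exact hv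
  have := congrArg Vertex.elt (K.colour_injOn x.supp_mem _ h2 _ hv rfl)
  simpa using this

lemma isFreeGSpace : IsFreeGSpace G K.Realization := fun _ _ h ↦ smul_eq_self (congrArg supp h)

end Realization

end ColouredComplex

/-! ### The cell structure of the realization -/

section CornerSimplex

/-- The `n`-simplex spanned by the origin and the standard basis of `ℝⁿ`. -/
def cornerSimplex (n : ℕ) : Set (Fin n → ℝ) := {y | (∀ i, 0 ≤ y i) ∧ ∑ i, y i ≤ 1}

lemma convex_cornerSimplex (n : ℕ) : Convex ℝ (cornerSimplex n) := by
  intro x hx y hy a b ha hb hab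
  refine ⟨fun i ↦ ?_, ?_⟩
  · have := hx.1 i; have := hy.1 i
    simp only [Pi.add_apply, Pi.smul_apply, smul_eq_mul]; positivity
  · simp only [Pi.add_apply, Pi.smul_apply, smul_eq_mul, Finset.sum_add_distrib, ← Finset.mul_sum]
    nlinarith [mul_le_mul_of_nonneg_left hx.2 ha, mul_le_mul_of_nonneg_left hy.2 hb]

lemma isClosed_cornerSimplex (n : ℕ) : IsClosed (cornerSimplex n) := by
  have : cornerSimplex n = (⋂ i, {y | 0 ≤ y i}) ∩ {y | ∑ i, y i ≤ 1} := by
    ext; simp [cornerSimplex]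
  rw [this]
  exact (isClosed_iInter fun i ↦ isClosed_le continuous_const (continuous_apply i)).inter
    (isClosed_le (by fun_prop) continuous_const)

lemma interior_cornerSimplex (n : ℕ) :
    interior (cornerSimplex n) = {y | (∀ i, 0 < y i) ∧ ∑ i, y i < 1} := by
  apply subset_antisymm
  · intro y hy
    have key (d : Fin n → ℝ) : ∀ᶠ ε in 𝓝 (0 : ℝ), y + ε • d ∈ cornerSimplex n := by
      have hc : ContinuousAt (fun ε : ℝ ↦ y + ε • d) 0 := by fun_prop
      exact hc.eventually (by simpa using mem_interior_iff_mem_nhds.1 hy)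
    obtain ⟨ε, hε, hε0⟩ := ((Filter.eventually_all.2 fun i ↦ key (-(Pi.single i 1))).filter_mono
      nhdsWithin_le_nhds |>.and (self_mem_nhdsWithin (s := Set.Ioi (0 : ℝ)))).exists
    obtain ⟨δ, hδ, hδ0⟩ := ((Filter.eventually_all.2 fun i ↦ key (Pi.single i 1)).filter_mono
      nhdsWithin_le_nhds |>.and (self_mem_nhdsWithin (s := Set.Ioi (0 : ℝ)))).exists
    refine ⟨fun i ↦ ?_, ?_⟩
    · have := (hε i).1 i
      simp at this
      linarith
    · rcases isEmpty_or_nonempty (Fin n) with h | ⟨⟨i⟩⟩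
      · simp
      · have := (hδ i).2
        simp [Finset.sum_add_distrib, ← Finset.mul_sum] at this
        linarith
  · refine interior_maximal (fun y hy ↦ ⟨fun i ↦ (hy.1 i).le, hy.2.le⟩) ?_
    have : {y : Fin n → ℝ | (∀ i, 0 < y i) ∧ ∑ i, y i < 1} =
        (⋂ i, {y | 0 < y i}) ∩ {y | ∑ i, y i < 1} := by ext; simp
    rw [this]
    exact (isOpen_iInter_of_finite fun i ↦ isOpen_lt continuous_const (continuous_apply i)).inter
      (isOpen_lt (by fun_prop) continuous_const)

lemma exists_ball_homeomorph_cornerSimplex (n : ℕ) : ∃ h : (Fin n → ℝ) ≃ₜ (Fin n → ℝ),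
    (∀ y, y ∈ Metric.ball 0 1 ↔ h y ∈ interior (cornerSimplex n)) ∧
    (∀ y, y ∈ Metric.closedBall 0 1 ↔ h y ∈ cornerSimplex n) := by
  have hb : Bornology.IsBounded (cornerSimplex n) := by
    refine (Metric.isBounded_closedBall (x := (0 : Fin n → ℝ)) (r := 1)).subset fun y hy ↦ ?_
    rw [mem_closedBall_zero_iff, pi_norm_le_iff_of_nonneg zero_le_one]
    intro i
    rw [Real.norm_of_nonneg (hy.1 i)]
    exact (Finset.single_le_sum (fun j _ ↦ hy.1 j) (Finset.mem_univ i)).trans hy.2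
  have hi : (interior (cornerSimplex n)).Nonempty := by
    rw [interior_cornerSimplex]
    refine ⟨fun _ ↦ 1 / (n + 1), fun i ↦ by positivity, ?_⟩
    simp only [Finset.sum_const, Finset.card_univ, Fintype.card_fin, nsmul_eq_mul]
    rw [mul_one_div, div_lt_one (by positivity)]
    linarith
  obtain ⟨e, h1, h2, -⟩ := exists_homeomorph_image_interior_closure_frontier_eq_unitBall
    (convex_cornerSimplex n) hi hb
  rw [(isClosed_cornerSimplex n).closure_eq] at h2
  refine ⟨e.symm, fun y ↦ ?_, fun y ↦ ?_⟩
  · rw [← h1, e.image_eq_preimage_symm]; rfl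
  · rw [← h2, e.image_eq_preimage_symm]; rfl

/-- A homeomorphism of `ℝⁿ` carrying the unit ball of the maximum norm to the corner simplex. -/
noncomputable def ballHomeo (n : ℕ) : (Fin n → ℝ) ≃ₜ (Fin n → ℝ) :=
  (exists_ball_homeomorph_cornerSimplex n).choose

lemma mem_ball_iff_ballHomeo {n : ℕ} {y : Fin n → ℝ} :
    y ∈ Metric.ball 0 1 ↔ (∀ i, 0 < ballHomeo n y i) ∧ ∑ i, ballHomeo n y i < 1 := by
  refine ((exists_ball_homeomorph_cornerSimplex n).choose_spec.1 y).trans ?_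
  exact Set.ext_iff.1 (interior_cornerSimplex n) _

lemma mem_closedBall_iff_ballHomeo {n : ℕ} {y : Fin n → ℝ} :
    y ∈ Metric.closedBall 0 1 ↔ ballHomeo n y ∈ cornerSimplex n :=
  (exists_ball_homeomorph_cornerSimplex n).choose_spec.2 y

end CornerSimplex

namespace ColouredComplex

variable {G I : Type u} [Group G] (K : ColouredComplex G I)

/-- The `n`-simplices of the complex. -/
def Face (n : ℕ) : Type u := {s : Finset (Vertex G I) // s ∈ K.simplices ∧ s.card = n + 1}

variable {K}

namespace Face

variable {n : ℕ} (s : K.Face n)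

/-- A numbering of the vertices of a simplex. -/
noncomputable def equiv : s.1 ≃ Fin (n + 1) := s.1.equivFinOfCardEq s.2.2

/-- The vertex with a given number. -/
noncomputable def vert (i : Fin (n + 1)) : Vertex G I := (s.equiv.symm i).1

lemma vert_mem (i : Fin (n + 1)) : s.vert i ∈ s.1 := (s.equiv.symm i).2

lemma exists_vert {v : Vertex G I} (hv : v ∈ s.1) : ∃ i, s.vert i = v :=
  ⟨s.equiv ⟨v, hv⟩, by rw [vert, Equiv.symm_apply_apply]⟩

lemma sum_vert (f : Vertex G I → ℝ) : ∑ i, f (s.vert i) = ∑ v ∈ s.1, f v := by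
  rw [← Finset.sum_coe_sort s.1]
  exact Equiv.sum_comp s.equiv.symm (fun v : s.1 ↦ f v)

open Classical in
/-- The function with given values on the vertices of a simplex which vanishes elsewhere. -/
noncomputable def extend (w : Fin (n + 1) → ℝ) (v : Vertex G I) : ℝ :=
  if h : v ∈ s.1 then w (s.equiv ⟨v, h⟩) else 0

lemma extend_vert (w : Fin (n + 1) → ℝ) (i : Fin (n + 1)) : s.extend w (s.vert i) = w i := by
  simp [extend, vert]

lemma extend_of_notMem (w : Fin (n + 1) → ℝ) {v : Vertex G I} (hv : v ∉ s.1) :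
    s.extend w v = 0 := dif_neg hv

/-- The weights on the vertices of a simplex given by a point of the corner simplex. -/
def weights (y : Fin n → ℝ) : Fin (n + 1) → ℝ := Fin.cons (1 - ∑ i, y i) y

lemma weights_nonneg {y : Fin n → ℝ} (hy : y ∈ cornerSimplex n) (i : Fin (n + 1)) :
    0 ≤ weights y i := by
  refine Fin.cases ?_ (fun j ↦ ?_) i
  · simpa [weights] using hy.2
  · simpa [weights] using hy.1 j

open Classical in
/-- The point of a simplex with the weights given by a point of the corner simplex. Outside the
corner simplex the value is irrelevant. -/
noncomputable def point (y : Fin n → ℝ) : K.Realization :=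
  if h : y ∈ cornerSimplex n then
    Realization.ofWeights s.2.1 (s.extend (weights y))
      (fun v ↦ by
        by_cases hv : v ∈ s.1
        · obtain ⟨i, rfl⟩ := s.exists_vert hv
          rw [extend_vert]; exact weights_nonneg h i
        · rw [extend_of_notMem _ _ hv])
      (fun v hv ↦ s.extend_of_notMem _ hv)
      (by rw [← s.sum_vert]; simp only [extend_vert]; rw [Fin.sum_univ_succ]; simp [weights])
  else Realization.vertex K (s.vert 0)

lemma point_apply_vert {y : Fin n → ℝ} (hy : y ∈ cornerSimplex n) (i : Fin (n + 1)) :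
    s.point y (s.vert i) = weights y i := by
  rw [point, dif_pos hy]
  exact s.extend_vert _ i

lemma supp_point_subset (y : Fin n → ℝ) : (s.point y).supp ⊆ s.1 := by
  by_cases hy : y ∈ cornerSimplex n
  · rw [point, dif_pos hy]
    exact Realization.supp_ofWeights_subset _ _ _ _ _
  · rw [point, dif_neg hy, Realization.supp_vertex, Finset.singleton_subset_iff]
    exact s.vert_mem 0

lemma point_apply_of_notMem (y : Fin n → ℝ) {v : Vertex G I} (hv : v ∉ s.1) : s.point y v = 0 :=
  Realization.eq_zero_of_notMem fun h ↦ hv (s.supp_point_subset y h)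

lemma supp_point_eq_iff {y : Fin n → ℝ} (hy : y ∈ cornerSimplex n) :
    (s.point y).supp = s.1 ↔ (∀ i, 0 < y i) ∧ ∑ i, y i < 1 := by
  have h1 : (s.point y).supp = s.1 ↔ ∀ i, 0 < weights y i := by
    refine ⟨fun h i ↦ ?_, fun h ↦ subset_antisymm (s.supp_point_subset y) fun v hv ↦ ?_⟩
    · rw [← s.point_apply_vert hy, ← Realization.mem_supp, h]; exact s.vert_mem i
    · obtain ⟨i, rfl⟩ := s.exists_vert hv
      rw [Realization.mem_supp, s.point_apply_vert hy]; exact h i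
  rw [h1, Fin.forall_fin_succ]
  simp [weights, and_comm]

/-- The coordinates in the corner simplex of a point of the realization. -/
noncomputable def coords (x : K.Realization) (i : Fin n) : ℝ := x (s.vert i.succ)

lemma continuous_coords : Continuous s.coords :=
  continuous_pi fun _ ↦ Realization.continuous_apply _

lemma coords_point {y : Fin n → ℝ} (hy : y ∈ cornerSimplex n) : s.coords (s.point y) = y := by
  ext i
  rw [coords, s.point_apply_vert hy]; rfl

lemma weights_coords {x : K.Realization} (hx : x.supp ⊆ s.1) (i : Fin (n + 1)) :
    weights (s.coords x) i = x (s.vert i) := by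
  refine Fin.cases ?_ (fun j ↦ rfl) i
  have := Realization.sum_eq_one_of_supp_subset hx
  rw [← s.sum_vert, Fin.sum_univ_succ] at this
  simp only [weights, coords, Fin.cons_zero]
  linarith

lemma coords_mem {x : K.Realization} (hx : x.supp ⊆ s.1) : s.coords x ∈ cornerSimplex n := by
  refine ⟨fun i ↦ x.nonneg _, ?_⟩
  have := s.weights_coords hx 0
  have h0 := x.nonneg (s.vert 0)
  rw [← this] at h0
  simpa [weights] using h0

lemma point_coords {x : K.Realization} (hx : x.supp ⊆ s.1) : s.point (s.coords x) = x := by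
  refine Realization.ext_apply fun v ↦ ?_
  by_cases hv : v ∈ s.1
  · obtain ⟨i, rfl⟩ := s.exists_vert hv
    rw [s.point_apply_vert (s.coords_mem hx), s.weights_coords hx]
  · rw [s.point_apply_of_notMem _ hv, Realization.eq_zero_of_notMem fun h ↦ hv (hx h)]

lemma continuousOn_point : ContinuousOn s.point (cornerSimplex n) := by
  rw [continuousOn_iff_continuous_domRestrict, Realization.continuous_iff]
  intro v
  by_cases hv : v ∈ s.1
  · obtain ⟨i, rfl⟩ := s.exists_vert hv
    have : (fun y : cornerSimplex n ↦ (cornerSimplex n).domRestrict s.point y (s.vert i)) =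
        fun y : cornerSimplex n ↦ weights y.1 i := funext fun y ↦ s.point_apply_vert y.2 i
    rw [this]
    refine Fin.cases ?_ (fun j ↦ ?_) i
    · simp only [weights, Fin.cons_zero]; fun_prop
    · simp only [weights, Fin.cons_succ]; exact (continuous_apply j).comp continuous_subtype_val
  · have : (fun y : cornerSimplex n ↦ (cornerSimplex n).domRestrict s.point y v) = fun _ ↦ 0 :=
      funext fun y ↦ s.point_apply_of_notMem _ hv
    rw [this]; exact continuous_const

/-- The characteristic map of a simplex. -/
noncomputable def charMap : PartialEquiv (Fin n → ℝ) K.Realization where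
  toFun y := s.point (ballHomeo n y)
  invFun x := (ballHomeo n).symm (s.coords x)
  source := Metric.ball 0 1
  target := {x | x.supp = s.1}
  map_source' y hy := (s.supp_point_eq_iff (mem_closedBall_iff_ballHomeo.1
    (Metric.ball_subset_closedBall hy))).2 (mem_ball_iff_ballHomeo.1 hy)
  map_target' x hx := by
    have hx' : x.supp ⊆ s.1 := subset_of_eq hx
    rw [mem_ball_iff_ballHomeo, Homeomorph.apply_symm_apply,
      ← s.supp_point_eq_iff (s.coords_mem hx'), s.point_coords hx']
    exact hx
  left_inv' y hy := by
    rw [s.coords_point (mem_closedBall_iff_ballHomeo.1 (Metric.ball_subset_closedBall hy)),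
      Homeomorph.symm_apply_apply]
  right_inv' x hx := by
    rw [Homeomorph.apply_symm_apply, s.point_coords (subset_of_eq hx)]

lemma charMap_image_ball : s.charMap '' Metric.ball 0 1 = {x | x.supp = s.1} :=
  s.charMap.image_source_eq_target

lemma charMap_image_closedBall : s.charMap '' Metric.closedBall 0 1 = {x | x.supp ⊆ s.1} := by
  ext x
  refine ⟨?_, fun hx ↦ ⟨(ballHomeo n).symm (s.coords x), ?_, ?_⟩⟩
  · rintro ⟨y, -, rfl⟩
    exact s.supp_point_subset _
  · rw [mem_closedBall_iff_ballHomeo, Homeomorph.apply_symm_apply]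
    exact s.coords_mem hx
  · change s.point (ballHomeo n _) = x
    rw [Homeomorph.apply_symm_apply, s.point_coords hx]

lemma supp_ssubset_of_mem_sphere {y : Fin n → ℝ} (hy : y ∈ Metric.sphere 0 1) :
    (s.charMap y).supp ⊂ s.1 := by
  refine lt_of_le_of_ne (s.supp_point_subset _) fun h ↦ ?_
  have := mem_ball_iff_ballHomeo.2 ((s.supp_point_eq_iff (mem_closedBall_iff_ballHomeo.1
    (Metric.sphere_subset_closedBall hy))).1 h)
  rw [Metric.mem_ball] at this
  exact this.ne hy

end Face

namespace Realization

/-- The simplex carrying a point. -/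
noncomputable def carrier (x : K.Realization) : K.Face (x.supp.card - 1) :=
  ⟨x.supp, x.supp_mem, (Nat.succ_pred_eq_of_pos x.supp_nonempty.card_pos).symm⟩

lemma finite_subfaces (s : Finset (Vertex G I)) (m : ℕ) : {t : K.Face m | t.1 ⊆ s}.Finite := by
  refine Set.Finite.of_finite_image (f := Subtype.val) ?_ Subtype.val_injective.injOn
  refine (Finset.finite_toSet s.powerset).subset ?_
  rintro _ ⟨t, ht, rfl⟩
  simpa using ht

/-- The cell structure whose open cells are the open simplices. -/
noncomputable instance : CWComplex (Set.univ : Set K.Realization) where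
  cell := K.Face
  map _ s := s.charMap
  source_eq _ _ := rfl
  continuousOn n s := s.continuousOn_point.comp (ballHomeo n).continuous.continuousOn
    fun _ hy ↦ mem_closedBall_iff_ballHomeo.1 hy
  continuousOn_symm n s := ((ballHomeo n).symm.continuous.comp s.continuous_coords).continuousOn
  pairwiseDisjoint' := by
    rintro ⟨n, s⟩ - ⟨m, t⟩ - hne
    simp only [Function.onFun, Face.charMap_image_ball]
    refine Set.disjoint_left.2 fun x (hx : x.supp = s.1) (hx' : x.supp = t.1) ↦ hne ?_
    have hst := hx.symm.trans hx'
    obtain rfl : n = m := by have := s.2.2; have := t.2.2; rw [hst] at *; omega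
    exact congrArg _ (Subtype.ext hst)
  mapsTo' n s := by
    refine ⟨fun m ↦ (finite_subfaces s.1 m).toFinset, fun y hy ↦ ?_⟩
    have h := s.supp_ssubset_of_mem_sphere hy
    have hc := Finset.card_lt_card h
    have hp := (s.charMap y).supp_nonempty.card_pos
    rw [s.2.2] at hc
    simp only [Set.mem_iUnion]
    refine ⟨_, by omega, (s.charMap y).carrier, ?_, ?_⟩
    · exact (Set.Finite.mem_toFinset _).2 h.subset
    · rw [Face.charMap_image_closedBall]; exact fun _ ↦ id
  closed' A _ hA := by
    simp only [Face.charMap_image_closedBall] at hA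
    have hlf : LocallyFinite fun s : K.simplices ↦ {x : K.Realization | x.supp ⊆ s.1} := by
      intro x
      obtain ⟨v, hv⟩ := x.supp_nonempty
      refine ⟨star K v, (isOpen_star v).mem_nhds (mem_supp.1 hv), ?_⟩
      refine Set.Finite.of_finite_image (f := Subtype.val) ?_ Subtype.val_injective.injOn
      refine (K.finite_star v).subset ?_
      rintro _ ⟨s, ⟨y, hy, hyv⟩, rfl⟩
      exact ⟨s.2, hy (mem_supp.2 hyv)⟩
    have hA' : A = ⋃ s : K.simplices, A ∩ {x : K.Realization | x.supp ⊆ s.1} := by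
      rw [← Set.inter_iUnion, Set.left_eq_inter]
      exact fun x _ ↦ Set.mem_iUnion.2 ⟨⟨x.supp, x.supp_mem⟩, fun _ ↦ id⟩
    rw [hA']
    refine (hlf.subset fun s ↦ Set.inter_subset_right).isClosed_iUnion fun s ↦ ?_
    exact hA (s.1.card - 1)
      ⟨s.1, s.2, (Nat.succ_pred_eq_of_pos (K.nonempty s.2).card_pos).symm⟩
  union' := by
    refine Set.eq_univ_of_forall fun x ↦ Set.mem_iUnion.2 ⟨_, Set.mem_iUnion.2 ⟨x.carrier, ?_⟩⟩
    rw [Face.charMap_image_closedBall]; exact fun _ ↦ id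

open CWComplex

lemma openCell_eq {n : ℕ} (s : K.Face n) :
    openCell (C := (Set.univ : Set K.Realization)) n s = {x | x.supp = s.1} :=
  s.charMap_image_ball

/-- Translation of the simplices. -/
def _root_.ColouredComplex.Face.translate {n : ℕ} (g : G) (s : K.Face n) : K.Face n :=
  ⟨Vertex.translate g s.1, K.translate_mem g s.2.1, by rw [Vertex.translate, Finset.card_map, s.2.2]⟩

lemma smul_openCell {n : ℕ} (g : G) (s : K.Face n) :
    g • openCell (C := (Set.univ : Set K.Realization)) n s =
      openCell (C := (Set.univ : Set K.Realization)) n (s.translate g) := by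
  rw [openCell_eq, openCell_eq]
  ext x
  rw [Set.mem_smul_set_iff_inv_smul_mem]
  simp only [Set.mem_ofPred_eq, supp_smul, Face.translate]
  have (t s : Finset (Vertex G I)) : Vertex.translate g⁻¹ t = s ↔ t = Vertex.translate g s := by
    constructor
    · rintro rfl; ext v; simp [Vertex.mem_translate]
    · rintro rfl; ext v; simp [Vertex.mem_translate]
  exact this _ _

instance : IsGCWComplex G K.Realization where
  exists_smul_openCell_eq g n s := ⟨s.translate g, smul_openCell g s⟩
  smul_eq_of_smul_openCell_subset g n s h x hx := by
    have h1 : (g • x).supp = x.supp := by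
      have := h (Set.smul_mem_smul_set hx)
      rw [openCell_eq] at this hx
      exact this.trans hx.symm
    rw [smul_eq_self h1, one_smul]

lemma mem_gSkeletonLT {n : ℕ} {x : K.Realization} :
    x ∈ gSkeletonLT G K.Realization n ↔ x.supp.card ≤ n := by
  change x ∈ (skeletonLT (Set.univ : Set K.Realization) (n : ℕ∞) : Set K.Realization) ↔ _
  rw [← CWComplex.iUnion_openCell_eq_skeletonLT]
  simp only [Set.mem_iUnion, openCell_eq]
  constructor
  · rintro ⟨m, hm, s, hs⟩
    rw [Set.mem_ofPred_eq] at hs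
    rw [hs, s.2.2]
    exact_mod_cast hm
  · intro h
    have hp := x.supp_nonempty.card_pos
    exact ⟨_, by exact_mod_cast (by omega : x.supp.card - 1 < n), x.carrier, rfl⟩

lemma isFiniteGCWComplex [Finite I] : IsFiniteGCWComplex G K.Realization := by
  have hfin : (⋃ i : I, {s | s ∈ K.simplices ∧ (⟨1, i⟩ : Vertex G I) ∈ s}).Finite :=
    Set.finite_iUnion fun i ↦ K.finite_star _
  refine (hfin.image fun s ↦ MulAction.orbit G {x : K.Realization | x.supp = s}).subset ?_
  rintro _ ⟨n, s, rfl⟩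
  obtain ⟨v, hv⟩ := K.nonempty s.2.1
  refine ⟨Vertex.translate v.elt⁻¹ s.1, Set.mem_iUnion.2 ⟨v.colour, K.translate_mem _ s.2.1, ?_⟩, ?_⟩
  · rw [Vertex.mem_translate, Vertex.smul_mk, inv_inv, mul_one]; exact hv
  · have := smul_openCell v.elt⁻¹ s
    rw [openCell_eq (s.translate _)] at this
    change MulAction.orbit G {x : K.Realization | x.supp = (s.translate v.elt⁻¹).1} = _
    rw [← this]
    exact MulAction.orbit_smul _ _

end Realization

end ColouredComplex

/-! ### One-chains modulo boundaries -/

section AffineMaps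

lemma stdSimplex_sum_map_mul {m n : ℕ} (f : Fin m → Fin n) (t : stdSimplex ℝ (Fin m))
    (w : Fin n → ℝ) : ∑ j, stdSimplex.map f t j * w j = ∑ i, t i * w (f i) := by
  classical
  simp only [stdSimplex.map_coe, FunOnFinite.linearMap_apply_apply, Finset.sum_mul]
  rw [← Finset.sum_fiberwise Finset.univ f (fun i ↦ t i * w (f i))]
  refine Finset.sum_congr rfl fun j _ ↦ Finset.sum_congr rfl fun i hi ↦ ?_
  rw [(Finset.mem_filter.1 hi).2]

lemma stdSimplex_continuous_apply {n : ℕ} (i : Fin n) :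
    Continuous fun t : stdSimplex ℝ (Fin n) ↦ t i :=
  (continuous_apply i).comp continuous_subtype_val

/-- The affine map `Δⁿ → Δᵐ` with prescribed values at the vertices. -/
def stdAffine {m n : ℕ} (p : Fin (n + 1) → StdSimp m) : C(StdSimp n, StdSimp m) where
  toFun t := ⟨fun j ↦ ∑ i, t i * p i j, fun j ↦ Finset.sum_nonneg fun i _ ↦
    mul_nonneg (t.2.1 i) ((p i).2.1 j), by
      rw [Finset.sum_comm]
      simp only [← Finset.mul_sum, stdSimplex.sum_eq_one, mul_one]⟩
  continuous_toFun := by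
    refine Continuous.subtype_mk (continuous_pi fun j ↦ continuous_finsetSum _ fun i _ ↦ ?_) _
    exact (stdSimplex_continuous_apply i).mul continuous_const

lemma stdAffine_apply {m n : ℕ} (p : Fin (n + 1) → StdSimp m) (t : StdSimp n) (j : Fin (m + 1)) :
    stdAffine p t j = ∑ i, t i * p i j := rfl

lemma stdAffine_comp_map {m n : ℕ} (p : Fin (n + 2) → StdSimp m) (i : Fin (n + 2)) :
    (stdAffine p).comp ⟨stdSimplex.map i.succAbove, stdSimplex.continuous_map _⟩ =
      stdAffine fun j ↦ p (i.succAbove j) := by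
  ext t j
  exact stdSimplex_sum_map_mul i.succAbove t fun k ↦ p k j

/-- The two vertices of `Δ¹`. -/
abbrev stdVertex (i : Fin 2) : StdSimp 1 := stdSimplex.vertex i

lemma stdAffine_apply_vertex {m : ℕ} (p : Fin 2 → StdSimp m) (k : Fin 2) :
    stdAffine p (stdVertex k) = p k := by
  ext j
  rw [stdAffine_apply, Fin.sum_univ_two]
  fin_cases k <;> simp

lemma stdAffine_stdVertex : stdAffine stdVertex = ContinuousMap.id (StdSimp 1) := by
  ext t j
  rw [stdAffine_apply, Fin.sum_univ_two]
  fin_cases j <;> simp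

end AffineMaps

section PathClass

variable (G X : Type u) [Group G] [TopologicalSpace X] [MulAction G X] [ContinuousConstSMul G X]

/-- The singular `1`-chains modulo boundaries. -/
abbrev PathModule : Type u :=
  SingularChains G X 1 ⧸ LinearMap.range (singularBoundary G X 2 1)

variable {X}

/-- The class of a path modulo boundaries. -/
noncomputable def pathClass (σ : C(StdSimp 1, X)) : PathModule G X :=
  Submodule.Quotient.mk (chainGen G σ)

lemma pathClass_triangle (τ : C(StdSimp 2, X)) :
    pathClass G (singFace τ 2) + pathClass G (singFace τ 0) = pathClass G (singFace τ 1) := by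
  have h : (Submodule.Quotient.mk (singularBoundary G X 2 1 (chainGen G τ)) : PathModule G X) = 0 :=
    (Submodule.Quotient.mk_eq_zero _).2 ⟨_, rfl⟩
  rw [singularBoundary_chainGen, Fin.sum_univ_three] at h
  simp only [Fin.val_zero, pow_zero, one_smul, Fin.val_one, pow_one, neg_smul, Fin.val_two, even_two,
    Even.neg_pow, one_pow, Submodule.Quotient.mk_add, Submodule.Quotient.mk_neg] at h
  change pathClass G _ + -pathClass G _ + pathClass G _ = 0 at h
  rw [← sub_eq_zero, ← h]
  abel

lemma pathClass_const (x : X) : pathClass G (ContinuousMap.const _ x) = 0 := by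
  have h := pathClass_triangle G (ContinuousMap.const (StdSimp 2) x)
  exact add_eq_left.1 h

/-- The restriction of a path to the segment between two points of its parameter interval `Δ¹`. -/
noncomputable def subPath (f : C(StdSimp 1, X)) (a b : StdSimp 1) : C(StdSimp 1, X) :=
  f.comp (stdAffine ![a, b])

lemma pathClass_subPath (f : C(StdSimp 1, X)) (a b c : StdSimp 1) :
    pathClass G (subPath f a b) + pathClass G (subPath f b c) = pathClass G (subPath f a c) := by
  have h := pathClass_triangle G (f.comp (stdAffine ![a, b, c]))
  simp only [singFace, ContinuousMap.comp_assoc, stdAffine_comp_map] at h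
  convert h using 4
  all_goals congr 1

lemma subPath_vertices (f : C(StdSimp 1, X)) : subPath f (stdVertex 0) (stdVertex 1) = f := by
  have : ![stdVertex 0, stdVertex 1] = stdVertex := by ext k : 1; fin_cases k <;> rfl
  rw [subPath, this, stdAffine_stdVertex]
  rfl

/-- The two ways around a singular square agree modulo boundaries. -/
lemma pathClass_square (H : C(StdSimp 1 × StdSimp 1, X)) :
    pathClass G (H.comp ((ContinuousMap.id _).prodMk (.const _ (stdVertex 0)))) +
        pathClass G (H.comp ((ContinuousMap.const _ (stdVertex 1)).prodMk (.id _))) =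
      pathClass G (H.comp ((ContinuousMap.const _ (stdVertex 0)).prodMk (.id _))) +
        pathClass G (H.comp ((ContinuousMap.id _).prodMk (.const _ (stdVertex 1)))) := by
  let a : C(StdSimp 2, StdSimp 1) := stdAffine ![stdVertex 0, stdVertex 0, stdVertex 1]
  let b : C(StdSimp 2, StdSimp 1) := stdAffine ![stdVertex 0, stdVertex 1, stdVertex 1]
  have ha := pathClass_triangle G (H.comp (b.prodMk a))
  have hb := pathClass_triangle G (H.comp (a.prodMk b))
  have face (p q : C(StdSimp 2, StdSimp 1)) (i : Fin 3) : singFace (H.comp (p.prodMk q)) i =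
      H.comp ((singFace p i).prodMk (singFace q i)) := rfl
  have face' (p : Fin 3 → StdSimp 1) (i : Fin 3) : singFace (stdAffine p) i =
      stdAffine fun j ↦ p (i.succAbove j) := stdAffine_comp_map p i
  have hconst (v : StdSimp 1) : stdAffine (fun _ : Fin 2 ↦ v) = ContinuousMap.const _ v := by
    ext t j
    rw [stdAffine_apply, Fin.sum_univ_two, ← add_mul, stdSimplex.add_eq_one, one_mul]; rfl
  have a0 : singFace a 0 = .id _ := by
    rw [face', ← stdAffine_stdVertex]; congr 1; ext k : 1; fin_cases k <;> rfl
  have a1 : singFace a 1 = .id _ := by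
    rw [face', ← stdAffine_stdVertex]; congr 1; ext k : 1; fin_cases k <;> rfl
  have a2 : singFace a 2 = .const _ (stdVertex 0) := by
    rw [face', ← hconst]; congr 1; ext k : 1; fin_cases k <;> rfl
  have b0 : singFace b 0 = .const _ (stdVertex 1) := by
    rw [face', ← hconst]; congr 1; ext k : 1; fin_cases k <;> rfl
  have b1 : singFace b 1 = .id _ := by
    rw [face', ← stdAffine_stdVertex]; congr 1; ext k : 1; fin_cases k <;> rfl
  have b2 : singFace b 2 = .id _ := by
    rw [face', ← stdAffine_stdVertex]; congr 1; ext k : 1; fin_cases k <;> rfl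
  rw [face, face, face, a0, a1, a2, b0, b1, b2] at ha hb
  rw [ha, hb]

/-- The boundary of a path is its end point minus its starting point. -/
lemma singularBoundary_chainGen_one (σ : C(StdSimp 1, X)) :
    singularBoundary G X 1 0 (chainGen G σ) =
      chainGen G (ContinuousMap.const _ (σ (stdVertex 1))) -
        chainGen G (ContinuousMap.const _ (σ (stdVertex 0))) := by
  have h (i : Fin 2) : singFace σ i = ContinuousMap.const _ (σ (stdVertex (i.succAbove 0))) := by
    ext t
    refine congrArg σ ?_
    obtain rfl : t = stdSimplex.vertex 0 := Subsingleton.elim _ _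
    exact stdSimplex.map_vertex _ _
  rw [singularBoundary_chainGen, Fin.sum_univ_two, h 0, h 1]
  simp [sub_eq_add_neg]

/-- Modulo a subgroup of the path module, a path is the difference of the values of a function `p` at
its end points as soon as this holds for all paths which are short, locally along it. -/
lemma pathClass_mem_of_locally (J : AddSubgroup (PathModule G X)) (p : X → PathModule G X)
    (f : C(StdSimp 1, X))
    (h : ∀ a : StdSimp 1, ∃ U : Set X, IsOpen U ∧ f a ∈ U ∧ ∀ g : C(StdSimp 1, X), (∀ t, g t ∈ U) →
      pathClass G g + p (g (stdVertex 0)) - p (g (stdVertex 1)) ∈ J) :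
    pathClass G f + p (f (stdVertex 0)) - p (f (stdVertex 1)) ∈ J := by
  let P (a b : StdSimp 1) : Prop := pathClass G (subPath f a b) + p (f a) - p (f b) ∈ J
  have hP : ∀ a b, P a b := by
    intro a b
    refine PreconnectedSpace.induction₂' P (fun a ↦ ?_) ⟨fun a b c hab hbc ↦ ?_⟩ a b
    · obtain ⟨U, hU, haU, hg⟩ := h a
      obtain ⟨ε, hε, hball⟩ := Metric.isOpen_iff.1 (hU.preimage f.continuous) a haU
      filter_upwards [Metric.ball_mem_nhds a hε] with b hb
      have hs (t : StdSimp 1) {c d : StdSimp 1} (hc : c ∈ Metric.ball a ε)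
          (hd : d ∈ Metric.ball a ε) : subPath f c d t ∈ U := by
        refine hball ?_
        have hv : (stdAffine ![c, d] t).1 = t.1 0 • c.1 + t.1 1 • d.1 := by
          ext j
          exact Fin.sum_univ_two fun i ↦ t i * (![c, d] i) j
        have := convex_ball a.1 ε (x := c.1) hc (y := d.1) hd (t.2.1 0) (t.2.1 1)
          (stdSimplex.add_eq_one t)
        rwa [← hv] at this
      have hend (c d : StdSimp 1) (k : Fin 2) : subPath f c d (stdVertex k) = f (![c, d] k) :=
        congrArg f (stdAffine_apply_vertex _ k)
      have ha := Metric.mem_ball_self (x := a) hε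
      have h1 := hg (subPath f a b) fun t ↦ hs t ha hb
      have h2 := hg (subPath f b a) fun t ↦ hs t hb ha
      rw [hend, hend] at h1 h2
      exact ⟨h1, h2⟩
    · have := add_mem hab hbc
      change pathClass G (subPath f a c) + p (f a) - p (f c) ∈ J
      rw [← pathClass_subPath G f a b c]
      convert this using 1
      abel
  have := hP (stdVertex 0) (stdVertex 1)
  dsimp only [P] at this
  rwa [subPath_vertices] at this

end PathClass

/-! ### Affine simplices and edge paths in the realization -/

namespace ColouredComplex

variable {G I : Type u} [Group G] {K : ColouredComplex G I}

namespace Realization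

/-- The points of a finite family lie in a common closed simplex. -/
def IsFlat {n : ℕ} (p : Fin (n + 1) → K.Realization) : Prop :=
  ∃ s ∈ K.simplices, ∀ i, (p i).supp ⊆ s

lemma IsFlat.comp {m n : ℕ} {p : Fin (n + 1) → K.Realization} (h : IsFlat p)
    (f : Fin (m + 1) → Fin (n + 1)) : IsFlat fun i ↦ p (f i) :=
  ⟨h.choose, h.choose_spec.1, fun i ↦ h.choose_spec.2 (f i)⟩

/-- The affine singular simplex with given vertices in a common closed simplex. -/
noncomputable def affine {n : ℕ} (p : Fin (n + 1) → K.Realization) (h : IsFlat p) :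
    C(StdSimp n, K.Realization) where
  toFun t := ⟨fun v ↦ ∑ i, t i * p i v,
    fun v ↦ Finset.sum_nonneg fun i _ ↦ mul_nonneg (t.2.1 i) ((p i).nonneg v), h.choose,
    h.choose_spec.1, fun v hv ↦ Finset.sum_eq_zero fun i _ ↦ by
      rw [eq_zero_of_notMem fun h' ↦ hv (h.choose_spec.2 i h'), mul_zero], by
      rw [Finset.sum_comm]
      simp only [← Finset.mul_sum, sum_eq_one_of_supp_subset (h.choose_spec.2 _), mul_one,
        stdSimplex.sum_eq_one]⟩
  continuous_toFun := continuous_iff.2 fun v ↦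
    show Continuous fun t : StdSimp n ↦ ∑ i, t i * p i v from
      continuous_finsetSum _ fun i _ ↦ (stdSimplex_continuous_apply i).mul continuous_const

lemma affine_apply {n : ℕ} (p : Fin (n + 1) → K.Realization) (h : IsFlat p) (t : StdSimp n)
    (v : Vertex G I) : affine p h t v = ∑ i, t i * p i v := rfl

lemma supp_affine_subset {n : ℕ} {p : Fin (n + 1) → K.Realization} (h : IsFlat p)
    {s : Finset (Vertex G I)} (hs : ∀ i, (p i).supp ⊆ s) (t : StdSimp n) :
    (affine p h t).supp ⊆ s := fun v hv ↦ by_contra fun hn ↦ (mem_supp.1 hv).ne' <| by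
      rw [affine_apply]
      exact Finset.sum_eq_zero fun i _ ↦ by
        rw [eq_zero_of_notMem fun h' ↦ hn (hs i h'), mul_zero]

lemma singFace_affine {n : ℕ} (p : Fin (n + 2) → K.Realization) (h : IsFlat p) (i : Fin (n + 2)) :
    singFace (affine p h) i = affine (fun j ↦ p (i.succAbove j)) (h.comp _) := by
  refine ContinuousMap.ext fun t ↦ ?_
  exact ext_apply fun v ↦ stdSimplex_sum_map_mul i.succAbove t fun k ↦ p k v

lemma affine_apply_vertex {p : Fin 2 → K.Realization} (h : IsFlat p) (k : Fin 2) :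
    affine p h (stdVertex k) = p k := by
  refine ext_apply fun v ↦ ?_
  rw [affine_apply, Fin.sum_univ_two]
  fin_cases k <;> simp

lemma smulSimplex_affine {n : ℕ} (g : G) (p : Fin (n + 1) → K.Realization) (h : IsFlat p)
    (h' : IsFlat fun i ↦ g • p i) :
    smulSimplex G g (affine p h) = affine (fun i ↦ g • p i) h' := rfl

/-- The segment between two points of a common closed simplex. -/
noncomputable def seg (x y : K.Realization) (h : IsFlat ![x, y]) : C(StdSimp 1, K.Realization) :=
  affine ![x, y] h

lemma seg_self (x : K.Realization) (h : IsFlat ![x, x]) :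
    seg x x h = ContinuousMap.const _ x := by
  refine ContinuousMap.ext fun t ↦ ext_apply fun v ↦ ?_
  rw [seg, affine_apply, Fin.sum_univ_two]
  exact (add_mul _ _ (x v)).symm.trans (by rw [stdSimplex.add_eq_one, one_mul]; rfl)

lemma isFlat_pair {x y : K.Realization} {s : Finset (Vertex G I)} (hs : s ∈ K.simplices)
    (hx : x.supp ⊆ s) (hy : y.supp ⊆ s) : IsFlat ![x, y] :=
  ⟨s, hs, fun i ↦ by fin_cases i <;> assumption⟩

lemma isFlat_triple {x y z : K.Realization} {s : Finset (Vertex G I)} (hs : s ∈ K.simplices)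
    (hx : x.supp ⊆ s) (hy : y.supp ⊆ s) (hz : z.supp ⊆ s) : IsFlat ![x, y, z] :=
  ⟨s, hs, fun i ↦ by fin_cases i <;> assumption⟩

lemma singFace_affine_triple {x y z : K.Realization} (h : IsFlat ![x, y, z]) (hxy : IsFlat ![x, y])
    (hyz : IsFlat ![y, z]) (hxz : IsFlat ![x, z]) :
    singFace (affine ![x, y, z] h) 0 = seg y z hyz ∧
    singFace (affine ![x, y, z] h) 1 = seg x z hxz ∧
    singFace (affine ![x, y, z] h) 2 = seg x y hxy := by
  refine ⟨?_, ?_, ?_⟩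
  all_goals
    rw [singFace_affine, seg]
    congr 1
    try (funext k; fin_cases k <;> rfl)

lemma pathClass_seg_add {x y z : K.Realization} (h : IsFlat ![x, y, z]) (hxy : IsFlat ![x, y])
    (hyz : IsFlat ![y, z]) (hxz : IsFlat ![x, z]) :
    pathClass G (seg x y hxy) + pathClass G (seg y z hyz) = pathClass G (seg x z hxz) := by
  obtain ⟨h0, h1, h2⟩ := singFace_affine_triple h hxy hyz hxz
  rw [← h0, ← h1, ← h2]
  exact pathClass_triangle G _

lemma vertex_isFlat_of_adj {v w : Vertex G I} (h : K.Adj v w) :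
    IsFlat ![vertex K v, vertex K w] := by
  obtain ⟨s, hs, hv, hw⟩ := h
  exact isFlat_pair hs (by rwa [supp_vertex, Finset.singleton_subset_iff])
    (by rwa [supp_vertex, Finset.singleton_subset_iff])

/-- The segment between two adjacent vertices. -/
noncomputable def edge {v w : Vertex G I} (h : K.Adj v w) : C(StdSimp 1, K.Realization) :=
  seg (vertex K v) (vertex K w) (vertex_isFlat_of_adj h)

lemma isFlat_vertex_of_mem {x : K.Realization} {v : Vertex G I} (h : v ∈ x.supp) :
    IsFlat ![vertex K v, x] :=
  isFlat_pair x.supp_mem (by rwa [supp_vertex, Finset.singleton_subset_iff]) fun _ ↦ id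

/-- The segment from a vertex to a point of its open star. -/
noncomputable def ray {x : K.Realization} {v : Vertex G I} (h : v ∈ x.supp) :
    C(StdSimp 1, K.Realization) :=
  seg (vertex K v) x (isFlat_vertex_of_mem h)

lemma pathClass_edge_add_ray {x : K.Realization} {v w : Vertex G I} (hv : v ∈ x.supp)
    (hw : w ∈ x.supp) : pathClass G (edge ⟨x.supp, x.supp_mem, hv, hw⟩) + pathClass G (ray hw) =
      pathClass G (ray hv) :=
  pathClass_seg_add (isFlat_triple x.supp_mem (by rwa [supp_vertex, Finset.singleton_subset_iff])
    (by rwa [supp_vertex, Finset.singleton_subset_iff]) fun _ ↦ id) _ _ _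

/-- The cone over a path in the open star of a vertex. -/
noncomputable def cone {v : Vertex G I} (f : C(StdSimp 1, K.Realization)) (hf : ∀ t, v ∈ (f t).supp) :
    C(StdSimp 1 × StdSimp 1, K.Realization) where
  toFun r := ray (hf r.2) r.1
  continuous_toFun := by
    refine continuous_iff.2 fun w ↦ ?_
    have : (fun r : StdSimp 1 × StdSimp 1 ↦ ray (hf r.2) r.1 w) =
        fun r ↦ r.1 0 * vertex K v w + r.1 1 * f r.2 w := funext fun r ↦ by
      rw [ray, seg, affine_apply, Fin.sum_univ_two]; rfl
    rw [this]
    exact (((stdSimplex_continuous_apply 0).comp continuous_fst).mul continuous_const).add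
      (((stdSimplex_continuous_apply 1).comp continuous_fst).mul
        ((continuous_apply w).comp (f.continuous.comp continuous_snd)))

/-- A path in the open star of a vertex is homologous to the difference of the segments joining
this vertex to the end points. -/
lemma pathClass_of_mem_star {v : Vertex G I} (f : C(StdSimp 1, K.Realization))
    (hf : ∀ t, v ∈ (f t).supp) : pathClass G f =
      pathClass G (ray (hf (stdVertex 1))) - pathClass G (ray (hf (stdVertex 0))) := by
  have h := pathClass_square G (cone f hf)
  have h1 : (cone f hf).comp ((ContinuousMap.const _ (stdVertex 1)).prodMk (.id _)) = f := by
    refine ContinuousMap.ext fun t ↦ ?_; exact affine_apply_vertex (isFlat_vertex_of_mem (hf t)) 1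
  have h2 : (cone f hf).comp ((ContinuousMap.const _ (stdVertex 0)).prodMk (.id _)) =
      .const _ (vertex K v) := by
    refine ContinuousMap.ext fun t ↦ ?_; exact affine_apply_vertex (isFlat_vertex_of_mem (hf t)) 0
  rw [h1, h2, pathClass_const, zero_add] at h
  exact eq_sub_iff_add_eq'.2 h

/-- The subgroup of the path module generated by the edges. -/
noncomputable def edgeSubgroup (K : ColouredComplex G I) : AddSubgroup (PathModule G K.Realization) :=
  AddSubgroup.closure {c | ∃ (v w : Vertex G I) (h : K.Adj v w), c = pathClass G (edge h)}

lemma pathClass_edge_mem {v w : Vertex G I} (h : K.Adj v w) :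
    pathClass G (edge h) ∈ edgeSubgroup K := AddSubgroup.subset_closure ⟨v, w, h, rfl⟩

variable [LinearOrder I]

/-- The segment from the base vertex of a point to the point. -/
noncomputable def baseRay (x : K.Realization) : PathModule G K.Realization :=
  pathClass G (ray x.base_mem)

/-- Modulo edges, a path is determined by its end points: it is the difference of the base rays of
its end points. Locally the path lies in the open star of a vertex, where this is clear. -/
lemma pathClass_add_baseRay_sub_baseRay_mem (f : C(StdSimp 1, K.Realization)) :
    pathClass G f + baseRay (f (stdVertex 0)) - baseRay (f (stdVertex 1)) ∈ edgeSubgroup K := by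
  refine pathClass_mem_of_locally G (edgeSubgroup K) baseRay f fun a ↦ ?_
  obtain ⟨v, hv⟩ := (f a).supp_nonempty
  refine ⟨star K v, isOpen_star v, mem_supp.1 hv, fun g hg ↦ ?_⟩
  have hg' : ∀ t, v ∈ (g t).supp := fun t ↦ mem_supp.2 (hg t)
  rw [pathClass_of_mem_star g hg', baseRay, baseRay, ← pathClass_edge_add_ray (base_mem _) (hg' _),
    ← pathClass_edge_add_ray (base_mem _) (hg' (stdVertex 1))]
  convert sub_mem (pathClass_edge_mem (K := K) ⟨_, supp_mem _, base_mem (g (stdVertex 0)), hg' _⟩)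
    (pathClass_edge_mem (K := K) ⟨_, supp_mem _, base_mem (g (stdVertex 1)), hg' _⟩) using 1
  abel

lemma baseRay_mem_of_card_le_one {x : K.Realization} (h : x.supp.card ≤ 1) :
    baseRay x ∈ edgeSubgroup K := by
  have : x = vertex K x.base := eq_vertex_of_supp_subset fun v hv ↦
    Finset.mem_singleton.2 (Finset.card_le_one.1 h _ hv _ x.base_mem)
  have h0 : baseRay x = 0 := by
    rw [baseRay, ray]
    rw [← pathClass_const G x]
    congr 1
    have key (y : K.Realization) (hy : y = x) (h : IsFlat ![y, x]) :
        seg y x h = ContinuousMap.const _ x := by subst hy; exact seg_self _ _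
    exact key _ this.symm _
  rw [h0]
  exact zero_mem _

/-- A relative `1`-cycle of the pair formed by the skeleta of dimensions one and zero is homologous
to a combination of edges. -/
lemma mk_mem_edgeSubgroup {z : SingularChains G K.Realization 1}
    (hz : z ∈ cellularCycles G K.Realization 1) :
    (Submodule.Quotient.mk z : PathModule G K.Realization) ∈ edgeSubgroup K := by
  -- `z` is `P (∂ z)` up to edges by the preceding lemma, and `P (∂ z)` is a combination of edges
  -- because `∂ z` lies in the `0`-skeleton
  let P : SingularChains G K.Realization 0 →+ PathModule G K.Realization :=
    chainLift G fun σ ↦ baseRay (σ (stdSimplex.vertex 0))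
  have h1 (z : SingularChains G K.Realization 1) :
      (Submodule.Quotient.mk z : PathModule G K.Realization) -
        P (singularBoundary G K.Realization 1 0 z) ∈ edgeSubgroup K := by
    induction z using singularChains_induction with
    | zero => simp
    | gen σ =>
      rw [singularBoundary_chainGen_one, map_sub, chainLift_chainGen, chainLift_chainGen]
      convert pathClass_add_baseRay_sub_baseRay_mem σ using 1
      simp only [ContinuousMap.const_apply]
      exact sub_sub_eq_add_sub _ _ _
    | add x y hx hy =>
      rw [Submodule.Quotient.mk_add, map_add, map_add, add_sub_add_comm]
      exact add_mem hx hy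
    | neg x hx =>
      rw [Submodule.Quotient.mk_neg, map_neg, map_neg, ← neg_sub']
      exact neg_mem hx
  have h2 : P (singularBoundary G K.Realization 1 0 z) ∈ edgeSubgroup K := by
    have := (Submodule.mem_iInf _).1 hz.2 0
    refine chainsIn_induction _ (p := fun c ↦ P c ∈ edgeSubgroup K) ?_ ?_ ?_ ?_ this
    · rw [map_zero]; exact zero_mem _
    · intro σ hσ
      rw [chainLift_chainGen]
      exact baseRay_mem_of_card_le_one (mem_gSkeletonLT.1 (hσ _))
    · intro a b ha hb
      rw [map_add]; exact add_mem ha hb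
    · intro a ha
      rw [map_neg]; exact neg_mem ha
  simpa using add_mem (h1 z) h2

end Realization

end ColouredComplex

/-! ### Transport of simplicial cocycles along paths -/

instance (n : ℕ) : LocallyPathConnectedSpace (StdSimp n) :=
  (convex_stdSimplex ℝ (Fin (n + 1))).locallyPathConnectedSpace

instance (n : ℕ) : ContractibleSpace (StdSimp n) :=
  (convex_stdSimplex ℝ (Fin (n + 1))).contractibleSpace ⟨_, single_mem_stdSimplex ℝ 0⟩

instance (n : ℕ) : SimplyConnectedSpace (StdSimp n) := inferInstance

namespace ColouredComplex

variable {G I : Type u} [Group G] {K : ColouredComplex G I}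

/-- A simplicial `1`-cocycle with values in an abelian group. Only the values on adjacent vertices
matter. -/
def IsCocycle {N : Type*} [AddCommGroup N] (K : ColouredComplex G I)
    (c : Vertex G I → Vertex G I → N) : Prop :=
  ∀ s ∈ K.simplices, ∀ u ∈ s, ∀ v ∈ s, ∀ w ∈ s, c u v + c v w = c u w

namespace IsCocycle

variable {N : Type*} [AddCommGroup N] {c : Vertex G I → Vertex G I → N} (hc : K.IsCocycle c)

include hc

lemma self (v : Vertex G I) : c v v = 0 :=
  add_eq_left.1 (hc _ (K.singleton_mem v) v (by simp) v (by simp) v (by simp))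

lemma symm {v w : Vertex G I} (h : K.Adj v w) : c w v = -c v w := by
  obtain ⟨s, hs, hv, hw⟩ := h
  rw [eq_neg_iff_add_eq_zero, hc s hs w hw v hv w hw, hc.self]

end IsCocycle

namespace Realization

variable [LinearOrder I] {N : Type*} [AddCommGroup N] {c : Vertex G I → Vertex G I → N}

/-- A function `η` on the domain of `f : T → |K|` is a primitive of the cocycle `c` along `f` if on
the preimage of the open star of each vertex `v` it differs by a locally constant function from
the function sending `t` to the value of `c` on the edge from `v` to the base vertex of `f t`. -/
def IsPrimitive (c : Vertex G I → Vertex G I → N) {T : Type*} [TopologicalSpace T]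
    (f : C(T, K.Realization)) (η : T → N) : Prop :=
  ∀ (v : Vertex G I) (t : T), v ∈ (f t).supp →
    ∀ᶠ t' in 𝓝 t, η t' + c (f t').base v = η t + c (f t).base v

/-- The covering space of `|K|` classified by a cocycle, as a fibre bundle with discrete fibre. -/
@[reducible] noncomputable def coverCore [TopologicalSpace N] [DiscreteTopology N]
    (hc : K.IsCocycle c) :
    FiberBundleCore (Vertex G I) K.Realization N where
  baseSet := star K
  isOpen_baseSet := isOpen_star
  indexAt := base
  mem_baseSet_at x := mem_supp.1 x.base_mem
  coordChange v w _ n := n + c v w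
  coordChange_self v _ _ n := by rw [hc.self, add_zero]
  continuousOn_coordChange v w :=
    ((continuous_of_discreteTopology (f := fun n : N ↦ n + c v w)).comp
      continuous_snd).continuousOn
  coordChange_comp u v w x hx n := by
    rw [add_assoc, hc x.supp x.supp_mem u (mem_supp.2 hx.1.1) v (mem_supp.2 hx.1.2) w
      (mem_supp.2 hx.2)]

/-- A primitive along a singular simplex is the fibre component of a lift to the covering space
classified by the cocycle. -/
lemma exists_isPrimitive (hc : K.IsCocycle c) {n : ℕ} (f : C(StdSimp n, K.Realization)) :
    ∃ η, IsPrimitive c f η := by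
  let _ : TopologicalSpace N := ⊥
  have : DiscreteTopology N := ⟨rfl⟩
  let Z := coverCore hc
  have hcov : IsCoveringMap Z.proj := FiberBundle.isCoveringMap
  let t₀ : StdSimp n := stdSimplex.vertex 0
  obtain ⟨F, ⟨-, hF⟩, -⟩ := hcov.existsUnique_continuousMap_lifts f t₀ ⟨f t₀, (0 : N)⟩ rfl
  have hF1 : ∀ t, (F t).1 = f t := fun t ↦ congrFun hF t
  let η : StdSimp n → N := fun t ↦ (F t).2
  refine ⟨η, fun v t hv ↦ ?_⟩
  have hval (t : StdSimp n) : (Z.localTriv v (F t)).2 = η t + c (f t).base v := by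
    rw [FiberBundleCore.localTriv_apply]
    change η t + c (F t).1.base v = _
    rw [hF1]
  have hmem : F t ∈ (Z.localTriv v).source := by
    rw [FiberBundleCore.mem_localTriv_source]
    change (F t).1 ∈ star K v
    rw [hF1]; exact mem_supp.1 hv
  have hcont : ContinuousAt (fun t ↦ (Z.localTriv v (F t)).2) t :=
    continuousAt_snd.comp (((Z.localTriv v).continuousAt hmem).comp F.continuous.continuousAt)
  have := hcont.eventually (isOpen_discrete {(Z.localTriv v (F t)).2} |>.mem_nhds rfl)
  filter_upwards [this] with t' ht'
  rw [← hval, ← hval]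
  exact ht'

lemma IsPrimitive.sub_eq_sub {T : Type*} [TopologicalSpace T] [PreconnectedSpace T]
    {f : C(T, K.Realization)} {η η' : T → N} (h : IsPrimitive c f η) (h' : IsPrimitive c f η')
    (s t : T) : η t - η s = η' t - η' s := by
  have hl : IsLocallyConstant fun t ↦ η t - η' t := by
    rw [IsLocallyConstant.iff_eventually_eq]
    intro t
    filter_upwards [h _ t (f t).base_mem, h' _ t (f t).base_mem] with t' h1 h2
    rw [← add_sub_add_right_eq_sub, h1, h2, add_sub_add_right_eq_sub]
  have := hl.apply_eq_of_preconnectedSpace s t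
  rw [sub_eq_sub_iff_sub_eq_sub, this]

lemma IsPrimitive.comp {T T' : Type*} [TopologicalSpace T] [TopologicalSpace T']
    {f : C(T, K.Realization)} {η : T → N} (h : IsPrimitive c f η) (p : C(T', T)) :
    IsPrimitive c (f.comp p) (η ∘ p) := fun v t hv ↦
  p.continuous.continuousAt.eventually (h v (p t) hv)

lemma isPrimitive_of_supp_subset (hc : K.IsCocycle c) {T : Type*} [TopologicalSpace T]
    {f : C(T, K.Realization)} {s : Finset (Vertex G I)} (hs : s ∈ K.simplices)
    (hf : ∀ t, (f t).supp ⊆ s) {v : Vertex G I} (hv : v ∈ s) :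
    IsPrimitive c f fun t ↦ c v (f t).base := by
  intro w t hw
  filter_upwards with t'
  rw [hc _ hs _ hv _ (hf _ (base_mem _)) _ (hf _ hw), hc _ hs _ hv _ (hf _ (base_mem _)) _ (hf _ hw)]

/-- The transport of a cocycle along a path: the increment of a primitive. -/
noncomputable def transport (hc : K.IsCocycle c) (f : C(StdSimp 1, K.Realization)) : N :=
  (exists_isPrimitive hc f).choose (stdVertex 1) - (exists_isPrimitive hc f).choose (stdVertex 0)

lemma IsPrimitive.transport_eq (hc : K.IsCocycle c) {f : C(StdSimp 1, K.Realization)}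
    {η : StdSimp 1 → N} (h : IsPrimitive c f η) :
    transport hc f = η (stdVertex 1) - η (stdVertex 0) :=
  (exists_isPrimitive hc f).choose_spec.sub_eq_sub h _ _

/-- Transport vanishes on boundaries, since a cocycle has a primitive along a singular triangle. -/
lemma transport_triangle (hc : K.IsCocycle c) (τ : C(StdSimp 2, K.Realization)) :
    transport hc (singFace τ 2) + transport hc (singFace τ 0) = transport hc (singFace τ 1) := by
  obtain ⟨η, hη⟩ := exists_isPrimitive hc τ
  have h (i : Fin 3) : transport hc (singFace τ i) =
      η (stdSimplex.vertex (i.succAbove 1)) - η (stdSimplex.vertex (i.succAbove 0)) := by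
    rw [singFace, (hη.comp _).transport_eq hc]
    simp only [Function.comp_apply, ContinuousMap.coe_mk, stdSimplex.map_vertex]
  rw [h, h, h]
  exact sub_add_sub_cancel' (η (stdSimplex.vertex 1)) _ _

lemma transport_of_supp_subset (hc : K.IsCocycle c) {f : C(StdSimp 1, K.Realization)}
    {s : Finset (Vertex G I)} (hs : s ∈ K.simplices) (hf : ∀ t, (f t).supp ⊆ s) :
    transport hc f = c (f (stdVertex 0)).base (f (stdVertex 1)).base := by
  rw [(isPrimitive_of_supp_subset hc hs hf (hf (stdVertex 0) (base_mem _))).transport_eq hc,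
    hc.self, sub_zero]

lemma transport_edge (hc : K.IsCocycle c) {v w : Vertex G I} (h : K.Adj v w) :
    transport hc (edge h) = c v w := by
  have h' := h
  obtain ⟨s, hs, hv, hw⟩ := h'
  have hsupp (t) : (edge h t).supp ⊆ s :=
    supp_affine_subset (vertex_isFlat_of_adj h) (fun i ↦ ?_) t
  rw [transport_of_supp_subset hc hs hsupp]
  · rw [edge, seg, affine_apply_vertex, affine_apply_vertex]
    change c (vertex K v).base (vertex K w).base = _
    rw [base_vertex, base_vertex]
  · fin_cases i
    · change (vertex K v).supp ⊆ s
      rwa [supp_vertex, Finset.singleton_subset_iff]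
    · change (vertex K w).supp ⊆ s
      rwa [supp_vertex, Finset.singleton_subset_iff]

lemma transport_smulSimplex (hc : K.IsCocycle c) {a : G → N →+ N}
    (ha : ∀ g v w, c (g • v) (g • w) = a g (c v w)) (g : G) (f : C(StdSimp 1, K.Realization)) :
    transport hc (smulSimplex G g f) = a g (transport hc f) := by
  obtain ⟨η, hη⟩ := exists_isPrimitive hc f
  have : IsPrimitive c (smulSimplex G g f) fun t ↦ a g (η t) := by
    intro v t hv
    have hb (t) (w) : c (smulSimplex G g f t).base w = a g (c (f t).base (g⁻¹ • w)) := by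
      rw [← ha, smul_inv_smul, ← base_smul]; rfl
    have hv' : g⁻¹ • v ∈ (f t).supp := by
      rw [← Vertex.mem_translate, ← supp_smul]; exact hv
    filter_upwards [hη _ t hv'] with t' ht'
    rw [hb, hb, ← map_add, ht', map_add]
  rw [this.transport_eq hc, hη.transport_eq hc, map_sub]

end Realization

end ColouredComplex

/-! ### Betti numbers of a complex in low degrees -/

section Balanced

variable {R D : Type u} [Ring R] [Ring D] (α : R →+* D)

namespace BalancedTensor

variable {M N : Type u} [AddCommGroup M] [Module R M] [AddCommGroup N] [Module D N]

/-- The elementary tensor `d ⊗ m` in `D ⊗_R M`. -/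
def tmul (d : D) (m : M) : BalancedTensor α M := Submodule.Quotient.mk (d ⊗ₜ[ℤ] m)

lemma smul_tmul (d e : D) (m : M) : d • tmul α e m = tmul α (d * e) m := rfl

lemma tmul_smul (d : D) (r : R) (m : M) : tmul α d (r • m) = tmul α (d * α r) m :=
  ((Submodule.Quotient.eq (balancingRelations α M)).2 (Submodule.subset_span ⟨d, r, m, rfl⟩)).symm

lemma one_tmul_smul (r : R) (m : M) : tmul α 1 (r • m) = α r • tmul α 1 m := by
  rw [tmul_smul, smul_tmul, one_mul, mul_one]

/-- The map `m ↦ 1 ⊗ m`. -/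
def unit : M →+ BalancedTensor α M where
  toFun m := tmul α 1 m
  map_zero' := by rw [tmul, TensorProduct.tmul_zero]; rfl
  map_add' m n := by rw [tmul, TensorProduct.tmul_add]; rfl

lemma tmul_eq_smul_unit (d : D) (m : M) : tmul α d m = d • unit α m := by
  change _ = d • tmul α 1 m
  rw [smul_tmul, mul_one]

lemma unit_smul (r : R) (m : M) : unit α (r • m) = α r • unit α m := one_tmul_smul α r m

/-- Linear maps out of `D ⊗_R M` are determined by their values on the tensors `1 ⊗ m`. -/
lemma hom_ext_unit {f g : BalancedTensor α M →ₗ[D] N} (h : ∀ m, f (unit α m) = g (unit α m)) :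
    f = g := hom_ext α fun d m ↦ by
  have := congrArg (d • ·) (h m)
  simp only [← map_smul, ← tmul_eq_smul_unit] at this
  exact this

/-- The linear map on `D ⊗_R M` induced by a map which is semilinear along `α`. -/
noncomputable def lift (f : M →+ N) (hf : ∀ (r : R) m, f (r • m) = α r • f m) :
    BalancedTensor α M →ₗ[D] N :=
  Submodule.liftQ _ (AlgebraTensorModule.lift
    { toFun := fun d ↦ d • f.toIntLinearMap
      map_add' := fun d e ↦ add_smul d e _
      map_smul' := fun d e ↦ mul_smul d e _ }) (by
    refine Submodule.span_le.2 ?_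
    rintro _ ⟨d, r, m, rfl⟩
    simp [hf, mul_smul])

lemma lift_unit (f : M →+ N) (hf : ∀ (r : R) m, f (r • m) = α r • f m) (m : M) :
    lift α f hf (unit α m) = f m := by
  change (1 : D) • f m = f m
  rw [one_smul]

lemma map_unit {M' : Type u} [AddCommGroup M'] [Module R M'] (f : M →ₗ[R] M') (m : M) :
    map α f (unit α m) = unit α (f m) := rfl

end BalancedTensor

end Balanced

lemma MonoidAlgebra.map_smul_of_single {G D M N : Type u} [Group G] [Ring D] [AddCommGroup M]
    [Module (MonoidAlgebra ℤ G) M] [AddCommGroup N] [Module D N] (α : MonoidAlgebra ℤ G →+* D)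
    (f : M →+ N) (hf : ∀ (g : G) m, f (MonoidAlgebra.single g (1 : ℤ) • m) =
      α (MonoidAlgebra.single g 1) • f m) (r : MonoidAlgebra ℤ G) (m : M) :
    f (r • m) = α r • f m := by
  induction r using MonoidAlgebra.induction_on with
  | of g => exact hf g m
  | add a b ha hb => rw [add_smul, map_add, ha, hb, map_add, add_smul]
  | smul k a ha => rw [smul_assoc, map_zsmul, ha, map_zsmul, smul_assoc]

section Rank

variable {D : Type u} [DivisionRing D] {B₂ B₁ B₀ : Type u} [AddCommGroup B₂] [Module D B₂]
  [AddCommGroup B₁] [Module D B₁] [AddCommGroup B₀] [Module D B₀]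

/-- In a complex `B₂ → B₁ → B₀`, the dimensions of the two cokernels differ from the dimensions of the
homology at `B₁` and of `B₀` by the rank of `B₁ → B₀` only, which cancels. The identity avoids
subtraction, so that infinite dimensions are allowed. -/
lemma rank_quotient_range_add_rank_quotient_range (f : B₂ →ₗ[D] B₁) (g : B₁ →ₗ[D] B₀)
    (h : ∀ x, g (f x) = 0) :
    Module.rank D (B₁ ⧸ LinearMap.range f) + Module.rank D (B₀ ⧸ LinearMap.range g) =
      Module.rank D (LinearMap.ker g ⧸ LinearMap.range (f.codRestrict (LinearMap.ker g) h)) +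
        Module.rank D B₀ := by
  have hfg : LinearMap.range f ≤ LinearMap.ker g := by rintro _ ⟨x, rfl⟩; exact h x
  let g' : (B₁ ⧸ LinearMap.range f) →ₗ[D] B₀ := (LinearMap.range f).liftQ g hfg
  have hr : LinearMap.range g' = LinearMap.range g := Submodule.range_liftQ _ _ _
  let k : LinearMap.ker g →ₗ[D] (B₁ ⧸ LinearMap.range f) :=
    (LinearMap.range f).mkQ.comp (LinearMap.ker g).subtype
  have hk : LinearMap.range k = LinearMap.ker g' := by
    ext x
    obtain ⟨x, rfl⟩ := Submodule.Quotient.mk_surjective _ x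
    constructor
    · rintro ⟨y, hy⟩
      rw [← hy]
      exact y.2
    · exact fun hx ↦ ⟨⟨x, hx⟩, rfl⟩
  have hk' : LinearMap.ker k = LinearMap.range (f.codRestrict (LinearMap.ker g) h) := by
    ext x
    rw [LinearMap.mem_ker]
    change (LinearMap.range f).mkQ x.1 = 0 ↔ _
    rw [Submodule.mkQ_apply, Submodule.Quotient.mk_eq_zero]
    constructor
    · rintro ⟨y, hy⟩; exact ⟨y, Subtype.ext hy⟩
    · rintro ⟨y, hy⟩; exact ⟨y, congrArg Subtype.val hy⟩
  rw [← LinearMap.rank_range_add_rank_ker g', hr, ← hk, ← hk', ← (k.quotKerEquivRange).rank_eq,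
    add_comm (Module.rank D (LinearMap.range g)), add_assoc, add_comm (Module.rank D _)
      (Module.rank D (B₀ ⧸ LinearMap.range g)), Submodule.rank_quotient_add_rank]

end Rank

section Betti

variable {R D : Type u} [Ring R] [DivisionRing D] (α : R →+* D)
  (C : ChainComplex (ModuleCat.{u} R) ℕ)

lemma bettiNumber_eq_toENat_rank {i j k : ℕ} (hi : (ComplexShape.down ℕ).prev j = i)
    (hk : (ComplexShape.down ℕ).next j = k)
    (h : ∀ x, BalancedTensor.map α (C.d j k).hom (BalancedTensor.map α (C.d i j).hom x) = 0) :
    bettiNumber α C j = Cardinal.toENat (Module.rank D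
      (LinearMap.ker (BalancedTensor.map α (C.d j k).hom) ⧸
        LinearMap.range ((BalancedTensor.map α (C.d i j).hom).codRestrict _ h))) := by
  let K := ((extensionFunctor α).mapHomologicalComplex (ComplexShape.down ℕ)).obj C
  have e : K.homology j ≅ _ := ShortComplex.homologyMapIso (K.isoSc' i j k hi hk) ≪≫
    (K.sc' i j k).moduleCatHomologyIso
  exact congrArg Cardinal.toENat e.toLinearEquiv.rank_eq

lemma map_d_map_d (i j k : ℕ) (x) :
    BalancedTensor.map α (C.d j k).hom (BalancedTensor.map α (C.d i j).hom x) = 0 := by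
  have := LinearMap.congr_fun (BalancedTensor.map_comp α (C.d j k).hom (C.d i j).hom) x
  have hd : (C.d j k).hom ∘ₗ (C.d i j).hom = 0 := congrArg ModuleCat.Hom.hom (C.d_comp_d i j k)
  have h0 : BalancedTensor.map α (0 : C.X i →ₗ[R] C.X k) = 0 :=
    BalancedTensor.hom_ext_unit α fun m ↦ by
      rw [BalancedTensor.map_unit, LinearMap.zero_apply, LinearMap.zero_apply, map_zero]
  rw [hd, h0] at this
  exact this.symm

/-- The dimensions of the cokernels of the first two differentials determine each other, given the
first two Betti numbers. -/
lemma toENat_rank_coker_add_bettiNumber :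
    Cardinal.toENat (Module.rank D (BalancedTensor α (C.X 1) ⧸
        LinearMap.range (BalancedTensor.map α (C.d 2 1).hom))) + bettiNumber α C 0 =
      bettiNumber α C 1 + Cardinal.toENat (Module.rank D (BalancedTensor α (C.X 0))) := by
  have h1 := bettiNumber_eq_toENat_rank α C (i := 2) (j := 1) (k := 0) (by simp) (by simp)
    (map_d_map_d α C _ _ _)
  have h0 := bettiNumber_eq_toENat_rank α C (i := 1) (j := 0) (k := 0) (by simp) (by simp)
    (map_d_map_d α C _ _ _)
  have hr := rank_quotient_range_add_rank_quotient_range _ _ (map_d_map_d α C 2 1 0)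
  have hz : BalancedTensor.map α (C.d 0 0).hom = 0 := by
    rw [C.shape 0 0 (by simp)]
    exact BalancedTensor.hom_ext_unit α fun m ↦ by
      rw [BalancedTensor.map_unit, ModuleCat.hom_zero, LinearMap.zero_apply, LinearMap.zero_apply,
        map_zero]
  have h0' : bettiNumber α C 0 = Cardinal.toENat (Module.rank D (BalancedTensor α (C.X 0) ⧸
      LinearMap.range (BalancedTensor.map α (C.d 1 0).hom))) := by
    rw [h0]
    have hk : LinearMap.ker (BalancedTensor.map α (C.d 0 0).hom) = ⊤ := by
      rw [hz, LinearMap.ker_zero]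
    refine congrArg _ (LinearEquiv.rank_eq (Submodule.Quotient.equiv _ _
      (LinearEquiv.ofTop _ hk) ?_))
    ext x
    constructor
    · rintro ⟨_, ⟨y, rfl⟩, rfl⟩; exact ⟨y, rfl⟩
    · rintro ⟨y, rfl⟩; exact ⟨_, ⟨y, rfl⟩, rfl⟩
  rw [h1, h0', ← map_add, ← map_add, hr]

end Betti

/-! ### The cellular chain complex of the realization in low degrees -/

section CellularGeneral

variable {G X : Type u} [Group G] [TopologicalSpace X] [MulAction G X]
  [CWComplex (Set.univ : Set X)] [T2Space X] [IsGCWComplex G X]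

/-- The class of a relative cycle in the cellular chains. -/
noncomputable def cellMk {n : ℕ} (z : SingularChains G X n) (hz : z ∈ cellularCycles G X n) :
    CellularChains G X n := Submodule.Quotient.mk ⟨z, hz⟩

lemma cellMk_add {n : ℕ} {y z : SingularChains G X n} (hy : y ∈ cellularCycles G X n)
    (hz : z ∈ cellularCycles G X n) :
    cellMk (y + z) (add_mem hy hz) = cellMk y hy + cellMk z hz := rfl

lemma cellMk_neg {n : ℕ} {z : SingularChains G X n} (hz : z ∈ cellularCycles G X n) :
    cellMk (-z) (neg_mem hz) = -cellMk z hz := rfl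

lemma cellMk_smul {n : ℕ} (r : MonoidAlgebra ℤ G) {z : SingularChains G X n}
    (hz : z ∈ cellularCycles G X n) :
    cellMk (r • z) (Submodule.smul_mem _ r hz) = r • cellMk z hz := rfl

lemma cellMk_surjective {n : ℕ} (c : CellularChains G X n) : ∃ z hz, c = cellMk z hz := by
  obtain ⟨z, rfl⟩ := Submodule.Quotient.mk_surjective _ c
  exact ⟨z.1, z.2, rfl⟩

lemma cellularBoundary_cellMk {i j : ℕ} {z : SingularChains G X i}
    (hz : z ∈ cellularCycles G X i) : cellularBoundary G X i j (cellMk z hz) =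
      cellMk (singularBoundary G X i j z) (singularBoundary_mem_cellularCycles G X i j hz) := rfl

/-- The map on cellular chains induced by a map on singular chains vanishing on boundaries. -/
noncomputable def cellLift {N : Type u} [AddCommGroup N] {n : ℕ} (φ : SingularChains G X n →+ N)
    (h : ∀ z ∈ cellularBoundaries G X n, φ z = 0) : CellularChains G X n →+ N :=
  QuotientAddGroup.lift _ (φ.comp (cellularCycles G X n).subtype.toAddMonoidHom) fun z hz ↦ h z.1 hz

lemma cellLift_cellMk {N : Type u} [AddCommGroup N] {n : ℕ} (φ : SingularChains G X n →+ N)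
    (h : ∀ z ∈ cellularBoundaries G X n, φ z = 0) {z : SingularChains G X n}
    (hz : z ∈ cellularCycles G X n) : cellLift φ h (cellMk z hz) = φ z := rfl

lemma mem_cellularCycles_iff {n : ℕ} {z : SingularChains G X (n + 1)} :
    z ∈ cellularCycles G X (n + 1) ↔ z ∈ chainsIn (gSkeletonLT G X (n + 2)) (n + 1) ∧
      singularBoundary G X (n + 1) n z ∈ chainsIn (gSkeletonLT G X (n + 1)) n := by
  refine and_congr_right fun _ ↦ ⟨fun h ↦ (Submodule.mem_iInf _).1 h n, fun h ↦ ?_⟩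
  refine (Submodule.mem_iInf _).2 fun j ↦ ?_
  by_cases hj : j + 1 = n + 1
  · obtain rfl : j = n := by omega
    exact h
  · rw [Submodule.mem_comap, singularBoundary_eq_zero G X hj]
    exact zero_mem _

lemma mem_cellularCycles_zero_iff {z : SingularChains G X 0} :
    z ∈ cellularCycles G X 0 ↔ z ∈ chainsIn (gSkeletonLT G X 1) 0 := by
  refine ⟨fun h ↦ h.1, fun h ↦ ⟨h, (Submodule.mem_iInf _).2 fun j ↦ ?_⟩⟩
  rw [Submodule.mem_comap, singularBoundary_eq_zero G X (by omega)]
  exact zero_mem _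

end CellularGeneral

namespace ColouredComplex

variable {G I : Type u} [Group G] {K : ColouredComplex G I}

/-- The image of a group element under an agrarian map. -/
noncomputable abbrev agr {D : Type u} [DivisionRing D] (α : AgrarianMap G D) (g : G) : D :=
  α (MonoidAlgebra.single g 1)

lemma agr_mul {D : Type u} [DivisionRing D] (α : AgrarianMap G D) (g h : G) :
    agr α (g * h) = agr α g * agr α h := by
  rw [agr, agr, agr, ← map_mul, MonoidAlgebra.single_mul_single, one_mul]

lemma agr_one {D : Type u} [DivisionRing D] (α : AgrarianMap G D) : agr α (1 : G) = 1 := by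
  rw [agr, ← MonoidAlgebra.one_def, map_one]

/-- A function on pairs of vertices with values in a `D`-module is equivariant along an agrarian
map. -/
def IsEquivariant {D N : Type u} [DivisionRing D] [AddCommGroup N] [Module D N]
    (α : AgrarianMap G D) (c : Vertex G I → Vertex G I → N) : Prop :=
  ∀ (g : G) v w, c (g • v) (g • w) = agr α g • c v w

section Universal

variable {D : Type u} [DivisionRing D] (α : AgrarianMap G D) (K)

/-- The relations defining the target of the universal equivariant simplicial cocycle: equivariance,
vanishing on pairs of vertices which are not adjacent, and the cocycle condition. -/
noncomputable def cocycleRelations : Submodule D ((Vertex G I × Vertex G I) →₀ D) :=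
  Submodule.span D
    ({x | ∃ (g : G) (v w : Vertex G I), x = Finsupp.single (g • v, g • w) 1 -
        agr α g • Finsupp.single (v, w) 1} ∪
      {x | ∃ v w, ¬ K.Adj v w ∧ x = Finsupp.single (v, w) 1} ∪
      {x | ∃ s ∈ K.simplices, ∃ u ∈ s, ∃ v ∈ s, ∃ w ∈ s, x = Finsupp.single (u, v) 1 +
        Finsupp.single (v, w) 1 - Finsupp.single (u, w) 1})

/-- The `D`-module with a universal equivariant simplicial `1`-cocycle. -/
abbrev CocycleModule : Type u := ((Vertex G I × Vertex G I) →₀ D) ⧸ cocycleRelations K α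

/-- The universal equivariant simplicial `1`-cocycle. -/
noncomputable def univCocycle (v w : Vertex G I) : CocycleModule K α :=
  Submodule.Quotient.mk (Finsupp.single (v, w) 1)

lemma univCocycle_isEquivariant : IsEquivariant α (univCocycle K α) := fun g v w ↦
  (Submodule.Quotient.eq _).2 (Submodule.subset_span (.inl (.inl ⟨g, v, w, rfl⟩)))

lemma univCocycle_of_not_adj {v w : Vertex G I} (h : ¬ K.Adj v w) : univCocycle K α v w = 0 :=
  (Submodule.Quotient.mk_eq_zero _).2 (Submodule.subset_span (.inl (.inr ⟨v, w, h, rfl⟩)))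

lemma univCocycle_isCocycle : K.IsCocycle (univCocycle K α) := fun s hs u hu v hv w hw ↦
  (Submodule.Quotient.eq _).2 (Submodule.subset_span (.inr ⟨s, hs, u, hu, v, hv, w, hw, rfl⟩))

variable {K} {N : Type u} [AddCommGroup N] [Module D N]

/-- The linear map classifying an equivariant cocycle. -/
noncomputable def cocycleLift (c : Vertex G I → Vertex G I → N) (he : IsEquivariant α c)
    (h0 : ∀ v w, ¬ K.Adj v w → c v w = 0) (hc : K.IsCocycle c) : CocycleModule K α →ₗ[D] N :=
  (cocycleRelations K α).liftQ (Finsupp.lift N D _ fun p ↦ c p.1 p.2) <| by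
    refine Submodule.span_le.2 ?_
    rintro x ((⟨g, v, w, rfl⟩ | ⟨v, w, h, rfl⟩) | ⟨s, hs, u, hu, v, hv, w, hw, rfl⟩)
    · rw [SetLike.mem_coe, LinearMap.mem_ker, map_sub, map_smul]
      simp [he g v w]
    · simp [h0 v w h]
    · rw [SetLike.mem_coe, LinearMap.mem_ker, map_sub, map_add]
      simp [hc s hs u hu v hv w hw]

lemma cocycleLift_univCocycle (c : Vertex G I → Vertex G I → N) (he : IsEquivariant α c)
    (h0 : ∀ v w, ¬ K.Adj v w → c v w = 0) (hc : K.IsCocycle c) (v w : Vertex G I) :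
    cocycleLift α c he h0 hc (univCocycle K α v w) = c v w := by
  change Finsupp.lift N D _ (fun p : Vertex G I × Vertex G I ↦ c p.1 p.2)
    (Finsupp.single (v, w) 1) = c v w
  simp

lemma cocycleModule_hom_ext {f g : CocycleModule K α →ₗ[D] N}
    (h : ∀ v w, K.Adj v w → f (univCocycle K α v w) = g (univCocycle K α v w)) : f = g := by
  refine Submodule.linearMap_qext _ (Finsupp.lhom_ext fun p d ↦ ?_)
  have hp : f (univCocycle K α p.1 p.2) = g (univCocycle K α p.1 p.2) := by
    by_cases hp : K.Adj p.1 p.2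
    · exact h _ _ hp
    · rw [univCocycle_of_not_adj K α hp, map_zero, map_zero]
  have : (cocycleRelations K α).mkQ (Finsupp.single p d) = d • univCocycle K α p.1 p.2 := by
    rw [univCocycle, ← Submodule.Quotient.mk_smul, Finsupp.smul_single, smul_eq_mul, mul_one]; rfl
  rw [LinearMap.comp_apply, LinearMap.comp_apply, this, map_smul, map_smul, hp]

lemma cocycleModule_span : Submodule.span D {x | ∃ v w, K.Adj v w ∧ x = univCocycle K α v w} = ⊤ := by
  have : (Submodule.span D {x | ∃ v w, K.Adj v w ∧ x = univCocycle K α v w}).mkQ = 0 :=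
    cocycleModule_hom_ext α fun v w h ↦
      (Submodule.Quotient.mk_eq_zero _).2 (Submodule.subset_span ⟨v, w, h, rfl⟩)
  rw [← Submodule.ker_mkQ (Submodule.span D _), this, LinearMap.ker_zero]

instance [Finite I] : Module.Finite D (CocycleModule K α) := by
  have hfin (i : I) : {w | K.Adj ⟨1, i⟩ w}.Finite := by
    refine Set.Finite.subset ((K.finite_star ⟨1, i⟩).biUnion fun s _ ↦ s.finite_toSet) ?_
    rintro w ⟨s, hs, h1, hw⟩
    exact Set.mem_iUnion₂.2 ⟨s, ⟨hs, h1⟩, hw⟩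
  have hS := Set.finite_iUnion fun i ↦ (hfin i).image (univCocycle K α ⟨1, i⟩)
  refine ⟨⟨hS.toFinset, ?_⟩⟩
  rw [Set.Finite.coe_toFinset, eq_top_iff, ← cocycleModule_span, Submodule.span_le]
  rintro _ ⟨v, w, ⟨s, hs, hv, hw⟩, rfl⟩
  have hv1 : v = v.elt • (⟨1, v.colour⟩ : Vertex G I) := by ext <;> simp
  have hw1 : w = v.elt • v.elt⁻¹ • w := by rw [smul_inv_smul]
  have hv2 : v.elt⁻¹ • v = ⟨1, v.colour⟩ := by ext <;> simp
  have h := univCocycle_isEquivariant K α v.elt ⟨1, v.colour⟩ (v.elt⁻¹ • w)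
  rw [← hv1, ← hw1] at h
  rw [h]
  refine Submodule.smul_mem _ _ (Submodule.subset_span (Set.mem_iUnion.2 ⟨v.colour, _, ?_, rfl⟩))
  refine ⟨Vertex.translate v.elt⁻¹ s, K.translate_mem _ hs, ?_, Vertex.smul_mem_translate.2 hw⟩
  rw [← hv2]
  exact Vertex.smul_mem_translate.2 hv

end Universal

namespace Realization

lemma edge_mem_cellularCycles {v w : Vertex G I} (h : K.Adj v w) :
    chainGen G (edge h) ∈ cellularCycles G K.Realization 1 := by
  classical
  refine mem_cellularCycles_iff.2 ⟨chainGen_mem_chainsIn _ fun t ↦ mem_gSkeletonLT.2 ?_, ?_⟩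
  · have hsub : (edge h t).supp ⊆ {v, w} :=
      supp_affine_subset (vertex_isFlat_of_adj h) (fun i ↦ by
        fin_cases i
        · change (vertex K v).supp ⊆ _
          rw [supp_vertex]; simp
        · change (vertex K w).supp ⊆ _
          rw [supp_vertex]; simp) t
    exact (Finset.card_le_card hsub).trans Finset.card_le_two
  · have hv (u : Vertex G I) : chainGen G (.const _ (vertex K u)) ∈
        chainsIn (gSkeletonLT G K.Realization 1) 0 :=
      chainGen_mem_chainsIn _ fun t ↦ mem_gSkeletonLT.2 (by
        rw [ContinuousMap.const_apply, supp_vertex, Finset.card_singleton])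
    rw [singularBoundary_chainGen_one, edge, seg, affine_apply_vertex, affine_apply_vertex]
    exact sub_mem (hv w) (hv v)

/-- The class of an edge in the cellular chains. -/
noncomputable def edgeCell {v w : Vertex G I} (h : K.Adj v w) : CellularChains G K.Realization 1 :=
  cellMk (chainGen G (edge h)) (edge_mem_cellularCycles h)

lemma mem_cellularCycles_two {b : SingularChains G K.Realization 2}
    (h : singularBoundary G K.Realization 2 1 b ∈ cellularCycles G K.Realization 1) :
    b ∈ cellularCycles G K.Realization 2 := by
  refine mem_cellularCycles_iff.2 ⟨?_, h.1⟩
  rw [chainsIn_eq_top fun x ↦ mem_gSkeletonLT.2 (K.card_le x.supp_mem)]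
  trivial

lemma adj_smul {v w : Vertex G I} (g : G) (h : K.Adj v w) : K.Adj (g • v) (g • w) := by
  obtain ⟨s, hs, hv, hw⟩ := h
  exact ⟨_, K.translate_mem g hs, Vertex.smul_mem_translate.2 hv, Vertex.smul_mem_translate.2 hw⟩

lemma single_smul_edgeCell {v w : Vertex G I} (h : K.Adj v w) (g : G) :
    MonoidAlgebra.single g (1 : ℤ) • edgeCell h = edgeCell (adj_smul g h) := by
  rw [edgeCell, ← cellMk_smul, edgeCell]
  congr 1
  rw [single_smul_chainGen]
  congr 1
  have h' : IsFlat fun i : Fin 2 ↦ g • ![vertex K v, vertex K w] i := by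
    obtain ⟨s, hs, hi⟩ := vertex_isFlat_of_adj h
    exact ⟨_, K.translate_mem g hs, fun i ↦ by rw [supp_smul]; exact Finset.map_subset_map.2 (hi i)⟩
  rw [edge, seg, smulSimplex_affine g _ _ h', edge, seg]
  congr 1
  funext i
  fin_cases i
  · exact smul_vertex g v
  · exact smul_vertex g w

section Cokernel

variable {D : Type u} [DivisionRing D] (α : AgrarianMap G D) (K)

/-- The cokernel of the differential from degree two to degree one after extension of scalars. -/
abbrev CokerOne : Type u := BalancedTensor α (CellularChains G K.Realization 1) ⧸
  LinearMap.range (BalancedTensor.map α (cellularBoundary G K.Realization 2 1))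

/-- The class of a cellular `1`-chain in the cokernel. -/
noncomputable def cokerMk : CellularChains G K.Realization 1 →+ CokerOne K α :=
  (LinearMap.range (BalancedTensor.map α (cellularBoundary G K.Realization 2 1))).mkQ.toAddMonoidHom.comp
    (BalancedTensor.unit α)

lemma cokerMk_smul (r : MonoidAlgebra ℤ G) (c : CellularChains G K.Realization 1) :
    cokerMk K α (r • c) = α r • cokerMk K α c := by
  change Submodule.mkQ _ (BalancedTensor.unit α (r • c)) = _
  rw [BalancedTensor.unit_smul, map_smul]; rfl

lemma cokerMk_boundary (b : SingularChains G K.Realization 2)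
    (h : singularBoundary G K.Realization 2 1 b ∈ cellularCycles G K.Realization 1) :
    cokerMk K α (cellMk _ h) = 0 :=
  (Submodule.Quotient.mk_eq_zero _).2
    ⟨BalancedTensor.unit α (cellMk b (mem_cellularCycles_two h)), rfl⟩

open Classical in
/-- The equivariant cocycle given by the classes of the edges. -/
noncomputable def edgeCocycle (v w : Vertex G I) : CokerOne K α :=
  if h : K.Adj v w then cokerMk K α (edgeCell h) else 0

variable {K}

lemma edgeCocycle_of_adj {v w : Vertex G I} (h : K.Adj v w) :
    edgeCocycle K α v w = cokerMk K α (edgeCell h) := dif_pos h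

lemma edgeCocycle_of_not_adj {v w : Vertex G I} (h : ¬ K.Adj v w) : edgeCocycle K α v w = 0 :=
  dif_neg h

lemma edgeCocycle_isEquivariant : IsEquivariant α (edgeCocycle K α) := by
  intro g v w
  by_cases h : K.Adj v w
  · rw [edgeCocycle_of_adj α h, edgeCocycle_of_adj α (adj_smul g h), ← single_smul_edgeCell,
      cokerMk_smul]
  · have h' : ¬ K.Adj (g • v) (g • w) := fun h' ↦ h (by
      simpa using adj_smul g⁻¹ h')
    rw [edgeCocycle_of_not_adj α h', edgeCocycle_of_not_adj α h, smul_zero]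

lemma edgeCocycle_isCocycle : K.IsCocycle (edgeCocycle K α) := by
  intro s hs u hu v hv w hw
  have huv : K.Adj u v := ⟨s, hs, hu, hv⟩
  have hvw : K.Adj v w := ⟨s, hs, hv, hw⟩
  have huw : K.Adj u w := ⟨s, hs, hu, hw⟩
  have hsub {x : Vertex G I} (hx : x ∈ s) : (vertex K x).supp ⊆ s := by
    rwa [supp_vertex, Finset.singleton_subset_iff]
  let τ := affine ![vertex K u, vertex K v, vertex K w]
    (isFlat_triple hs (hsub hu) (hsub hv) (hsub hw))
  obtain ⟨h0, h1, h2⟩ := singFace_affine_triple (isFlat_triple hs (hsub hu) (hsub hv) (hsub hw))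
    (vertex_isFlat_of_adj huv) (vertex_isFlat_of_adj hvw) (vertex_isFlat_of_adj huw)
  have hb : singularBoundary G K.Realization 2 1 (chainGen G τ) =
      chainGen G (edge hvw) + -chainGen G (edge huw) + chainGen G (edge huv) := by
    rw [singularBoundary_chainGen, Fin.sum_univ_three, h0, h1, h2]
    simp [edge]
  have hcyc : singularBoundary G K.Realization 2 1 (chainGen G τ) ∈
      cellularCycles G K.Realization 1 := by
    rw [hb]
    exact add_mem (add_mem (edge_mem_cellularCycles _) (neg_mem (edge_mem_cellularCycles _)))
      (edge_mem_cellularCycles _)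
  have h := cokerMk_boundary K α _ hcyc
  have hsum : cellMk _ hcyc = edgeCell hvw + -edgeCell huw + edgeCell huv := by
    rw [edgeCell, edgeCell, edgeCell, ← cellMk_neg, ← cellMk_add, ← cellMk_add]
    congr 1
  rw [hsum, map_add, map_add, map_neg] at h
  rw [edgeCocycle_of_adj α huv, edgeCocycle_of_adj α hvw, edgeCocycle_of_adj α huw,
    ← sub_eq_zero, ← h]
  abel

/-- The map from the universal module to the cokernel sending the universal cocycle to the edges. -/
noncomputable def cocycleToCoker : CocycleModule K α →ₗ[D] CokerOne K α :=
  cocycleLift α (edgeCocycle K α) (edgeCocycle_isEquivariant α) (fun _ _ ↦ edgeCocycle_of_not_adj α)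
    (edgeCocycle_isCocycle α)

lemma cocycleToCoker_univCocycle {v w : Vertex G I} (h : K.Adj v w) :
    cocycleToCoker α (univCocycle K α v w) = cokerMk K α (edgeCell h) :=
  (cocycleLift_univCocycle α _ _ _ _ v w).trans (edgeCocycle_of_adj α h)

variable (K) in
/-- The combinations of edges in the singular chains. -/
noncomputable def edgeChains : AddSubgroup (SingularChains G K.Realization 1) :=
  AddSubgroup.closure {c | ∃ (v w : Vertex G I) (h : K.Adj v w), c = chainGen G (edge h)}

lemma edgeChains_le {c : SingularChains G K.Realization 1} (h : c ∈ edgeChains K) :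
    c ∈ cellularCycles G K.Realization 1 := by
  refine (AddSubgroup.closure_le (cellularCycles G K.Realization 1).toAddSubgroup).2 ?_ h
  rintro _ ⟨v, w, h, rfl⟩
  exact edge_mem_cellularCycles h

variable [LinearOrder I]

lemma exists_edgeChain {z : SingularChains G K.Realization 1}
    (hz : z ∈ cellularCycles G K.Realization 1) : ∃ e ∈ edgeChains K,
      ∃ b, singularBoundary G K.Realization 2 1 b = z - e := by
  have key : edgeSubgroup K ≤ (edgeChains K).map (Submodule.mkQ _).toAddMonoidHom := by
    refine (AddSubgroup.closure_le _).2 ?_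
    rintro _ ⟨v, w, h, rfl⟩
    exact ⟨_, AddSubgroup.subset_closure ⟨v, w, h, rfl⟩, rfl⟩
  obtain ⟨e, he, hze⟩ := key (mk_mem_edgeSubgroup hz)
  exact ⟨e, he, (Submodule.Quotient.eq _).1 hze.symm⟩

/-- The transport of the universal cocycle, extended to singular `1`-chains. -/
noncomputable def transportHom : SingularChains G K.Realization 1 →+ CocycleModule K α :=
  chainLift G (transport (univCocycle_isCocycle K α))

lemma transportHom_boundary (b : SingularChains G K.Realization 2) :
    transportHom α (singularBoundary G K.Realization 2 1 b) = 0 := by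
  induction b using singularChains_induction with
  | zero => simp
  | gen τ =>
    rw [singularBoundary_chainGen, Fin.sum_univ_three, transportHom]
    simp only [Fin.val_zero, pow_zero, one_smul, Fin.val_one, pow_one, neg_smul, Fin.val_two,
      even_two, Even.neg_pow, one_pow, map_add, map_neg, chainLift_chainGen]
    rw [← transport_triangle]
    abel
  | add x y hx hy => rw [map_add, map_add, hx, hy, add_zero]
  | neg x hx => rw [map_neg, map_neg, hx, neg_zero]

lemma base_eq_of_card_le_one (σ : C(StdSimp 1, K.Realization)) (h : ∀ t, (σ t).supp.card ≤ 1)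
    (s t : StdSimp 1) : (σ s).base = (σ t).base := by
  have : IsLocallyConstant fun t ↦ (σ t).base := by
    rw [IsLocallyConstant.iff_eventually_eq]
    intro t
    filter_upwards [σ.continuous.continuousAt.preimage_mem_nhds ((isOpen_star (σ t).base).mem_nhds
      (mem_supp.1 (σ t).base_mem))] with t' ht'
    exact Finset.card_le_one.1 (h t') _ (base_mem _) _ (mem_supp.2 ht')
  exact this.apply_eq_of_preconnectedSpace s t

lemma eq_vertex_base {x : K.Realization} (h : x.supp.card ≤ 1) : x = vertex K x.base :=
  eq_vertex_of_supp_subset fun _ hv ↦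
    Finset.mem_singleton.2 (Finset.card_le_one.1 h _ hv _ x.base_mem)

lemma transportHom_cellularBoundaries (z : SingularChains G K.Realization 1)
    (hz : z ∈ cellularBoundaries G K.Realization 1) : transportHom α z = 0 := by
  obtain ⟨a, ha, b, ⟨b, -, rfl⟩, rfl⟩ := Submodule.mem_sup.1 hz
  rw [map_add, transportHom_boundary, add_zero]
  refine chainsIn_induction _ (p := fun c ↦ transportHom α c = 0) (map_zero _) (fun σ hσ ↦ ?_)
    (fun a b ha hb ↦ by rw [map_add, ha, hb, add_zero]) (fun a ha ↦ by rw [map_neg, ha, neg_zero]) ha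
  have hσ' : ∀ t, (σ t).supp.card ≤ 1 := fun t ↦ mem_gSkeletonLT.1 (hσ t)
  rw [transportHom, chainLift_chainGen, transport_of_supp_subset _
    (K.singleton_mem (σ (stdVertex 0)).base) (fun t ↦ ?_), base_eq_of_card_le_one σ hσ' (stdVertex 1)
      (stdVertex 0), (univCocycle_isCocycle K α).self]
  rw [eq_vertex_base (hσ' t), supp_vertex, base_eq_of_card_le_one σ hσ' t (stdVertex 0)]

/-- The transport of the universal cocycle on cellular `1`-chains. -/
noncomputable def cellTransport : CellularChains G K.Realization 1 →+ CocycleModule K α :=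
  cellLift (transportHom α) (transportHom_cellularBoundaries α)

lemma cellTransport_smul (r : MonoidAlgebra ℤ G) (c : CellularChains G K.Realization 1) :
    cellTransport α (r • c) = α r • cellTransport α c := by
  refine MonoidAlgebra.map_smul_of_single α _ (fun g c ↦ ?_) r c
  obtain ⟨z, hz, rfl⟩ := cellMk_surjective c
  rw [← cellMk_smul, cellTransport, cellLift_cellMk, cellLift_cellMk]
  let a : G → CocycleModule K α →+ CocycleModule K α := fun g ↦
    DistribSMul.toAddMonoidHom _ (agr α g)
  exact chainLift_single_smul G (a := a) (fun g σ ↦ transport_smulSimplex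
    (univCocycle_isCocycle K α) (a := a) (univCocycle_isEquivariant K α) g σ) g z

lemma cellTransport_edgeCell {v w : Vertex G I} (h : K.Adj v w) :
    cellTransport α (edgeCell h) = univCocycle K α v w := by
  rw [edgeCell, cellTransport, cellLift_cellMk, transportHom, chainLift_chainGen, transport_edge]

/-- The map from the cokernel to the universal module given by transport. -/
noncomputable def cokerToCocycle : CokerOne K α →ₗ[D] CocycleModule K α :=
  Submodule.liftQ _ (BalancedTensor.lift α (cellTransport α) (cellTransport_smul α)) <| by
    rintro _ ⟨x, rfl⟩
    rw [LinearMap.mem_ker, ← LinearMap.comp_apply]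
    refine LinearMap.congr_fun (g := 0) (BalancedTensor.hom_ext_unit α fun c ↦ ?_) x
    obtain ⟨z, hz, rfl⟩ := cellMk_surjective c
    rw [LinearMap.comp_apply, BalancedTensor.map_unit, BalancedTensor.lift_unit,
      cellularBoundary_cellMk, cellTransport, cellLift_cellMk, transportHom_boundary]
    rfl

lemma cokerToCocycle_cokerMk (c : CellularChains G K.Realization 1) :
    cokerToCocycle α (cokerMk K α c) = cellTransport α c :=
  BalancedTensor.lift_unit α _ (cellTransport_smul α) c

lemma cocycleToCoker_cellTransport_of_mem {c : SingularChains G K.Realization 1}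
    (h : c ∈ edgeChains K) (hc : c ∈ cellularCycles G K.Realization 1) :
    cocycleToCoker α (cellTransport α (cellMk c hc)) = cokerMk K α (cellMk c hc) := by
  revert hc
  induction h using AddSubgroup.closure_induction with
  | mem x hx =>
    obtain ⟨v, w, h, rfl⟩ := hx
    intro _
    change cocycleToCoker α (cellTransport α (edgeCell h)) = cokerMk K α (edgeCell h)
    rw [cellTransport_edgeCell, cocycleToCoker_univCocycle]
  | zero =>
    intro hc
    have h0 : cellMk (0 : SingularChains G K.Realization 1) hc = 0 := rfl
    rw [h0, map_zero, map_zero, map_zero]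
  | add x y hx hy hx' hy' =>
    intro hc
    have h0 : cellMk (x + y) hc = cellMk x (edgeChains_le hx) + cellMk y (edgeChains_le hy) := rfl
    rw [h0, map_add, map_add, map_add, hx', hy']
  | neg x hx hx' =>
    intro hc
    have h0 : cellMk (-x) hc = -cellMk x (edgeChains_le hx) := rfl
    rw [h0, map_neg, map_neg, map_neg, hx']

/-- Every cellular `1`-chain becomes a combination of edges modulo boundaries. -/
lemma cocycleToCoker_cellTransport (c : CellularChains G K.Realization 1) :
    cocycleToCoker α (cellTransport α c) = cokerMk K α c := by
  obtain ⟨z, hz, rfl⟩ := cellMk_surjective c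
  obtain ⟨e, he, b, hb⟩ := exists_edgeChain hz
  have hcyc : singularBoundary G K.Realization 2 1 b ∈ cellularCycles G K.Realization 1 := by
    rw [hb]; exact sub_mem hz (edgeChains_le he)
  have hsum : cellMk z hz = cellMk _ hcyc + cellMk e (edgeChains_le he) := by
    rw [← cellMk_add]
    congr 1
    rw [hb, sub_add_cancel]
  have h0 : cellTransport α (cellMk _ hcyc) = 0 := transportHom_boundary α b
  rw [hsum, map_add, map_add, map_add, cocycleToCoker_cellTransport_of_mem α he, h0,
    cokerMk_boundary, map_zero]

/-- The cokernel of the second cellular differential after extension of scalars is the universal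
module for equivariant simplicial cocycles. -/
noncomputable def cokerEquivCocycle : CokerOne K α ≃ₗ[D] CocycleModule K α :=
  LinearEquiv.ofLinearMap (cokerToCocycle α) (cocycleToCoker α)
    (cocycleModule_hom_ext α fun v w h ↦ by
      rw [LinearMap.comp_apply, cocycleToCoker_univCocycle α h, cokerToCocycle_cokerMk,
        cellTransport_edgeCell]; rfl)
    (Submodule.linearMap_qext _ (BalancedTensor.hom_ext_unit α fun c ↦ by
      change cocycleToCoker α (cokerToCocycle α (cokerMk K α c)) = cokerMk K α c
      rw [cokerToCocycle_cokerMk, cocycleToCoker_cellTransport]))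

end Cokernel

end Realization

end ColouredComplex

/-! ### Betti numbers determine the dimension of the cocycle module -/

namespace ColouredComplex

variable {G I : Type u} [Group G] {K : ColouredComplex G I}

namespace Realization

lemma const_vertex_mem_cellularCycles (v : Vertex G I) :
    chainGen G (.const (StdSimp 0) (vertex K v)) ∈ cellularCycles G K.Realization 0 :=
  mem_cellularCycles_zero_iff.2 <| chainGen_mem_chainsIn _ fun t ↦ mem_gSkeletonLT.2 (by
    rw [ContinuousMap.const_apply, supp_vertex, Finset.card_singleton])

variable (K) in
/-- The class of a vertex in the cellular chains. -/
noncomputable def vertexCell (v : Vertex G I) : CellularChains G K.Realization 0 :=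
  cellMk _ (const_vertex_mem_cellularCycles v)

lemma single_smul_vertexCell (g : G) (v : Vertex G I) :
    MonoidAlgebra.single g (1 : ℤ) • vertexCell K v = vertexCell K (g • v) := by
  rw [vertexCell, ← cellMk_smul, vertexCell]
  congr 1
  rw [single_smul_chainGen]
  congr 1
  refine ContinuousMap.ext fun _ ↦ ?_
  exact smul_vertex g v

section Base

variable {D : Type u} [DivisionRing D] (α : AgrarianMap G D) [LinearOrder I]

variable (K) in
/-- The map sending a singular `0`-simplex to the orbit of its base vertex, weighted by the position
of the base vertex in this orbit. -/
noncomputable def baseHom : SingularChains G K.Realization 0 →+ (I →₀ D) :=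
  chainLift G fun σ ↦ Finsupp.single (σ (stdSimplex.vertex 0)).base.colour (agr α (σ (stdSimplex.vertex 0)).base.elt)

lemma baseHom_cellularBoundaries (z : SingularChains G K.Realization 0)
    (hz : z ∈ cellularBoundaries G K.Realization 0) : baseHom K α z = 0 := by
  obtain ⟨a, ha, _, ⟨b, hb, rfl⟩, rfl⟩ := Submodule.mem_sup.1 hz
  have h1 : baseHom K α a = 0 :=
    chainsIn_induction _ (p := fun c ↦ baseHom K α c = 0) (map_zero _)
      (fun σ hσ ↦ absurd (mem_gSkeletonLT.1 (hσ (stdSimplex.vertex 0)))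
        (not_le.2 (σ (stdSimplex.vertex 0)).supp_nonempty.card_pos))
      (fun a b ha hb ↦ by rw [map_add, ha, hb, add_zero])
      (fun a ha ↦ by rw [map_neg, ha, neg_zero]) ha
  have h2 : baseHom K α (singularBoundary G K.Realization 1 0 b) = 0 := by
    refine chainsIn_induction _
      (p := fun c ↦ baseHom K α (singularBoundary G K.Realization 1 0 c) = 0)
      (by rw [map_zero, map_zero]) (fun σ hσ ↦ ?_)
      (fun a b ha hb ↦ by rw [map_add, map_add, ha, hb, add_zero])
      (fun a ha ↦ by rw [map_neg, map_neg, ha, neg_zero]) hb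
    rw [singularBoundary_chainGen_one, map_sub, baseHom, chainLift_chainGen, chainLift_chainGen,
      ContinuousMap.const_apply, ContinuousMap.const_apply,
      base_eq_of_card_le_one σ (fun t ↦ mem_gSkeletonLT.1 (hσ t)) (stdVertex 1) (stdVertex 0),
      sub_self]
  rw [map_add, h1, h2, add_zero]

variable (K) in
/-- The map induced by `baseHom` on cellular chains. -/
noncomputable def cellBase : CellularChains G K.Realization 0 →+ (I →₀ D) :=
  cellLift (baseHom K α) (baseHom_cellularBoundaries α)

lemma cellBase_vertexCell (v : Vertex G I) :
    cellBase K α (vertexCell K v) = Finsupp.single v.colour (agr α v.elt) := by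
  rw [vertexCell, cellBase, cellLift_cellMk, baseHom, chainLift_chainGen,
    ContinuousMap.const_apply, base_vertex]

lemma cellBase_smul (r : MonoidAlgebra ℤ G) (c : CellularChains G K.Realization 0) :
    cellBase K α (r • c) = α r • cellBase K α c := by
  refine MonoidAlgebra.map_smul_of_single α _ (fun g c ↦ ?_) r c
  obtain ⟨z, hz, rfl⟩ := cellMk_surjective c
  rw [← cellMk_smul, cellBase, cellLift_cellMk, cellLift_cellMk]
  let a : G → (I →₀ D) →+ (I →₀ D) := fun g ↦ DistribSMul.toAddMonoidHom _ (agr α g)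
  refine chainLift_single_smul G (a := a) (fun g σ ↦ ?_) g z
  change Finsupp.single (g • σ (stdSimplex.vertex 0)).base.colour (agr α (g • σ (stdSimplex.vertex 0)).base.elt) =
    agr α g • Finsupp.single (σ (stdSimplex.vertex 0)).base.colour (agr α (σ (stdSimplex.vertex 0)).base.elt)
  rw [base_smul, Finsupp.smul_single, smul_eq_mul, ← agr_mul]
  rfl

lemma cellularChains_zero_induction {p : CellularChains G K.Realization 0 → Prop}
    (zero : p 0) (vert : ∀ v, p (vertexCell K v)) (add : ∀ x y, p x → p y → p (x + y))
    (neg : ∀ x, p x → p (-x)) (c : CellularChains G K.Realization 0) : p c := by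
  obtain ⟨z, hz, rfl⟩ := cellMk_surjective c
  have key : ∃ hz, p (cellMk z hz) := by
    refine chainsIn_induction _ (p := fun z ↦ ∃ hz, p (cellMk z hz)) ⟨zero_mem _, zero⟩
      (fun σ hσ ↦ ?_) ?_ ?_ (mem_cellularCycles_zero_iff.1 hz)
    · have hσ' : σ = .const _ (vertex K (σ (stdSimplex.vertex 0)).base) := by
        refine ContinuousMap.ext fun t ↦ ?_
        rw [Subsingleton.elim t (stdSimplex.vertex 0)]
        exact eq_vertex_base (mem_gSkeletonLT.1 (hσ _))
      rw [hσ']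
      exact ⟨_, vert _⟩
    · rintro a b ⟨ha, ha'⟩ ⟨hb, hb'⟩
      exact ⟨add_mem ha hb, add _ _ ha' hb'⟩
    · rintro a ⟨ha, ha'⟩
      exact ⟨neg_mem ha, neg _ ha'⟩
  exact key.choose_spec

variable (K) in
/-- After extension of scalars, the cellular `0`-chains are free on the orbits of vertices. -/
noncomputable def cellularChainsZeroEquiv :
    BalancedTensor α (CellularChains G K.Realization 0) ≃ₗ[D] (I →₀ D) :=
  LinearEquiv.ofLinearMap (BalancedTensor.lift α (cellBase K α) (cellBase_smul α))
    (Finsupp.lift _ D I fun i ↦ BalancedTensor.unit α (vertexCell K ⟨1, i⟩))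
    (Finsupp.lhom_ext fun i d ↦ by
      rw [LinearMap.comp_apply, Finsupp.lift_apply, Finsupp.sum_single_index (by exact zero_smul _ _),
        map_smul, BalancedTensor.lift_unit, cellBase_vertexCell, agr_one]
      simp)
    (BalancedTensor.hom_ext_unit α fun c ↦ by
      rw [LinearMap.comp_apply, BalancedTensor.lift_unit, LinearMap.id_apply]
      induction c using cellularChains_zero_induction with
      | zero => simp
      | vert v =>
        rw [cellBase_vertexCell, Finsupp.lift_apply, Finsupp.sum_single_index (by exact zero_smul _ _),
          ← BalancedTensor.unit_smul, single_smul_vertexCell, Vertex.smul_mk, mul_one]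
      | add x y hx hy => rw [map_add, map_add, map_add, hx, hy]
      | neg x hx => rw [map_neg, map_neg, map_neg, hx])

lemma toENat_rank_cellularChains_zero [Fintype I] :
    Cardinal.toENat (Module.rank D (BalancedTensor α (CellularChains G K.Realization 0))) =
      Fintype.card I := by
  rw [(cellularChainsZeroEquiv K α).rank_eq, rank_finsupp_self']
  simp

/-- If the Betti numbers of the realization agree for two agrarian maps, then so do the dimensions
of the universal modules for equivariant cocycles. -/
lemma finrank_cocycleModule_eq [Finite I] {D' : Type u} [DivisionRing D'] (α' : AgrarianMap G D')
    (h : ∀ p, agrarianBetti G K.Realization α p = agrarianBetti G K.Realization α' p) :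
    Module.finrank D (CocycleModule K α) = Module.finrank D' (CocycleModule K α') := by
  cases nonempty_fintype I
  have key {D : Type u} [DivisionRing D] (α : AgrarianMap G D) :
      (Module.finrank D (CocycleModule K α) : ℕ∞) + agrarianBetti G K.Realization α 0 =
        agrarianBetti G K.Realization α 1 + Fintype.card I ∧
      agrarianBetti G K.Realization α 0 ≤ Fintype.card I := by
    constructor
    · have h1 := toENat_rank_coker_add_bettiNumber α (cellularComplex G K.Realization)
      have h2 : Cardinal.toENat (Module.rank D (CokerOne K α)) =
          (Module.finrank D (CocycleModule K α) : ℕ∞) := by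
        rw [(cokerEquivCocycle α).rank_eq, ← Module.finrank_eq_rank]
        simp
      rw [← h2, ← toENat_rank_cellularChains_zero (K := K) α]
      exact h1
    · rw [← toENat_rank_cellularChains_zero (K := K) α]
      refine (bettiNumber_eq_toENat_rank α (cellularComplex G K.Realization) (i := 1) (j := 0)
        (k := 0) (by simp) (by simp) (map_d_map_d α _ _ _ _)).le.trans ?_
      exact OrderHomClass.mono _ ((rank_quotient_le _).trans (Submodule.rank_le _))
  -- only a finite Betti number may be cancelled
  have hfin : agrarianBetti G K.Realization α 0 ≠ ⊤ :=
    ne_top_of_le_ne_top (ENat.natCast_ne_top _) (key α).2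
  have h1 := (key α).1.trans (h 1 ▸ (key α').1.symm)
  rw [← h 0] at h1
  exact ENat.natCast_inj.1 (WithTop.add_right_cancel hfin h1)

end Base

/-- The realization is connected if its graph is. -/
lemma connectedSpace [Nonempty I] (h : ∀ v w, Relation.ReflTransGen K.Adj v w) :
    ConnectedSpace K.Realization := by
  have hpath (σ : C(StdSimp 1, K.Realization)) : connectedComponent (σ (stdVertex 0)) =
      connectedComponent (σ (stdVertex 1)) :=
    connectedComponent_eq ((isPreconnected_range σ.continuous).subset_connectedComponent
      ⟨_, rfl⟩ ⟨_, rfl⟩)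
  have hvert (v w : Vertex G I) : connectedComponent (vertex K v) = connectedComponent (vertex K w) := by
    induction h v w with
    | refl => rfl
    | tail _ hvw ih =>
      have := hpath (edge hvw)
      rw [edge, seg, affine_apply_vertex, affine_apply_vertex] at this
      exact ih.trans this
  have hpt (x : K.Realization) : ∃ v, connectedComponent (vertex K v) = connectedComponent x := by
    obtain ⟨v, hv⟩ := x.supp_nonempty
    have := hpath (ray hv)
    rw [ray, seg, affine_apply_vertex, affine_apply_vertex] at this
    exact ⟨v, this⟩
  have : Nonempty K.Realization := ⟨vertex K ⟨1, Classical.arbitrary I⟩⟩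
  refine connectedSpace_iff_connectedComponent.2 ⟨Classical.arbitrary _, Set.eq_univ_of_forall fun y ↦ ?_⟩
  obtain ⟨v, hv⟩ := hpt (Classical.arbitrary _)
  obtain ⟨w, hw⟩ := hpt y
  rw [← hv, hvert v w, hw]
  exact mem_connectedComponent

end Realization

end ColouredComplex

/-! ### Complexes generated by triangles -/

/-- For an alternating function on pairs, the cocycle condition on a triangle is one equation. -/
lemma cocycle_on_triangle {V N : Type*} [AddCommGroup N] {c : V → V → N} (h0 : ∀ v, c v v = 0)
    (h1 : ∀ v w, c w v = -c v w) {x y z : V} (h : c x y + c y z = c x z) {b : Finset V}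
    (hb : ∀ u ∈ b, u = x ∨ u = y ∨ u = z) : ∀ u ∈ b, ∀ v ∈ b, ∀ w ∈ b, c u v + c v w = c u w := by
  -- on the triangle, the function is the coboundary of its values on the edges at `x`
  have key : ∀ u ∈ b, ∀ v ∈ b, c u v = c x v - c x u := by
    intro u hu v hv
    rcases hb u hu with rfl | rfl | rfl <;> rcases hb v hv with rfl | rfl | rfl
    · simp [h0]
    · simp [h0]
    · simp [h0]
    · rw [h0, h1 _ u, zero_sub]
    · simp [h0]
    · rw [← h]; abel
    · rw [h0, h1 _ u, zero_sub]
    · rw [← h, h1 v u]; abel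
    · simp [h0]
  intro u hu v hv w hw
  rw [key u hu v hv, key v hv w hw, key u hu w hw]
  abel

namespace ColouredComplex

variable {G I : Type u} [Group G]

/-- The coloured complex whose simplices are the vertices and the nonempty subsets of the translates
of the members of a finite family of sets of at most three vertices of distinct colours. -/
def generate (B : Set (Finset (Vertex G I))) (hfin : B.Finite) (hcard : ∀ b ∈ B, b.card ≤ 3)
    (hcol : ∀ b ∈ B, ∀ v ∈ b, ∀ w ∈ b, v.colour = w.colour → v = w) : ColouredComplex G I where
  simplices := {s | s.Nonempty ∧ ((∃ v, s ⊆ {v}) ∨ ∃ g, ∃ b ∈ B, s ⊆ Vertex.translate g b)}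
  nonempty h := h.1
  mono h hst ht := ⟨ht, h.2.imp (fun ⟨v, hv⟩ ↦ ⟨v, hst.trans hv⟩)
    fun ⟨g, b, hb, h⟩ ↦ ⟨g, b, hb, hst.trans h⟩⟩
  translate_mem g s h := by
    refine ⟨h.1.map, h.2.imp (fun ⟨v, hv⟩ ↦ ⟨g • v, ?_⟩) fun ⟨k, b, hb, h⟩ ↦ ⟨g * k, b, hb, ?_⟩⟩
    · exact (Finset.map_subset_map.2 hv).trans (by simp)
    · intro v hv
      have := h (Vertex.mem_translate.1 hv)
      rw [Vertex.mem_translate] at this ⊢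
      rwa [mul_inv_rev, mul_smul]
  singleton_mem v := ⟨Finset.singleton_nonempty v, .inl ⟨v, fun _ ↦ id⟩⟩
  colour_injOn := by
    rintro s ⟨-, ⟨u, hu⟩ | ⟨g, b, hb, h⟩⟩ v hv w hw hvw
    · rw [Finset.mem_singleton.1 (hu hv), Finset.mem_singleton.1 (hu hw)]
    · exact MulAction.injective g⁻¹ (hcol b hb _ (Vertex.mem_translate.1 (h hv)) _
        (Vertex.mem_translate.1 (h hw)) hvw)
  card_le := by
    rintro s ⟨-, ⟨u, hu⟩ | ⟨g, b, hb, h⟩⟩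
    · exact (Finset.card_le_card hu).trans (by simp)
    · exact (Finset.card_le_card h).trans ((Finset.card_map _).le.trans (hcard b hb))
  finite_star v := by
    classical
    refine ((Set.finite_singleton {v}).union (hfin.biUnion fun b _ ↦ b.finite_toSet.biUnion fun w _ ↦
      (Vertex.translate (v.elt * w.elt⁻¹) b).powerset.finite_toSet)).subset ?_
    rintro s ⟨⟨-, ⟨u, hu⟩ | ⟨g, b, hb, h⟩⟩, hv⟩
    · obtain rfl := Finset.mem_singleton.1 (hu hv)
      exact .inl (Finset.Subset.antisymm hu (Finset.singleton_subset_iff.2 hv))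
    · refine .inr (Set.mem_iUnion₂.2 ⟨b, hb, Set.mem_iUnion₂.2
        ⟨g⁻¹ • v, Vertex.mem_translate.1 (h hv), ?_⟩⟩)
      have : v.elt * (g⁻¹ • v).elt⁻¹ = g := by simp
      rw [this]
      exact Finset.mem_coe.2 (Finset.mem_powerset.2 h)

section Generate

variable {B : Set (Finset (Vertex G I))} {hfin : B.Finite} {hcard : ∀ b ∈ B, b.card ≤ 3}
  {hcol : ∀ b ∈ B, ∀ v ∈ b, ∀ w ∈ b, v.colour = w.colour → v = w}

lemma mem_generate {b : Finset (Vertex G I)} (hb : b ∈ B) (hne : b.Nonempty) :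
    b ∈ (generate B hfin hcard hcol).simplices :=
  ⟨hne, .inr ⟨1, b, hb, fun v hv ↦ Vertex.mem_translate.2 (by simpa using hv)⟩⟩

lemma adj_generate {b : Finset (Vertex G I)} (hb : b ∈ B) {v w : Vertex G I} (hv : v ∈ b)
    (hw : w ∈ b) : (generate B hfin hcard hcol).Adj v w := ⟨b, mem_generate hb ⟨v, hv⟩, hv, hw⟩

lemma adj_generate_iff {v w : Vertex G I} : (generate B hfin hcard hcol).Adj v w ↔
    v = w ∨ ∃ (g : G), ∃ b ∈ B, g⁻¹ • v ∈ b ∧ g⁻¹ • w ∈ b := by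
  constructor
  · rintro ⟨s, ⟨-, ⟨u, hu⟩ | ⟨g, b, hb, h⟩⟩, hv, hw⟩
    · exact .inl ((Finset.mem_singleton.1 (hu hv)).trans (Finset.mem_singleton.1 (hu hw)).symm)
    · exact .inr ⟨g, b, hb, Vertex.mem_translate.1 (h hv), Vertex.mem_translate.1 (h hw)⟩
  · rintro (rfl | ⟨g, b, hb, hv, hw⟩)
    · exact ⟨{v}, ColouredComplex.singleton_mem _ v, by simp, by simp⟩
    · exact ⟨_, ⟨⟨v, Vertex.mem_translate.2 hv⟩, .inr ⟨g, b, hb, fun _ ↦ id⟩⟩,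
        Vertex.mem_translate.2 hv, Vertex.mem_translate.2 hw⟩

variable {D N : Type u} [DivisionRing D] [AddCommGroup N] [Module D N] {α : AgrarianMap G D}

lemma isCocycle_generate {c : Vertex G I → Vertex G I → N} (he : IsEquivariant α c)
    (h0 : ∀ v, c v v = 0) (h : ∀ b ∈ B, ∀ u ∈ b, ∀ v ∈ b, ∀ w ∈ b, c u v + c v w = c u w) :
    (generate B hfin hcard hcol).IsCocycle c := by
  rintro s ⟨-, ⟨x, hx⟩ | ⟨g, b, hb, hs⟩⟩ u hu v hv w hw
  · rw [Finset.mem_singleton.1 (hx hu), Finset.mem_singleton.1 (hx hv),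
      Finset.mem_singleton.1 (hx hw), h0, add_zero]
  · have := congrArg (agr α g • ·) (h b hb _ (Vertex.mem_translate.1 (hs hu)) _
      (Vertex.mem_translate.1 (hs hv)) _ (Vertex.mem_translate.1 (hs hw)))
    simpa only [smul_add, ← he g, smul_inv_smul] using this

end Generate

variable {K : ColouredComplex G I} {D N : Type u} [DivisionRing D] [AddCommGroup N] [Module D N]
  (α : AgrarianMap G D)

/-- The universal property of the cocycle module, for cocycles with arbitrary values on pairs of
vertices which are not adjacent. -/
lemma exists_linearMap_univCocycle {c : Vertex G I → Vertex G I → N} (he : IsEquivariant α c)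
    (hc : K.IsCocycle c) : ∃ φ : CocycleModule K α →ₗ[D] N,
      ∀ v w, K.Adj v w → φ (univCocycle K α v w) = c v w := by
  classical
  have hadj (g : G) (v w) : K.Adj (g • v) (g • w) ↔ K.Adj v w :=
    ⟨fun h ↦ by simpa using Realization.adj_smul g⁻¹ h, Realization.adj_smul g⟩
  refine ⟨cocycleLift α (fun v w ↦ if K.Adj v w then c v w else 0) (fun g v w ↦ ?_)
    (fun v w h ↦ if_neg h) (fun s hs u hu v hv w hw ↦ ?_), fun v w h ↦ ?_⟩
  · simp only [hadj, he g v w, smul_ite, smul_zero]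
  · have huv : K.Adj u v := ⟨s, hs, hu, hv⟩
    have hvw : K.Adj v w := ⟨s, hs, hv, hw⟩
    have huw : K.Adj u w := ⟨s, hs, hu, hw⟩
    simp only [if_pos huv, if_pos hvw, if_pos huw, hc s hs u hu v hv w hw]
  · exact (cocycleLift_univCocycle α _ _ _ _ v w).trans (if_pos h)

end ColouredComplex

/-! ### Encoding partial derivations by cocycles -/

/-- The colours of the vertices of the complex attached to a partial group with elements `E`: three
base points, and midpoints of the three kinds of arcs labelled by `E` which join base points. -/
inductive Colour (E : Type u) : Type u
  | base0 | base1 | base2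
  | mid01 (e : E) | mid12 (e : E) | mid02 (e : E)

instance (E : Type u) [Finite E] : Finite (Colour E) := by
  let f : Fin 3 ⊕ (E ⊕ (E ⊕ E)) → Colour E := Sum.elim ![.base0, .base1, .base2]
    (Sum.elim .mid01 (Sum.elim .mid12 .mid02))
  refine Finite.of_surjective f fun c ↦ ?_
  cases c with
  | base0 => exact ⟨.inl 0, rfl⟩
  | base1 => exact ⟨.inl 1, rfl⟩
  | base2 => exact ⟨.inl 2, rfl⟩
  | mid01 e => exact ⟨.inr (.inl e), rfl⟩
  | mid12 e => exact ⟨.inr (.inr (.inl e)), rfl⟩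
  | mid02 e => exact ⟨.inr (.inr (.inr e)), rfl⟩

section Derivation

variable {G E : Type u} [Group G]

/-- A triple of elements of `E` whose images in `G` multiply. -/
def Composable (h : E → G) : Set (E × E × E) := {t | h t.1 * h t.2.1 = h t.2.2}

/-- A map `q` from `E` to a module over the target of `α` behaves like a derivation for the formal
equation `t.1 * t.2.1 = t.2.2`. -/
def IsDerivationAt {D N : Type u} [DivisionRing D] [AddCommGroup N] [Module D N]
    (α : AgrarianMap G D) (h : E → G) (q : E → N) (t : E × E × E) : Prop :=
  q t.1 + α (MonoidAlgebra.single (h t.1) 1) • q t.2.1 = q t.2.2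

/-- All derivations for the formal equations in `T` are derivations for the formal equation `t`. -/
def DerivationImplies {D : Type u} [DivisionRing D] (α : AgrarianMap G D) (h : E → G)
    (T : Set (E × E × E)) (t : E × E × E) : Prop :=
  ∀ (N : Type u) [AddCommGroup N] [Module D N] (q : E → N),
    (∀ s ∈ T, IsDerivationAt α h q s) → IsDerivationAt α h q t

end Derivation

namespace ColouredComplex

open Colour

variable {G E : Type u} [Group G] (h : E → G)

open Classical in
/-- A triangle between the first base point and the midpoints of two arcs leaving it. -/
noncomputable def startTriangle (e : E × E) : Finset (Vertex G (Colour E)) :=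
  {⟨1, base0⟩, ⟨1, mid01 e.1⟩, ⟨1, mid02 e.2⟩}

open Classical in
/-- A triangle between the second base point and the midpoints of two arcs through it. -/
noncomputable def middleTriangle (e : E × E) : Finset (Vertex G (Colour E)) :=
  {⟨1, mid01 e.1⟩, ⟨h e.1, base1⟩, ⟨h e.1, mid12 e.2⟩}

open Classical in
/-- A triangle between the third base point and the midpoints of two arcs leading to it. -/
noncomputable def endTriangle (t : E × E × E) : Finset (Vertex G (Colour E)) :=
  {⟨h t.1, mid12 t.2.1⟩, ⟨h t.2.2, base2⟩, ⟨1, mid02 t.2.2⟩}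

open Classical in
/-- The triangle between the midpoints of three arcs, which encodes a formal equation. -/
noncomputable def centralTriangle (t : E × E × E) : Finset (Vertex G (Colour E)) :=
  {⟨1, mid01 t.1⟩, ⟨h t.1, mid12 t.2.1⟩, ⟨1, mid02 t.2.2⟩}

lemma mem_startTriangle {e : E × E} {v : Vertex G (Colour E)} : v ∈ startTriangle e ↔
    v = ⟨1, base0⟩ ∨ v = ⟨1, mid01 e.1⟩ ∨ v = ⟨1, mid02 e.2⟩ := by simp [startTriangle]

lemma mem_middleTriangle {e : E × E} {v : Vertex G (Colour E)} : v ∈ middleTriangle h e ↔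
    v = ⟨1, mid01 e.1⟩ ∨ v = ⟨h e.1, base1⟩ ∨ v = ⟨h e.1, mid12 e.2⟩ := by simp [middleTriangle]

lemma mem_endTriangle {t : E × E × E} {v : Vertex G (Colour E)} : v ∈ endTriangle h t ↔
    v = ⟨h t.1, mid12 t.2.1⟩ ∨ v = ⟨h t.2.2, base2⟩ ∨ v = ⟨1, mid02 t.2.2⟩ := by simp [endTriangle]

lemma mem_centralTriangle {t : E × E × E} {v : Vertex G (Colour E)} : v ∈ centralTriangle h t ↔
    v = ⟨1, mid01 t.1⟩ ∨ v = ⟨h t.1, mid12 t.2.1⟩ ∨ v = ⟨1, mid02 t.2.2⟩ := by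
  simp [centralTriangle]

/-- The triangles generating the complex which encodes the formal equations in `T`. -/
def triangles (T : Set (E × E × E)) : Set (Finset (Vertex G (Colour E))) :=
  Set.range startTriangle ∪ Set.range (middleTriangle h) ∪ endTriangle h '' Composable h ∪
    centralTriangle h '' T

lemma triangles_finite [Finite E] (T : Set (E × E × E)) : (triangles h T).Finite :=
  (((Set.finite_range _).union (Set.finite_range _)).union (Set.toFinite _)).union (Set.toFinite _)

lemma forall_triangles {T : Set (E × E × E)} {p : Finset (Vertex G (Colour E)) → Prop} :
    (∀ b ∈ triangles h T, p b) ↔ (∀ e, p (startTriangle e)) ∧ (∀ e, p (middleTriangle h e)) ∧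
      (∀ t ∈ Composable h, p (endTriangle h t)) ∧ ∀ t ∈ T, p (centralTriangle h t) := by
  simp only [triangles, Set.mem_union, or_imp, forall_and, Set.forall_mem_range, Set.forall_mem_image,
    and_assoc]

lemma card_le_three_of_mem_triangles {T : Set (E × E × E)} : ∀ b ∈ triangles h T, b.card ≤ 3 := by
  classical
  refine (forall_triangles h).2 ⟨fun _ ↦ ?_, fun _ ↦ ?_, fun _ _ ↦ ?_, fun _ _ ↦ ?_⟩ <;>
    exact Finset.card_le_three

lemma colour_injOn_of_mem_triangles {T : Set (E × E × E)} : ∀ b ∈ triangles h T,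
    ∀ v ∈ b, ∀ w ∈ b, v.colour = w.colour → v = w := by
  refine (forall_triangles h).2 ⟨fun _ ↦ ?_, fun _ ↦ ?_, fun _ _ ↦ ?_, fun _ _ ↦ ?_⟩ <;>
  · intro v hv w hw hvw
    simp only [startTriangle, middleTriangle, endTriangle, centralTriangle, Finset.mem_insert,
      Finset.mem_singleton] at hv hw
    rcases hv with rfl | rfl | rfl <;> rcases hw with rfl | rfl | rfl <;> simp_all

/-- The complex which encodes the formal equations in `T`. The cocycles on it correspond to the
derivations for these equations, up to choices at the base points: a triangle of arcs bounds once its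
central triangle is filled in. -/
def encode [Finite E] (T : Set (E × E × E)) : ColouredComplex G (Colour E) :=
  generate (triangles h T) (triangles_finite h T)
    (card_le_three_of_mem_triangles h) (colour_injOn_of_mem_triangles h)

variable {T : Set (E × E × E)} {h}

lemma start_mem (e f : E) : startTriangle (e, f) ∈ triangles h T := .inl (.inl (.inl ⟨_, rfl⟩))

lemma middle_mem (e f : E) : middleTriangle h (e, f) ∈ triangles h T := .inl (.inl (.inr ⟨_, rfl⟩))

lemma end_mem {t : E × E × E} (ht : t ∈ Composable h) : endTriangle h t ∈ triangles h T :=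
  .inl (.inr ⟨_, ht, rfl⟩)

lemma central_mem {t : E × E × E} (ht : t ∈ T) : centralTriangle h t ∈ triangles h T :=
  .inr ⟨_, ht, rfl⟩

variable [Finite E]

lemma adj_encode {b : Finset (Vertex G (Colour E))} (hb : b ∈ triangles h T)
    {v w : Vertex G (Colour E)} (hv : v ∈ b) (hw : w ∈ b) : (encode h T).Adj v w :=
  adj_generate hb hv hw

/-- Filling in central triangles does not create new edges. -/
lemma adj_encode_insert {t : E × E × E} (ht : t ∈ Composable h) {v w : Vertex G (Colour E)} :
    (encode h (insert t T)).Adj v w ↔ (encode h T).Adj v w := by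
  have hsub : triangles h T ⊆ triangles h (insert t T) :=
    Set.union_subset_union_right _ (Set.image_mono (Set.subset_insert _ _))
  refine ⟨fun hvw ↦ ?_, fun hvw ↦ ?_⟩
  · rw [encode, adj_generate_iff] at hvw
    obtain rfl | ⟨g, b, hb, hv, hw⟩ := hvw
    · exact adj_generate_iff.2 (.inl rfl)
    · have key : ∀ b ∈ triangles h (insert t T), ∀ v ∈ b, ∀ w ∈ b, ∃ b ∈ triangles h T, v ∈ b ∧ w ∈ b := by
        refine (forall_triangles h).2 ⟨fun e v hv w hw ↦ ⟨_, start_mem _ _, hv, hw⟩,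
          fun e v hv w hw ↦ ⟨_, middle_mem _ _, hv, hw⟩, fun t ht v hv w hw ↦ ⟨_, end_mem ht, hv, hw⟩, ?_⟩
        rintro s (rfl | hs) v hv w hw
        · have h1 := start_mem (h := h) (T := T) s.1 s.2.2
          have h2 := middle_mem (h := h) (T := T) s.1 s.2.1
          have h3 := end_mem (T := T) ht
          simp only [centralTriangle, Finset.mem_insert, Finset.mem_singleton] at hv hw
          rcases hv with rfl | rfl | rfl <;> rcases hw with rfl | rfl | rfl <;>
          first
          | (refine ⟨_, h1, ?_, ?_⟩ <;> · simp [startTriangle])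
          | (refine ⟨_, h2, ?_, ?_⟩ <;> · simp [middleTriangle])
          | (refine ⟨_, h3, ?_, ?_⟩ <;> · simp [endTriangle])
        · exact ⟨_, central_mem hs, hv, hw⟩
      obtain ⟨b, hb, hv, hw⟩ := key b hb _ hv _ hw
      exact adj_generate_iff.2 (.inr ⟨g, b, hb, hv, hw⟩)
  · rw [encode, adj_generate_iff] at hvw ⊢
    exact hvw.imp_right fun ⟨g, b, hb, h⟩ ↦ ⟨g, b, hsub hb, h⟩

/-- The graph of the complex is connected if the formal equations include the laws of a unit and the
images of the formal elements generate the group. -/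
lemma encode_connected (hgen : Subgroup.closure (Set.range h) = ⊤) {o : E}
    (ho : (o, o, o) ∈ Composable h) (v w : Vertex G (Colour E)) :
    Relation.ReflTransGen (encode h T).Adj v w := by
  have : Std.Symm (encode h T).Adj := ⟨fun _ _ ⟨s, hs, hv, hw⟩ ↦ ⟨s, hs, hw, hv⟩⟩
  have hequiv : Equivalence (Relation.ReflTransGen (encode h T).Adj) :=
    ⟨fun _ ↦ .refl, fun h ↦ Std.Symm.symm _ _ h, fun h h' ↦ h.trans h'⟩
  have hsmul (g : G) {v w} (hvw : Relation.ReflTransGen (encode h T).Adj v w) :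
      Relation.ReflTransGen (encode h T).Adj (g • v) (g • w) :=
    hvw.lift (g • ·) fun _ _ ↦ Realization.adj_smul g
  have h1 : h o = 1 := mul_eq_left.1 ho
  have a1 (e : E) : (encode h T).Adj ⟨1, base0⟩ ⟨1, mid01 e⟩ :=
    adj_encode (start_mem e e) (by simp [startTriangle]) (by simp [startTriangle])
  have a2 (e : E) : (encode h T).Adj ⟨1, base0⟩ ⟨1, mid02 e⟩ :=
    adj_encode (start_mem e e) (by simp [startTriangle]) (by simp [startTriangle])
  have a3 (e : E) : (encode h T).Adj ⟨1, mid01 e⟩ ⟨h e, base1⟩ :=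
    adj_encode (middle_mem e e) (by simp [middleTriangle]) (by simp [middleTriangle])
  have a4 (e : E) : (encode h T).Adj ⟨1, base1⟩ ⟨1, mid12 e⟩ :=
    adj_encode (middle_mem o e) (by simp [middleTriangle, h1]) (by simp [middleTriangle, h1])
  have a5 : (encode h T).Adj ⟨1, mid02 o⟩ ⟨1, base2⟩ :=
    adj_encode (end_mem ho) (by simp [endTriangle]) (by simp [endTriangle, h1])
  have b1 : Relation.ReflTransGen (encode h T).Adj ⟨1, base0⟩ ⟨1, base1⟩ := by
    have := (Relation.ReflTransGen.single (a1 o)).tail (a3 o)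
    rwa [h1] at this
  -- every vertex is connected to the first base point with the same group component
  have hcol (g : G) (c : Colour E) :
      Relation.ReflTransGen (encode h T).Adj ⟨g, base0⟩ ⟨g, c⟩ := by
    have : Relation.ReflTransGen (encode h T).Adj ⟨1, base0⟩ ⟨1, c⟩ := by
      cases c with
      | base0 => exact .refl
      | base1 => exact b1
      | base2 => exact (Relation.ReflTransGen.single (a2 o)).tail a5
      | mid01 e => exact .single (a1 e)
      | mid12 e => exact b1.tail (a4 e)
      | mid02 e => exact .single (a2 e)
    simpa [Vertex.smul_mk] using hsmul g this
  have hgrp (g : G) : Relation.ReflTransGen (encode h T).Adj ⟨1, base0⟩ ⟨g, base0⟩ := by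
    have hg : g ∈ Subgroup.closure (Set.range h) := hgen ▸ Subgroup.mem_top g
    induction hg using Subgroup.closure_induction with
    | mem x hx =>
      obtain ⟨e, rfl⟩ := hx
      exact ((Relation.ReflTransGen.single (a1 e)).tail (a3 e)).trans (hequiv.symm (hcol _ _))
    | one => exact .refl
    | mul x y _ _ hx hy =>
      refine hx.trans ?_
      simpa [Vertex.smul_mk] using hsmul x hy
    | inv x _ hx =>
      refine hequiv.symm ?_
      simpa [Vertex.smul_mk] using hsmul x⁻¹ hx
  exact (hequiv.symm ((hgrp v.elt).trans (hcol v.elt v.colour))).trans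
    ((hgrp w.elt).trans (hcol w.elt w.colour))

section Cocycles

variable {D N : Type u} [DivisionRing D] [AddCommGroup N] [Module D N] (α : AgrarianMap G D)

/-- Half of the cocycle of a derivation: it is concentrated at the midpoints of arcs. -/
noncomputable def halfCocycle (q : E → N) (v w : Vertex G (Colour E)) : N :=
  match v.colour, w.colour with
  | mid01 e, base1 => agr α v.elt • q e
  | mid01 e, mid12 _ => agr α v.elt • q e
  | mid12 e, base2 => agr α (v.elt) • q e
  | mid12 e, mid02 _ => agr α v.elt • q e
  | mid02 e, base2 => agr α v.elt • q e
  | mid02 e, mid12 _ => agr α v.elt • q e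
  | _, _ => 0

/-- The cocycle of a derivation. -/
noncomputable def derivationCocycle (q : E → N) (v w : Vertex G (Colour E)) : N :=
  halfCocycle α q v w - halfCocycle α q w v

omit [Finite E] in
lemma derivationCocycle_isEquivariant (q : E → N) : IsEquivariant α (derivationCocycle α q) := by
  have key (g : G) (v w) : halfCocycle α q (g • v) (g • w) = agr α g • halfCocycle α q v w := by
    obtain ⟨x, i⟩ := v
    obtain ⟨y, j⟩ := w
    cases i <;> cases j <;> simp [halfCocycle, agr_mul, mul_smul]
  intro g v w
  rw [derivationCocycle, key, key, ← smul_sub]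
  rfl

lemma derivationCocycle_isCocycle {q : E → N} (hq : ∀ t ∈ T, IsDerivationAt α h q t) :
    (encode h T).IsCocycle (derivationCocycle α q) := by
  have hself (v) : derivationCocycle α q v v = 0 := sub_self _
  have hanti (v w) : derivationCocycle α q w v = -derivationCocycle α q v w := (neg_sub _ _).symm
  refine isCocycle_generate (derivationCocycle_isEquivariant α q) hself
    ((forall_triangles h).2 ⟨fun e ↦ ?_, fun e ↦ ?_, fun t _ ↦ ?_, fun t ht ↦ ?_⟩)
  · refine cocycle_on_triangle hself hanti ?_ fun u ↦ mem_startTriangle.1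
    simp [derivationCocycle, halfCocycle]
  · refine cocycle_on_triangle hself hanti ?_ fun u ↦ (mem_middleTriangle h).1
    simp [derivationCocycle, halfCocycle]
  · refine cocycle_on_triangle hself hanti ?_ fun u ↦ (mem_endTriangle h).1
    simp [derivationCocycle, halfCocycle, sub_eq_add_neg]
  · refine cocycle_on_triangle hself hanti ?_ fun u ↦ (mem_centralTriangle h).1
    have := hq t ht
    rw [IsDerivationAt] at this
    simp [derivationCocycle, halfCocycle, ← this, agr_one]

/-- A cocycle evaluates the boundary of a triangle of arcs like its central triangle. -/
lemma arc_add_arc_sub_arc {c : Vertex G (Colour E) → Vertex G (Colour E) → N}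
    (he : IsEquivariant α c) (hc : (encode h T).IsCocycle c) {t : E × E × E} (ht : t ∈ Composable h) :
    c ⟨1, base0⟩ ⟨1, mid01 t.1⟩ + c ⟨1, mid01 t.1⟩ ⟨h t.1, base1⟩ +
      agr α (h t.1) • (c ⟨1, base1⟩ ⟨1, mid12 t.2.1⟩ + c ⟨1, mid12 t.2.1⟩ ⟨h t.2.1, base2⟩) -
      (c ⟨1, base0⟩ ⟨1, mid02 t.2.2⟩ + c ⟨1, mid02 t.2.2⟩ ⟨h t.2.2, base2⟩) =
    c ⟨1, mid01 t.1⟩ ⟨h t.1, mid12 t.2.1⟩ + c ⟨h t.1, mid12 t.2.1⟩ ⟨1, mid02 t.2.2⟩ -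
      c ⟨1, mid01 t.1⟩ ⟨1, mid02 t.2.2⟩ := by
  have hs := hc _ (mem_generate (start_mem t.1 t.2.2) ⟨_, mem_startTriangle.2 (.inl rfl)⟩)
    ⟨1, base0⟩ (mem_startTriangle.2 (.inl rfl)) ⟨1, mid01 t.1⟩ (mem_startTriangle.2 (.inr (.inl rfl)))
    ⟨1, mid02 t.2.2⟩ (mem_startTriangle.2 (.inr (.inr rfl)))
  have hm := hc _ (mem_generate (middle_mem t.1 t.2.1) ⟨_, (mem_middleTriangle h).2 (.inl rfl)⟩)
    ⟨1, mid01 t.1⟩ ((mem_middleTriangle h).2 (.inl rfl)) ⟨h t.1, base1⟩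
    ((mem_middleTriangle h).2 (.inr (.inl rfl))) ⟨h t.1, mid12 t.2.1⟩
    ((mem_middleTriangle h).2 (.inr (.inr rfl)))
  have hd := hc _ (mem_generate (end_mem ht) ⟨_, (mem_endTriangle h).2 (.inl rfl)⟩)
    ⟨h t.1, mid12 t.2.1⟩ ((mem_endTriangle h).2 (.inl rfl)) ⟨1, mid02 t.2.2⟩
    ((mem_endTriangle h).2 (.inr (.inr rfl))) ⟨h t.2.2, base2⟩
    ((mem_endTriangle h).2 (.inr (.inl rfl)))
  have ht' : h t.1 * h t.2.1 = h t.2.2 := ht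
  rw [smul_add, ← he, ← he, Vertex.smul_mk, Vertex.smul_mk, Vertex.smul_mk, mul_one, ht', ← hs, ← hm,
    ← hd]
  abel

/-- The arcs of a cocycle on the complex, based at the arcs of the unit, form a derivation. -/
lemma isDerivationAt_arc_iff {c : Vertex G (Colour E) → Vertex G (Colour E) → N}
    (he : IsEquivariant α c) (hc : (encode h T).IsCocycle c) {o : E}
    (ho : ∀ e, (o, e, e) ∈ T ∧ (e, o, e) ∈ T) (hT : T ⊆ Composable h) {t : E × E × E}
    (ht : t ∈ Composable h) : IsDerivationAt α h (fun e ↦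
      c ⟨1, base0⟩ ⟨1, mid01 e⟩ + c ⟨1, mid01 e⟩ ⟨h e, base1⟩ -
        (c ⟨1, base0⟩ ⟨1, mid01 o⟩ + c ⟨1, mid01 o⟩ ⟨h o, base1⟩)) t ↔
    c ⟨1, mid01 t.1⟩ ⟨h t.1, mid12 t.2.1⟩ + c ⟨h t.1, mid12 t.2.1⟩ ⟨1, mid02 t.2.2⟩ =
      c ⟨1, mid01 t.1⟩ ⟨1, mid02 t.2.2⟩ := by
  have key {t : E × E × E} (ht : t ∈ T) := arc_add_arc_sub_arc α he hc (hT ht)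
  have cen {t : E × E × E} (ht : t ∈ T) := hc _ (mem_generate (central_mem ht)
    ⟨_, (mem_centralTriangle h).2 (.inl rfl)⟩) ⟨1, mid01 t.1⟩ ((mem_centralTriangle h).2 (.inl rfl))
    ⟨h t.1, mid12 t.2.1⟩ ((mem_centralTriangle h).2 (.inr (.inl rfl))) ⟨1, mid02 t.2.2⟩
    ((mem_centralTriangle h).2 (.inr (.inr rfl)))
  have h1 : h o = 1 := mul_eq_left.1 (hT (ho o).1)
  have ht' : h t.1 * h t.2.1 = h t.2.2 := ht
  rw [← sub_eq_zero (b := c ⟨1, mid01 t.1⟩ ⟨1, mid02 t.2.2⟩), ← arc_add_arc_sub_arc α he hc ht,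
    IsDerivationAt, ← sub_eq_zero]
  -- the arcs of the other two kinds are determined by those of the first kind
  have hl (e : E) := (key (ho e).1).trans (sub_eq_zero.2 (cen (ho e).1))
  have hr (e : E) := (key (ho e).2).trans (sub_eq_zero.2 (cen (ho e).2))
  simp only [h1, agr_one, one_smul] at hl hr
  rw [h1]
  generalize hq01 : (fun e : E ↦ c ⟨1, base0⟩ ⟨1, mid01 e⟩ + c ⟨1, mid01 e⟩ ⟨h e, base1⟩) = q01
  generalize hq12 : (fun e : E ↦ c ⟨1, base1⟩ ⟨1, mid12 e⟩ + c ⟨1, mid12 e⟩ ⟨h e, base2⟩) = q12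
  generalize hq02 : (fun e : E ↦ c ⟨1, base0⟩ ⟨1, mid02 e⟩ + c ⟨1, mid02 e⟩ ⟨h e, base2⟩) = q02
  have h01 (e) := congrFun hq01 e
  have h12 (e) := congrFun hq12 e
  have h02 (e) := congrFun hq02 e
  have h01o := h01 o
  have h12o := h12 o
  rw [h1] at h01o h12o
  simp only [h01, h12, h02, h01o, h12o] at hl hr ⊢
  have e1 (e) : q01 e - q01 o = q12 e - agr α (h e) • q12 o := by
    rw [← sub_eq_zero, ← sub_eq_zero.2 ((hr e).trans (hl e).symm)]
    abel
  have e2 (e) : q02 e = q01 o + q12 e := (sub_eq_zero.1 (hl e)).symm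
  rw [e1 t.2.1, e1 t.2.2, e2, smul_sub, smul_smul, ← agr_mul, ht']
  refine Eq.congr_left ?_
  abel

/-- The dimension of the cocycle module detects whether a formal equation is implied by others:
filling in the central triangle of the equation replaces the cocycle module by a quotient, which is
proper unless the equation is implied. -/
lemma finrank_eq_iff_derivationImplies {o : E} (ho : ∀ e, (o, e, e) ∈ T ∧ (e, o, e) ∈ T)
    (hT : T ⊆ Composable h) {t : E × E × E} (ht : t ∈ Composable h) :
    Module.finrank D (CocycleModule (encode h T) α) =
      Module.finrank D (CocycleModule (encode h (insert t T)) α) ↔ DerivationImplies α h T t := by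
  have hcoc : (encode h (insert t T)).IsCocycle (univCocycle (encode h (insert t T)) α) :=
    univCocycle_isCocycle _ α
  -- the quotient map imposing the additional equation
  obtain ⟨φ, hφ⟩ := exists_linearMap_univCocycle (K := encode h T) α
    (univCocycle_isEquivariant (encode h (insert t T)) α) (by
      refine fun s hs ↦ univCocycle_isCocycle (encode h (insert t T)) α s ⟨hs.1, hs.2.imp_right ?_⟩
      exact fun ⟨g, b, hb, hs⟩ ↦ ⟨g, b, Set.union_subset_union_right _
        (Set.image_mono (Set.subset_insert _ _)) hb, hs⟩)
  have hφ' : Function.Surjective φ := by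
    rw [← LinearMap.range_eq_top, eq_top_iff, ← cocycleModule_span, Submodule.span_le]
    rintro _ ⟨v, w, hvw, rfl⟩
    exact ⟨_, hφ v w ((adj_encode_insert ht).1 hvw)⟩
  constructor
  · intro heq N _ _ q hq
    have hinj : Function.Injective φ :=
      (LinearMap.injective_iff_surjective_of_finrank_eq_finrank heq).2 hφ'
    -- an equality of dimensions makes the quotient map injective, so that the cocycle of `q` extends
    -- over the additional central triangle
    obtain ⟨ψ, hψ⟩ := exists_linearMap_univCocycle α (derivationCocycle_isEquivariant α q)
      (derivationCocycle_isCocycle (T := T) α hq)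
    let e := LinearEquiv.ofBijective φ ⟨hinj, hφ'⟩
    have he (v w) (hvw : (encode h T).Adj v w) :
        e.symm (univCocycle (encode h (insert t T)) α v w) = univCocycle (encode h T) α v w :=
      e.symm_apply_eq.2 (hφ v w hvw).symm
    have hc := hcoc _ (mem_generate (central_mem (Set.mem_insert t T))
      ⟨_, (mem_centralTriangle h).2 (.inl rfl)⟩) ⟨1, mid01 t.1⟩ ((mem_centralTriangle h).2 (.inl rfl))
      ⟨h t.1, mid12 t.2.1⟩ ((mem_centralTriangle h).2 (.inr (.inl rfl))) ⟨1, mid02 t.2.2⟩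
      ((mem_centralTriangle h).2 (.inr (.inr rfl)))
    have hadj {v w} (hv : v ∈ centralTriangle h t) (hw : w ∈ centralTriangle h t) :
        (encode h T).Adj v w :=
      (adj_encode_insert ht).1 (adj_encode (central_mem (Set.mem_insert t T)) hv hw)
    replace hc := congrArg (fun x ↦ ψ (e.symm x)) hc
    simp only [map_add] at hc
    rw [he _ _ (hadj ((mem_centralTriangle h).2 (.inl rfl)) ((mem_centralTriangle h).2
        (.inr (.inl rfl)))), he _ _ (hadj ((mem_centralTriangle h).2 (.inr (.inl rfl)))
        ((mem_centralTriangle h).2 (.inr (.inr rfl)))), he _ _ (hadj ((mem_centralTriangle h).2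
        (.inl rfl)) ((mem_centralTriangle h).2 (.inr (.inr rfl)))),
      hψ _ _ (hadj ((mem_centralTriangle h).2 (.inl rfl)) ((mem_centralTriangle h).2
        (.inr (.inl rfl)))), hψ _ _ (hadj ((mem_centralTriangle h).2 (.inr (.inl rfl)))
        ((mem_centralTriangle h).2 (.inr (.inr rfl)))), hψ _ _ (hadj ((mem_centralTriangle h).2
        (.inl rfl)) ((mem_centralTriangle h).2 (.inr (.inr rfl))))] at hc
    rw [IsDerivationAt, ← sub_eq_zero, add_sub_assoc]
    simpa [derivationCocycle, halfCocycle, agr_one] using hc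
  · intro himp
    have he := univCocycle_isEquivariant (encode h T) α
    have hc := univCocycle_isCocycle (encode h T) α
    have hanti (v w) : univCocycle (encode h T) α w v = -univCocycle (encode h T) α v w := by
      by_cases hvw : (encode h T).Adj v w
      · exact hc.symm hvw
      · rw [univCocycle_of_not_adj _ α hvw, neg_zero, univCocycle_of_not_adj]
        exact fun ⟨s, hs, hw, hv⟩ ↦ hvw ⟨s, hs, hv, hw⟩
    -- the universal cocycle satisfies the additional equation, so that the quotient map is injective
    have hcen := (isDerivationAt_arc_iff α he hc ho hT ht).1 <| himp _ _ fun s hs ↦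
      (isDerivationAt_arc_iff α he hc ho hT (hT hs)).2 <|
        hc _ (mem_generate (central_mem hs) ⟨_, (mem_centralTriangle h).2 (.inl rfl)⟩)
          _ ((mem_centralTriangle h).2 (.inl rfl)) _ ((mem_centralTriangle h).2 (.inr (.inl rfl)))
          _ ((mem_centralTriangle h).2 (.inr (.inr rfl)))
    have hc' : (encode h (insert t T)).IsCocycle (univCocycle (encode h T) α) := by
      have hb (b) (hb : b ∈ triangles h T) (u) (hu : u ∈ b) :=
        hc b (mem_generate hb ⟨u, hu⟩) u hu
      refine isCocycle_generate he hc.self ((forall_triangles h).2 ⟨fun e ↦ hb _ (start_mem _ _),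
        fun e ↦ hb _ (middle_mem _ _), fun s hs ↦ hb _ (end_mem hs), ?_⟩)
      rintro s (rfl | hs)
      · exact cocycle_on_triangle hc.self hanti hcen fun u ↦ (mem_centralTriangle h).1
      · exact hb _ (central_mem hs)
    obtain ⟨ψ, hψ⟩ := exists_linearMap_univCocycle α he hc'
    have hcomp : ψ ∘ₗ φ = LinearMap.id := cocycleModule_hom_ext α fun v w hvw ↦ by
      rw [LinearMap.comp_apply, hφ v w hvw, hψ v w ((adj_encode_insert ht).2 hvw), LinearMap.id_apply]
    exact (LinearEquiv.ofBijective φ ⟨Function.LeftInverse.injective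
      (LinearMap.congr_fun hcomp), hφ'⟩).finrank_eq

/-- If the first two agrarian Betti numbers of all complexes agree for two agrarian maps, then the
same implications between formal equations hold for both. -/
lemma derivationImplies_iff_of_betti {D' : Type u} [DivisionRing D'] (α' : AgrarianMap G D')
    (hb : ∀ (X : Type u) [TopologicalSpace X] [T2Space X] [MulAction G X]
      [CWComplex (Set.univ : Set X)] [IsGCWComplex G X], ConnectedSpace X → IsFreeGSpace G X →
      IsFiniteGCWComplex G X → ∀ p : ℕ, agrarianBetti G X α p = agrarianBetti G X α' p)
    (hgen : Subgroup.closure (Set.range h) = ⊤) {o : E} (ho : ∀ e, (o, e, e) ∈ T ∧ (e, o, e) ∈ T)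
    (hT : T ⊆ Composable h) {t : E × E × E} (ht : t ∈ Composable h) :
    DerivationImplies α h T t ↔ DerivationImplies α' h T t := by
  -- the choice of an order of the colours does not matter
  let _ : LinearOrder (Colour E) := LinearOrder.lift' _ (Finite.equivFin (Colour E)).injective
  have : Nonempty (Colour E) := ⟨base0⟩
  have hfin (S : Set (E × E × E)) := Realization.finrank_cocycleModule_eq (K := encode h S) α α'
    (hb _ (Realization.connectedSpace (encode_connected hgen (hT (ho o).1)))
      Realization.isFreeGSpace Realization.isFiniteGCWComplex)
  rw [← finrank_eq_iff_derivationImplies α ho hT ht, ← finrank_eq_iff_derivationImplies α' ho hT ht,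
    hfin, hfin]

end Cocycles

end ColouredComplex

/-! ### Invertibility of matrices is detected by derivations -/

section SemidirectProduct

variable {G : Type u} [Group G] {n : ℕ}

/-- The image in `D` of a vector over the group ring. -/
noncomputable def mapVec {D : Type u} [DivisionRing D] (α : AgrarianMap G D) (f : Fin n → MonoidAlgebra ℤ G) :
    Fin n → D := fun j ↦ α (f j)

/-- A map defined on `(ℤG)^n × G`, viewed as the semidirect product of `(ℤG)^n` and `G`, is a partial
derivation on a set `S` if it is a derivation for all products of elements of `S` lying in `S`. -/
def IsPartialDerivation {D N : Type u} [DivisionRing D] [AddCommGroup N] [Module D N]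
    (α : AgrarianMap G D) (S : Set ((Fin n → MonoidAlgebra ℤ G) × G))
    (q : (Fin n → MonoidAlgebra ℤ G) × G → N) : Prop :=
  ∀ x ∈ S, ∀ y ∈ S, ∀ z ∈ S, x.2 * y.2 = z.2 → x.1 + MonoidAlgebra.single x.2 (1 : ℤ) • y.1 = z.1 →
    q x + α (MonoidAlgebra.single x.2 1) • q y = q z

lemma IsPartialDerivation.mono {D N : Type u} [DivisionRing D] [AddCommGroup N] [Module D N]
    {α : AgrarianMap G D} {S S' : Set ((Fin n → MonoidAlgebra ℤ G) × G)}
    {q : (Fin n → MonoidAlgebra ℤ G) × G → N} (h : IsPartialDerivation α S' q) (hS : S ⊆ S') :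
    IsPartialDerivation α S q :=
  fun x hx y hy z hz ↦ h x (hS hx) y (hS hy) z (hS hz)

/-- The partial derivations on `S` are `ℤG`-linear at the vector `f`. -/
def ForcesLinearAt (S : Set ((Fin n → MonoidAlgebra ℤ G) × G)) (f : Fin n → MonoidAlgebra ℤ G) :
    Prop :=
  ∀ (D N : Type u) [DivisionRing D] [AddCommGroup N] [Module D N] (α : AgrarianMap G D)
    (q : (Fin n → MonoidAlgebra ℤ G) × G → N), IsPartialDerivation α S q →
    q (f, 1) = ∑ j, α (f j) • q (Pi.single j 1, 1)

lemma ForcesLinearAt.mono {S S' : Set ((Fin n → MonoidAlgebra ℤ G) × G)}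
    {f : Fin n → MonoidAlgebra ℤ G} (h : ForcesLinearAt S f) (hS : S ⊆ S') : ForcesLinearAt S' f :=
  fun D N _ _ _ α q hq ↦ h D N α q (hq.mono hS)

/-- For every vector there is a finite set on which all partial derivations are linear at this vector:
the vector arises from the basis vectors by finitely many multiplications in the semidirect
product. -/
lemma exists_finite_forcesLinearAt (f : Fin n → MonoidAlgebra ℤ G) :
    ∃ S : Set ((Fin n → MonoidAlgebra ℤ G) × G), S.Finite ∧ ForcesLinearAt S f := by
  have one_smul' (f : Fin n → MonoidAlgebra ℤ G) : MonoidAlgebra.single (1 : G) (1 : ℤ) • f = f := by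
    rw [← MonoidAlgebra.one_def, one_smul]
  have hone {D N : Type u} [DivisionRing D] [AddCommGroup N] [Module D N] (α : AgrarianMap G D)
      (x : N) : α (MonoidAlgebra.single (1 : G) 1) • x = x := by
    rw [← MonoidAlgebra.one_def, map_one, one_smul]
  have hzero : ForcesLinearAt {((0 : Fin n → MonoidAlgebra ℤ G), (1 : G))} 0 := by
    intro D N _ _ _ α q hq
    have := hq _ rfl _ rfl _ rfl (mul_one _) (by simp)
    rw [hone, add_eq_left] at this
    simp [this]
  have hadd (f f' : Fin n → MonoidAlgebra ℤ G) :
      (∃ S : Set ((Fin n → MonoidAlgebra ℤ G) × G), S.Finite ∧ ForcesLinearAt S f) →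
      (∃ S : Set ((Fin n → MonoidAlgebra ℤ G) × G), S.Finite ∧ ForcesLinearAt S f') →
      ∃ S : Set ((Fin n → MonoidAlgebra ℤ G) × G), S.Finite ∧ ForcesLinearAt S (f + f') := by
    rintro ⟨S, hS, h⟩ ⟨S', hS', h'⟩
    refine ⟨S ∪ S' ∪ {(f, 1), (f', 1), (f + f', 1)}, (hS.union hS').union (Set.toFinite _), ?_⟩
    intro D N _ _ _ α q hq
    have := hq (f, 1) (.inr (by simp)) (f', 1) (.inr (by simp)) (f + f', 1) (.inr (by simp))
      (mul_one _) (by rw [one_smul'])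
    rw [hone, h D N α q (hq.mono (Set.subset_union_left.trans Set.subset_union_left)),
      h' D N α q (hq.mono (Set.subset_union_right.trans Set.subset_union_left))] at this
    rw [← this, ← Finset.sum_add_distrib]
    exact Finset.sum_congr rfl fun j _ ↦ by rw [← add_smul, ← map_add]; rfl
  have hneg (f : Fin n → MonoidAlgebra ℤ G) :
      (∃ S : Set ((Fin n → MonoidAlgebra ℤ G) × G), S.Finite ∧ ForcesLinearAt S f) →
      ∃ S : Set ((Fin n → MonoidAlgebra ℤ G) × G), S.Finite ∧ ForcesLinearAt S (-f) := by
    rintro ⟨S, hS, h⟩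
    refine ⟨S ∪ {(f, 1), (-f, 1), (0, 1)}, hS.union (Set.toFinite _), ?_⟩
    intro D N _ _ _ α q hq
    have h0 := hq (f, 1) (.inr (by simp)) (-f, 1) (.inr (by simp)) (0, 1) (.inr (by simp))
      (mul_one _) (by rw [one_smul', add_neg_cancel])
    rw [hzero D N α q (hq.mono (by simp)), hone, h D N α q (hq.mono Set.subset_union_left)] at h0
    simp only [Pi.zero_apply, map_zero, zero_smul, Finset.sum_const_zero] at h0
    rw [← neg_eq_of_add_eq_zero_right h0, ← Finset.sum_neg_distrib]
    exact Finset.sum_congr rfl fun j _ ↦ by rw [← neg_smul, ← map_neg]; rfl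
  have hsingle (j : Fin n) (r : MonoidAlgebra ℤ G) :
      ∃ S : Set ((Fin n → MonoidAlgebra ℤ G) × G), S.Finite ∧ ForcesLinearAt S (Pi.single j r) := by
    induction r using MonoidAlgebra.induction_on with
    | of g =>
      let e : Fin n → MonoidAlgebra ℤ G := Pi.single j 1
      let ge : Fin n → MonoidAlgebra ℤ G := Pi.single j (MonoidAlgebra.single g 1)
      have hge : MonoidAlgebra.single g (1 : ℤ) • e = ge := by
        rw [← Pi.single_smul, smul_eq_mul, mul_one]
      -- the factorizations `(0, g) (e, 1) = (ge, g) = (ge, 1) (0, g)` are compared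
      refine ⟨{(e, 1), (0, g), (ge, g), (ge, 1)}, Set.toFinite _, ?_⟩
      intro D N _ _ _ α q hq
      have h1 := hq (0, g) (by simp) (e, 1) (by simp) (ge, g) (by simp) (mul_one _)
        (by rw [hge, zero_add])
      have h2 := hq (ge, 1) (by simp) (0, g) (by simp) (ge, g) (by simp) (one_mul _)
        (by rw [smul_zero, add_zero])
      rw [hone, ← h1, add_comm] at h2
      rw [Finset.sum_eq_single_of_mem j (Finset.mem_univ _) fun i _ hi ↦ by
        rw [MonoidAlgebra.of_apply, Pi.single_eq_of_ne hi, map_zero, zero_smul]]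
      rw [MonoidAlgebra.of_apply, Pi.single_eq_same]
      exact add_left_cancel h2
    | add a b ha hb => rw [Pi.single_add]; exact hadd _ _ ha hb
    | smul k a ha =>
      rw [Pi.single_smul]
      induction k with
      | zero => rw [zero_smul]; exact ⟨_, Set.finite_singleton _, hzero⟩
      | succ k ih => rw [add_smul, one_smul]; exact hadd _ _ ih ha
      | pred k ih => rw [sub_smul, one_smul, sub_eq_add_neg]; exact hadd _ _ ih (hneg _ ha)
  rw [← Finset.univ_sum_single f]
  exact Finset.sum_induction _ _ hadd ⟨_, Set.finite_singleton _, hzero⟩ fun j _ ↦ hsingle j _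

end SemidirectProduct

section Matrix

variable {G : Type u} [Group G] {n : ℕ} (A : Matrix (Fin n) (Fin n) (MonoidAlgebra ℤ G))

/-- The formal equations among the elements of `S` which hold in the semidirect product of
`(ℤG)^n` and `G` modulo the row space of `A`. -/
def rowEquations (S : Set ((Fin n → MonoidAlgebra ℤ G) × G)) : Set (S × S × S) :=
  {t | t.1.1.2 * t.2.1.1.2 = t.2.2.1.2 ∧
    t.1.1.1 + MonoidAlgebra.single t.1.1.2 (1 : ℤ) • t.2.1.1.1 - t.2.2.1.1 ∈
      Submodule.span (MonoidAlgebra ℤ G) (Set.range A)}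

/-- A matrix becomes invertible if and only if in the universal derivation killing its rows all basis
vectors vanish. -/
lemma exists_mul_eq_one_iff {S : Set ((Fin n → MonoidAlgebra ℤ G) × G)} (h0 : (0, 1) ∈ S)
    (hrow : ∀ i, (A i, 1) ∈ S) (hbasis : ∀ j, (Pi.single j 1, 1) ∈ S)
    (hlin : ∀ i, ForcesLinearAt S (A i)) {D : Type u} [DivisionRing D] (α : AgrarianMap G D) :
    (∃ B : Matrix (Fin n) (Fin n) D, B * A.map α = 1) ↔
      ∀ j, DerivationImplies α (fun e : S ↦ e.1.2) (rowEquations A S)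
        (⟨_, hbasis j⟩, ⟨_, h0⟩, ⟨_, h0⟩) := by
  classical
  have hone : α (MonoidAlgebra.single (1 : G) 1) = 1 := by rw [← MonoidAlgebra.one_def, map_one]
  constructor
  · rintro ⟨B, hB⟩ k N _ _ q hq
    -- `q` extended by zero, in order to apply `hlin`
    let q' : (Fin n → MonoidAlgebra ℤ G) × G → N := fun x ↦ if hx : x ∈ S then q ⟨x, hx⟩ else 0
    have hq' {x} (hx : x ∈ S) : q' x = q ⟨x, hx⟩ := dif_pos hx
    have hpart : IsPartialDerivation α S q' := by
      intro x hx y hy z hz h1 h2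
      rw [hq' hx, hq' hy, hq' hz]
      exact hq (⟨x, hx⟩, ⟨y, hy⟩, ⟨z, hz⟩) ⟨h1, by
        change x.1 + _ - z.1 ∈ _
        rw [h2, sub_self]; exact zero_mem _⟩
    have hzero : q ⟨_, h0⟩ = 0 := by
      have := hq (⟨_, h0⟩, ⟨_, h0⟩, ⟨_, h0⟩) ⟨mul_one _, by simp⟩
      rw [IsDerivationAt, hone, one_smul] at this
      exact add_eq_left.1 this
    have hA (i) : ∑ j, α (A i j) • q ⟨_, hbasis j⟩ = 0 := by
      have h1 := hlin i D N α q' hpart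
      have h2 := hq (⟨_, hrow i⟩, ⟨_, h0⟩, ⟨_, h0⟩) ⟨mul_one _, by
        simpa using Submodule.subset_span (Set.mem_range_self i)⟩
      rw [IsDerivationAt, hzero, smul_zero, add_zero] at h2
      simp only [hq' (hrow i), hq' (hbasis _), h2] at h1
      exact h1.symm
    have hk : q ⟨_, hbasis k⟩ = 0 := by
      calc q ⟨_, hbasis k⟩ = ∑ j, (B * A.map α) k j • q ⟨_, hbasis j⟩ := by
            rw [hB, Finset.sum_eq_single_of_mem k (Finset.mem_univ _) fun j _ hj ↦ by
              rw [Matrix.one_apply_ne hj.symm, zero_smul], Matrix.one_apply_eq, one_smul]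
        _ = ∑ i, B k i • ∑ j, α (A i j) • q ⟨_, hbasis j⟩ := by
            simp only [Matrix.mul_apply, Matrix.map_apply, Finset.sum_smul, Finset.smul_sum, mul_smul]
            exact Finset.sum_comm
        _ = 0 := by simp [hA]
    rw [IsDerivationAt, hzero, smul_zero, add_zero, hk]
  · intro himp
    let W : Submodule D (Fin n → D) := Submodule.span D (Set.range (A.map α))
    have hspan (f) (hf : f ∈ Submodule.span (MonoidAlgebra ℤ G) (Set.range A)) : mapVec α f ∈ W := by
      induction hf using Submodule.span_induction with
      | mem f hf => obtain ⟨i, rfl⟩ := hf; exact Submodule.subset_span ⟨i, rfl⟩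
      | zero => convert W.zero_mem; ext; simp [mapVec]
      | add f f' _ _ h h' => convert W.add_mem h h'; ext; simp [mapVec]
      | smul r f _ h => convert W.smul_mem (α r) h; ext; simp [mapVec]
    -- vectors modulo the row space of `A` over `D` are a derivation for the row equations
    have hmem (j : Fin n) : (Pi.single j 1 : Fin n → D) ∈ W := by
      have := himp j _ (fun e : S ↦ W.mkQ (mapVec α e.1.1)) fun t ht ↦ by
        rw [IsDerivationAt, ← map_smul, ← map_add, ← sub_eq_zero, ← map_sub, Submodule.mkQ_apply,
          Submodule.Quotient.mk_eq_zero]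
        convert hspan _ ht.2
        ext; simp [mapVec]
      rw [IsDerivationAt, hone, one_smul, add_eq_right, Submodule.mkQ_apply,
        Submodule.Quotient.mk_eq_zero] at this
      convert this
      ext i
      simp [mapVec, Pi.single_apply, apply_ite α]
    have hB (j : Fin n) := (Submodule.mem_span_range_iff_exists_fun D).1 (hmem j)
    choose B hB using hB
    refine ⟨Matrix.of B, Matrix.ext fun i j ↦ ?_⟩
    have := congrFun (hB i) j
    rw [Finset.sum_apply] at this
    rw [Matrix.mul_apply, Matrix.one_apply]
    refine (this.trans ?_)
    rw [Pi.single_apply]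
    simp only [eq_comm]

end Matrix

/-- If the agrarian Betti numbers of all complexes agree for two agrarian maps, then the same matrices
over the group ring become invertible under both. -/
lemma isUnit_map_iff_of_betti {G : Type u} [Group G] [Group.FG G] {D D' : Type u} [DivisionRing D]
    [DivisionRing D'] (α : AgrarianMap G D) (α' : AgrarianMap G D')
    (hb : ∀ (X : Type u) [TopologicalSpace X] [T2Space X] [MulAction G X]
      [CWComplex (Set.univ : Set X)] [IsGCWComplex G X], ConnectedSpace X → IsFreeGSpace G X →
      IsFiniteGCWComplex G X → ∀ p : ℕ, agrarianBetti G X α p = agrarianBetti G X α' p)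
    {n : ℕ} (A : Matrix (Fin n) (Fin n) (MonoidAlgebra ℤ G)) :
    IsUnit (A.map α) ↔ IsUnit (A.map α') := by
  have hunit {D : Type u} [DivisionRing D] (M : Matrix (Fin n) (Fin n) D) :
      IsUnit M ↔ ∃ B, B * M = 1 :=
    ⟨fun h ↦ h.exists_left_inv, fun ⟨B, h⟩ ↦ ⟨⟨M, B, mul_eq_one_symm h, h⟩, rfl⟩⟩
  choose F hFfin hF using fun i ↦ exists_finite_forcesLinearAt (A i)
  obtain ⟨Γ, hΓ, hΓfin⟩ := (Group.fg_iff (G := G)).1 inferInstance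
  -- the generators of `G` are included in order to make the complex connected
  let S : Set ((Fin n → MonoidAlgebra ℤ G) × G) := (⋃ i, F i) ∪ Set.range (fun i ↦ (A i, 1)) ∪
    Set.range (fun j ↦ (Pi.single j 1, 1)) ∪ insert (0, 1) ((fun g ↦ (0, g)) '' Γ)
  have hS : S.Finite := (((Set.finite_iUnion hFfin).union (Set.finite_range _)).union
    (Set.finite_range _)).union ((hΓfin.image _).insert _)
  have : Finite S := hS
  have h0 : ((0 : Fin n → MonoidAlgebra ℤ G), (1 : G)) ∈ S := .inr (.inl rfl)
  have hrow (i) : (A i, (1 : G)) ∈ S := .inl (.inl (.inr ⟨i, rfl⟩))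
  have hbasis (j) : (Pi.single j 1, (1 : G)) ∈ S := .inl (.inr ⟨j, rfl⟩)
  have hlin (i) : ForcesLinearAt S (A i) := (hF i).mono fun x hx ↦
    .inl (.inl (.inl (Set.mem_iUnion.2 ⟨i, hx⟩)))
  have hone (f : Fin n → MonoidAlgebra ℤ G) : MonoidAlgebra.single (1 : G) (1 : ℤ) • f = f := by
    rw [← MonoidAlgebra.one_def, one_smul]
  rw [hunit, hunit, exists_mul_eq_one_iff A h0 hrow hbasis hlin,
    exists_mul_eq_one_iff A h0 hrow hbasis hlin]
  have hunitlaws (e : S) : (⟨_, h0⟩, e, e) ∈ rowEquations A S ∧ (e, ⟨_, h0⟩, e) ∈ rowEquations A S :=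
    ⟨⟨one_mul _, by simp [hone]⟩, ⟨mul_one _, by simp⟩⟩
  refine forall_congr' fun j ↦ ColouredComplex.derivationImplies_iff_of_betti
    (h := fun e : S ↦ e.1.2) α α' hb ?_
    hunitlaws (fun t ht ↦ ht.1) (mul_one _)
  refine eq_top_iff.2 (hΓ ▸ Subgroup.closure_mono fun g hg ↦ ?_)
  exact ⟨⟨(0, g), .inr (.inr ⟨g, hg, rfl⟩)⟩, rfl⟩

/-! ### Epic maps to skew fields -/

section Epic

variable {R D : Type u} [Ring R] [DivisionRing D]

/-- A skew field is generated, as a skew field, by the image of an epic ring homomorphism: otherwise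
some nontrivial additive automorphism of `D`, linear over the generated subfield and fixing `1`,
conjugates the left regular representation of `D` on its additive group to a different one, which
agrees with it on the subfield. -/
lemma IsEpic.closure_range_eq_top {α : R →+* D} (h : IsEpic α) :
    Subfield.closure (Set.range α) = ⊤ := by
  set K := Subfield.closure (Set.range α)
  by_contra hK
  have hlt : Submodule.span K {(1 : D)} < ⊤ := by
    refine lt_top_iff_ne_top.2 fun htop ↦ hK (eq_top_iff.2 fun x _ ↦ ?_)
    obtain ⟨k, hk⟩ := Submodule.mem_span_singleton.1 (htop ▸ Submodule.mem_top (x := x))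
    rw [← hk, Subfield.smul_def, smul_eq_mul, mul_one]
    exact k.2
  obtain ⟨f, hf, hf1⟩ := Submodule.exists_le_ker_of_lt_top _ hlt
  have hf1 : f 1 = 0 := hf1 (Submodule.mem_span_singleton_self 1)
  have hfK (k : K) : f (k : D) = 0 := by
    have := f.map_smul k 1
    rwa [hf1, smul_zero, Subfield.smul_def, smul_eq_mul, mul_one] at this
  -- `θ = 1 + f`, with inverse `1 - f` because `f` vanishes on `K`, which contains its values
  let θ : (AddMonoid.End D)ˣ :=
    { val := AddMonoidHom.id D + K.subtype.toAddMonoidHom.comp f.toAddMonoidHom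
      inv := AddMonoidHom.id D - K.subtype.toAddMonoidHom.comp f.toAddMonoidHom
      val_inv := by
        ext x
        change (x - (f x : D)) + (f (x - (f x : D)) : D) = x
        rw [map_sub, hfK]; simp
      inv_val := by
        ext x
        change (x + (f x : D)) - (f (x + (f x : D)) : D) = x
        rw [map_add, hfK]; simp }
  let L : D →+* AddMonoid.End D := Module.toAddMonoidEnd D D
  let L' : D →+* AddMonoid.End D :=
    { toFun := fun x ↦ θ * L x * θ⁻¹
      map_one' := by simp
      map_mul' := fun x y ↦ by simp [mul_assoc]
      map_zero' := by simp
      map_add' := fun x y ↦ by simp [mul_add, add_mul] }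
  have hLL : L = L' := h _ _ _ <| RingHom.ext fun r ↦ by
    change L (α r) = θ * L (α r) * θ⁻¹
    rw [Units.eq_mul_inv_iff_mul_eq]
    let k : K := ⟨α r, Subfield.subset_closure ⟨r, rfl⟩⟩
    ext y
    change α r * (y + f y) = α r * y + f (α r * y)
    have : f (α r * y) = k * f y := f.map_smul k y
    rw [this, mul_add]
    rfl
  refine hf (LinearMap.ext fun x ↦ ?_)
  have h1 : L x * θ = θ * L x := by
    rw [← Units.eq_mul_inv_iff_mul_eq]
    exact RingHom.congr_fun hLL x
  have h2 := DFunLike.congr_fun h1 (1 : D)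
  change x * (1 + f 1) = x * 1 + f (x * 1) at h2
  rw [hf1] at h2
  simpa using h2

/-- Conversely, a ring homomorphism to a skew field becomes epic when the target is replaced by the
generated skew field. -/
lemma isEpic_codRestrict_closure (α : R →+* D) :
    IsEpic (α.codRestrict (Subfield.closure (Set.range α)) fun r ↦
      Subfield.subset_closure ⟨r, rfl⟩) := by
  intro T _ g₁ g₂ h
  refine RingHom.ext fun ⟨x, hx⟩ ↦ ?_
  induction hx using Subfield.closure_induction with
  | mem x hx =>
    obtain ⟨r, rfl⟩ := hx
    exact RingHom.congr_fun h r
  | one => exact (map_one g₁).trans (map_one g₂).symm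
  | add x y hx hy h h' =>
    exact (map_add g₁ ⟨x, hx⟩ ⟨y, hy⟩).trans
      ((congrArg₂ (· + ·) h h').trans (map_add g₂ ⟨x, hx⟩ ⟨y, hy⟩).symm)
  | neg x hx h =>
    exact (map_neg g₁ ⟨x, hx⟩).trans ((congrArg Neg.neg h).trans (map_neg g₂ ⟨x, hx⟩).symm)
  | inv x hx h =>
    rcases eq_or_ne x 0 with rfl | hx0
    · have h0 : (⟨0⁻¹, inv_mem hx⟩ : Subfield.closure (Set.range α)) = 0 := Subtype.ext inv_zero
      rw [h0, map_zero, map_zero]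
    · let y : Subfield.closure (Set.range α) := ⟨x, hx⟩
      have hy : y ≠ 0 := fun h ↦ hx0 (congrArg Subtype.val h)
      change g₁ y = g₂ y at h
      change g₁ y⁻¹ = g₂ y⁻¹
      refine left_inv_eq_right_inv (a := g₁ y) ?_ ?_
      · rw [← map_mul, inv_mul_cancel₀ hy, map_one]
      · rw [h, ← map_mul, mul_inv_cancel₀ hy, map_one]
  | mul x y hx hy h h' =>
    exact (map_mul g₁ ⟨x, hx⟩ ⟨y, hy⟩).trans
      ((congrArg₂ (· * ·) h h').trans (map_mul g₂ ⟨x, hx⟩ ⟨y, hy⟩).symm)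

end Epic

/-! ### Rational closure -/

section RationalClosure

open Matrix

lemma IsUnit.submatrix_equiv {R ι κ : Type*} [Ring R] [Fintype ι] [DecidableEq ι] [Fintype κ]
    [DecidableEq κ] {M : Matrix ι ι R} (h : IsUnit M) (e : κ ≃ ι) : IsUnit (M.submatrix e e) := by
  obtain ⟨⟨M, N, h1, h2⟩, rfl⟩ := h
  refine ⟨⟨M.submatrix e e, N.submatrix e e, ?_, ?_⟩, rfl⟩
  · rw [submatrix_mul_equiv, h1, submatrix_one_equiv]
  · rw [submatrix_mul_equiv, h2, submatrix_one_equiv]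

lemma Matrix.isUnit_fromBlocks_zero {D ι κ : Type*} [DivisionRing D] [Fintype ι] [DecidableEq ι]
    [Fintype κ] [DecidableEq κ] {A : Matrix ι ι D} {B : Matrix κ κ D} (hA : IsUnit A) (hB : IsUnit B)
    (C : Matrix ι κ D) : IsUnit (fromBlocks A C 0 B) := by
  obtain ⟨⟨A, A', hA1, hA2⟩, rfl⟩ := hA
  obtain ⟨⟨B, B', hB1, hB2⟩, rfl⟩ := hB
  have h : fromBlocks A C 0 B * fromBlocks A' (-(A' * C * B')) 0 B' = 1 := by
    rw [fromBlocks_multiply, hA1, hB1, Matrix.mul_neg, ← Matrix.mul_assoc, ← Matrix.mul_assoc, hA1]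
    simp
  exact ⟨⟨_, _, h, mul_eq_one_symm h⟩, rfl⟩

/-- A bordered matrix is invertible if the corresponding quasideterminant is. -/
lemma Matrix.isUnit_fromBlocks_bordered {D ι : Type*} [DivisionRing D] [Fintype ι] [DecidableEq ι]
    {A : Matrix ι ι D} (hA : IsUnit A) {b x : Matrix ι Unit D} {c : Matrix Unit ι D}
    (hx : A * x = b) : IsUnit (fromBlocks A b c 0) ↔ (c * x) () () ≠ 0 := by
  constructor
  · intro h h0
    have h0 : c * x = 0 := by ext i j; exact h0
    have h1 : fromBlocks A b c 0 * fromRows (-x) (1 : Matrix Unit Unit D) = 0 := by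
      rw [fromBlocks_mul_fromRows]
      simp [hx, h0]
    have h2 : fromRows (-x) (1 : Matrix Unit Unit D) = 0 := by
      obtain ⟨M, hM⟩ := h.exists_left_inv
      rw [← Matrix.one_mul (fromRows _ _), ← hM, Matrix.mul_assoc, h1, Matrix.mul_zero]
    exact one_ne_zero (congrFun (congrFun h2 (.inr ())) ())
  · intro h
    let d : Matrix Unit Unit D := of fun _ _ ↦ ((c * x) () ())⁻¹
    have hd : c * x * d = 1 := by ext; simp [d, mul_apply (M := c * x), h]
    obtain ⟨⟨A, A', hA1, hA2⟩, rfl⟩ := hA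
    have h : fromBlocks A b c 0 * fromBlocks (A' - x * d * (c * A')) (x * d) (d * (c * A')) (-d) = 1 := by
      rw [fromBlocks_multiply, ← fromBlocks_one]
      congr 1
      · rw [mul_sub, hA1, ← hx]; simp [Matrix.mul_assoc]
      · rw [← hx]; simp [Matrix.mul_assoc]
      · rw [Matrix.mul_sub, ← Matrix.mul_assoc c (x * d), ← Matrix.mul_assoc c x, hd]; simp
      · rw [← Matrix.mul_assoc, hd]; simp
    exact ⟨⟨_, _, h, mul_eq_one_symm h⟩, rfl⟩

variable {R D₁ D₂ : Type u} [Ring R] [DivisionRing D₁] [DivisionRing D₂] {α₁ : R →+* D₁}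
  {α₂ : R →+* D₂}

section

variable {D : Type u} [DivisionRing D] (α : R →+* D) {ι : Type} [Fintype ι] [DecidableEq ι]

/-- The element `d` is the value of the rational expression `c A⁻¹ b` over `R`, where `A` is required
to become invertible. -/
def IsRationalValue (A : Matrix ι ι R) (b : Matrix ι Unit R) (c : Matrix Unit ι R) (d : D) : Prop :=
  IsUnit (A.map α) ∧ ∃ x : Matrix ι Unit D, A.map α * x = b.map α ∧ (c.map α * x) () () = d

variable {α} {κ : Type} [Fintype κ] [DecidableEq κ] {A : Matrix ι ι R} {b : Matrix ι Unit R}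
  {c : Matrix Unit ι R} {d : D} {B : Matrix κ κ R} {p : Matrix κ Unit R} {q : Matrix Unit κ R} {e : D}

variable (α) in
lemma IsRationalValue.map (r : R) :
    IsRationalValue α (1 : Matrix Unit Unit R) (of fun _ _ ↦ r) 1 (α r) :=
  ⟨by simp, of fun _ _ ↦ α r, by ext; simp, by simp⟩

lemma IsRationalValue.neg (h : IsRationalValue α A b c d) : IsRationalValue α A b (-c) (-d) := by
  obtain ⟨h, x, hx, rfl⟩ := h
  exact ⟨h, x, hx, by simp [mul_apply]⟩

lemma IsRationalValue.add (hd : IsRationalValue α A b c d) (he : IsRationalValue α B p q e) :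
    IsRationalValue α (fromBlocks A 0 0 B) (fromRows b p) (fromCols c q) (d + e) := by
  obtain ⟨h, x, hx, rfl⟩ := hd
  obtain ⟨k, y, hy, rfl⟩ := he
  refine ⟨?_, fromRows x y, ?_, ?_⟩
  · rw [fromBlocks_map, Matrix.map_zero _ (map_zero α), Matrix.map_zero _ (map_zero α)]
    exact isUnit_fromBlocks_zero h k _
  · rw [fromBlocks_map, fromBlocks_mul_fromRows, hx, hy]
    ext (i | i) j <;> simp
  · simp [mul_apply]

lemma IsRationalValue.mul (hd : IsRationalValue α A b c d) (he : IsRationalValue α B p q e) :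
    IsRationalValue α (fromBlocks A (-(b * q)) 0 B) (fromRows 0 p) (fromCols c 0) (d * e) := by
  obtain ⟨h, x, hx, rfl⟩ := hd
  obtain ⟨k, y, hy, rfl⟩ := he
  refine ⟨?_, fromRows (x * (q.map α * y)) y, ?_, ?_⟩
  · rw [fromBlocks_map, Matrix.map_zero _ (map_zero α)]
    exact isUnit_fromBlocks_zero h k _
  · have : (-(b * q)).map α = -(b.map α * q.map α) := by
      rw [← Matrix.map_mul, ← Matrix.map_neg _ (map_neg α)]
    rw [fromBlocks_map, fromBlocks_mul_fromRows, this, ← Matrix.mul_assoc, hx, hy]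
    ext (i | i) j <;> simp [Matrix.mul_assoc]
  · have : (fromCols c (0 : Matrix Unit κ R)).map α * fromRows (x * (q.map α * y)) y =
        c.map α * x * (q.map α * y) := by
      rw [Matrix.mul_assoc]; ext; simp [mul_apply]
    rw [this, mul_apply]
    simp

lemma IsRationalValue.isUnit_bordered_iff (h : IsRationalValue α A b c d) :
    IsUnit ((fromBlocks A b c 0).map α) ↔ d ≠ 0 := by
  obtain ⟨h, x, hx, rfl⟩ := h
  rw [fromBlocks_map, Matrix.map_zero _ (map_zero α)]
  exact isUnit_fromBlocks_bordered h hx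

lemma IsRationalValue.inv (h : IsRationalValue α A b c d) (h0 : d ≠ 0) :
    IsRationalValue α (fromBlocks A b c 0) (fromRows 0 (1 : Matrix Unit Unit R))
      (fromCols 0 (-1 : Matrix Unit Unit R)) d⁻¹ := by
  refine ⟨h.isUnit_bordered_iff.2 h0, ?_⟩
  obtain ⟨h, x, hx, rfl⟩ := h
  let t : Matrix Unit Unit D := of fun _ _ ↦ ((c.map α * x) () ())⁻¹
  refine ⟨fromRows (x * t) (-t), ?_, ?_⟩
  · have ht : c.map α * (x * t) = 1 := by
      rw [← Matrix.mul_assoc]; ext; rw [mul_apply]; simp [t, h0]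
    rw [fromBlocks_map, fromBlocks_mul_fromRows, ht, ← Matrix.mul_assoc, hx]
    ext (i | i) j <;> simp
  · simp [mul_apply, t]

end

variable (α₁ α₂) in
/-- Two elements are the values of a common rational expression over `R`. -/
def SameRational (d : D₁ × D₂) : Prop :=
  ∃ (ι : Type) (_ : Fintype ι) (_ : DecidableEq ι) (A : Matrix ι ι R) (b : Matrix ι Unit R)
    (c : Matrix Unit ι R), IsRationalValue α₁ A b c d.1 ∧ IsRationalValue α₂ A b c d.2

/-- If the same matrices become invertible over both skew fields, the pairs of values of common
rational expressions are the graph of a partial isomorphism. -/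
lemma SameRational.eq_zero_iff (h : ∀ (n : ℕ) (A : Matrix (Fin n) (Fin n) R),
    IsUnit (A.map α₁) ↔ IsUnit (A.map α₂)) {d : D₁ × D₂} (hd : SameRational α₁ α₂ d) :
    d.1 = 0 ↔ d.2 = 0 := by
  obtain ⟨ι, _, _, A, b, c, h1, h2⟩ := hd
  have key {κ : Type} [Fintype κ] [DecidableEq κ] (M : Matrix κ κ R) :
      IsUnit (M.map α₁) ↔ IsUnit (M.map α₂) := by
    let e := (Fintype.equivFin κ).symm
    have hM := h _ (M.submatrix e e)
    rw [← Matrix.submatrix_map, ← Matrix.submatrix_map] at hM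
    have back {D : Type u} [DivisionRing D] (N : Matrix κ κ D) :
        IsUnit (N.submatrix e e) ↔ IsUnit N :=
      ⟨fun h ↦ by simpa using h.submatrix_equiv e.symm, fun h ↦ h.submatrix_equiv e⟩
    rwa [back, back] at hM
  rw [← not_iff_not]
  exact h1.isUnit_bordered_iff.symm.trans ((key _).trans h2.isUnit_bordered_iff)

/-- Two maps to skew fields generated by their images are isomorphic if the same matrices become
invertible under both. -/
lemma exists_ringEquiv_of_isUnit_iff (h : ∀ (n : ℕ) (A : Matrix (Fin n) (Fin n) R),
    IsUnit (A.map α₁) ↔ IsUnit (A.map α₂)) (h₁ : Subfield.closure (Set.range α₁) = ⊤)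
    (h₂ : Subfield.closure (Set.range α₂) = ⊤) : ∃ e : D₁ ≃+* D₂, e.toRingHom.comp α₁ = α₂ := by
  have hmap (r : R) : SameRational α₁ α₂ (α₁ r, α₂ r) := ⟨_, _, _, _, _, _, .map α₁ r, .map α₂ r⟩
  let S : Subring (D₁ × D₂) :=
    { carrier := {d | SameRational α₁ α₂ d}
      mul_mem' := fun ⟨_, _, _, _, _, _, h1, h2⟩ ⟨_, _, _, _, _, _, k1, k2⟩ ↦
        ⟨_, _, _, _, _, _, h1.mul k1, h2.mul k2⟩
      add_mem' := fun ⟨_, _, _, _, _, _, h1, h2⟩ ⟨_, _, _, _, _, _, k1, k2⟩ ↦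
        ⟨_, _, _, _, _, _, h1.add k1, h2.add k2⟩
      neg_mem' := fun ⟨_, _, _, _, _, _, h1, h2⟩ ↦ ⟨_, _, _, _, _, _, h1.neg, h2.neg⟩
      one_mem' := by have := hmap 1; rwa [map_one, map_one] at this
      zero_mem' := by have := hmap 0; rwa [map_zero, map_zero] at this }
  have hinv {d : D₁ × D₂} (hd : d ∈ S) : (d.1⁻¹, d.2⁻¹) ∈ S := by
    by_cases h0 : d.1 = 0
    · rw [h0, (SameRational.eq_zero_iff h hd).1 h0, _root_.inv_zero, _root_.inv_zero]
      exact S.zero_mem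
    · have h0' : d.2 ≠ 0 := fun h' ↦ h0 ((SameRational.eq_zero_iff h hd).2 h')
      obtain ⟨_, _, _, _, _, _, h1, h2⟩ := hd
      exact ⟨_, _, _, _, _, _, h1.inv h0, h2.inv h0'⟩
  let p₁ : S →+* D₁ := (RingHom.fst D₁ D₂).comp S.subtype
  let p₂ : S →+* D₂ := (RingHom.snd D₁ D₂).comp S.subtype
  have i₁ : Function.Injective p₁ := (injective_iff_map_eq_zero p₁).2 fun d hd ↦
    Subtype.ext (Prod.ext hd ((SameRational.eq_zero_iff h d.2).1 hd))
  have i₂ : Function.Injective p₂ := (injective_iff_map_eq_zero p₂).2 fun d hd ↦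
    Subtype.ext (Prod.ext ((SameRational.eq_zero_iff h d.2).2 hd) hd)
  have s₁ : Function.Surjective p₁ := by
    let K : Subfield D₁ := { p₁.range with
      inv_mem' := by rintro _ ⟨d, rfl⟩; exact ⟨⟨_, hinv d.2⟩, rfl⟩ }
    have hK : Subfield.closure (Set.range α₁) ≤ K := Subfield.closure_le.2 (by
      rintro _ ⟨r, rfl⟩; exact ⟨⟨_, hmap r⟩, rfl⟩)
    exact fun x ↦ hK (h₁ ▸ Subfield.mem_top x)
  have s₂ : Function.Surjective p₂ := by
    let K : Subfield D₂ := { p₂.range with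
      inv_mem' := by rintro _ ⟨d, rfl⟩; exact ⟨⟨_, hinv d.2⟩, rfl⟩ }
    have hK : Subfield.closure (Set.range α₂) ≤ K := Subfield.closure_le.2 (by
      rintro _ ⟨r, rfl⟩; exact ⟨⟨_, hmap r⟩, rfl⟩)
    exact fun x ↦ hK (h₂ ▸ Subfield.mem_top x)
  let e₁ := RingEquiv.ofBijective p₁ ⟨i₁, s₁⟩
  let e₂ := RingEquiv.ofBijective p₂ ⟨i₂, s₂⟩
  refine ⟨e₁.symm.trans e₂, RingHom.ext fun r ↦ ?_⟩
  have : e₁.symm (α₁ r) = ⟨_, hmap r⟩ := e₁.symm_apply_eq.2 rfl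
  change e₂ (e₁.symm (α₁ r)) = α₂ r
  rw [this]
  rfl

end RationalClosure

/-! ### Betti numbers and extensions of skew fields -/

section Splitting

variable {E : Type u} [DivisionRing E]

lemma LinearMap.exists_comp_comp_eq_self {U V : Type u} [AddCommGroup U] [Module E U] [AddCommGroup V]
    [Module E V] (f : U →ₗ[E] V) : ∃ s : V →ₗ[E] U, f ∘ₗ s ∘ₗ f = f := by
  obtain ⟨r, hr⟩ := f.rangeRestrict.exists_rightInverse_of_surjective f.range_rangeRestrict
  obtain ⟨l, hl⟩ := (LinearMap.range f).subtype.exists_leftInverse_of_injective (Submodule.ker_subtype _)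
  refine ⟨r ∘ₗ l, LinearMap.ext fun x ↦ ?_⟩
  have h1 : l (f x) = f.rangeRestrict x := LinearMap.congr_fun hl (f.rangeRestrict x)
  have h2 : f.rangeRestrict (r (f.rangeRestrict x)) = f.rangeRestrict x := LinearMap.congr_fun hr _
  change f (r (l (f x))) = f x
  rw [h1]
  exact congrArg Subtype.val h2

variable {U V W H : Type u} [AddCommGroup U] [Module E U] [AddCommGroup V] [Module E V]
  [AddCommGroup W] [Module E W] [AddCommGroup H] [Module E H]

/-- A splitting of a complex `U → V → W` with homology `H` at `V`. -/
structure ComplexSplitting (f : U →ₗ[E] V) (g : V →ₗ[E] W) (H : Type u) [AddCommGroup H]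
    [Module E H] where
  /-- The inclusion of the homology. -/
  i : H →ₗ[E] V
  /-- The projection to the homology. -/
  p : V →ₗ[E] H
  /-- The splitting of the first map. -/
  s : V →ₗ[E] U
  /-- The splitting of the second map. -/
  t : W →ₗ[E] V
  g_comp_i : g ∘ₗ i = 0
  p_comp_f : p ∘ₗ f = 0
  p_comp_i : p ∘ₗ i = LinearMap.id
  decomp : i ∘ₗ p + f ∘ₗ s + t ∘ₗ g = LinearMap.id

lemma exists_complexSplitting (f : U →ₗ[E] V) (g : V →ₗ[E] W) (h : ∀ x, g (f x) = 0) :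
    Nonempty (ComplexSplitting f g
      (LinearMap.ker g ⧸ LinearMap.range (f.codRestrict (LinearMap.ker g) h))) := by
  obtain ⟨s, hs⟩ := f.exists_comp_comp_eq_self
  obtain ⟨t, ht⟩ := g.exists_comp_comp_eq_self
  have hs (x) : f (s (f x)) = f x := LinearMap.congr_fun hs x
  have ht (x) : g (t (g x)) = g x := LinearMap.congr_fun ht x
  let B := LinearMap.range (f.codRestrict (LinearMap.ker g) h)
  let pz : V →ₗ[E] LinearMap.ker g := (LinearMap.id - t ∘ₗ g).codRestrict _ fun x ↦ by
    rw [LinearMap.mem_ker]; simp [ht]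
  have hpz (x) : (pz x : V) = x - t (g x) := rfl
  let i : (LinearMap.ker g ⧸ B) →ₗ[E] V := B.liftQ ((LinearMap.id - f ∘ₗ s) ∘ₗ (LinearMap.ker g).subtype) (by
    rintro _ ⟨x, rfl⟩
    rw [LinearMap.mem_ker]
    change f x - f (s (f x)) = 0
    rw [hs, sub_self])
  have hi (z : LinearMap.ker g) : i (B.mkQ z) = z - f (s z) := rfl
  refine ⟨⟨i, B.mkQ ∘ₗ pz, s ∘ₗ (LinearMap.id - t ∘ₗ g), t, ?_, ?_, ?_, ?_⟩⟩
  · refine Submodule.linearMap_qext _ (LinearMap.ext fun z ↦ ?_)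
    change g (z - f (s z)) = 0
    rw [map_sub, h, sub_zero]
    exact z.2
  · refine LinearMap.ext fun x ↦ (Submodule.Quotient.mk_eq_zero _).2 ⟨x, Subtype.ext ?_⟩
    rw [hpz, h, map_zero, sub_zero]; rfl
  · refine Submodule.linearMap_qext _ (LinearMap.ext fun z ↦ ?_)
    refine (Submodule.Quotient.eq _).2 ⟨-s z, Subtype.ext ?_⟩
    change f (-s z) = (z - f (s z)) - t (g (z - f (s z))) - z
    have : g z = 0 := z.2
    rw [map_sub, h, this, sub_zero, map_zero, map_neg]
    abel
  · refine LinearMap.ext fun x ↦ ?_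
    change (x - t (g x)) - f (s (x - t (g x))) + f (s (x - t (g x))) + t (g x) = x
    abel

lemma ComplexSplitting.rank_eq {f : U →ₗ[E] V} {g : V →ₗ[E] W} (S : ComplexSplitting f g H)
    (h : ∀ x, g (f x) = 0) : Module.rank E
      (LinearMap.ker g ⧸ LinearMap.range (f.codRestrict (LinearMap.ker g) h)) = Module.rank E H := by
  let k : LinearMap.ker g →ₗ[E] H := S.p ∘ₗ (LinearMap.ker g).subtype
  have hsurj : Function.Surjective k := fun y ↦
    ⟨⟨S.i y, LinearMap.congr_fun S.g_comp_i y⟩, LinearMap.congr_fun S.p_comp_i y⟩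
  have hker : LinearMap.range (f.codRestrict (LinearMap.ker g) h) = LinearMap.ker k := by
    ext x
    constructor
    · rintro ⟨y, rfl⟩
      exact LinearMap.congr_fun S.p_comp_f y
    · intro hx
      have hd := LinearMap.congr_fun S.decomp x.1
      have hx' : S.p x.1 = 0 := hx
      have hg : g x.1 = 0 := x.2
      simp only [LinearMap.add_apply, LinearMap.comp_apply, hx', hg, map_zero, zero_add, add_zero] at hd
      exact ⟨S.s x, Subtype.ext hd⟩
  rw [hker]
  exact (k.quotKerEquivOfSurjective hsurj).rank_eq

end Splitting

section BaseChange

variable {R E D : Type u} [Ring R] [DivisionRing E] [DivisionRing D] (β : R →+* E) (ι : E →+* D)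

lemma BalancedTensor.rank_eq (H : Type u) [AddCommGroup H] [Module E H] :
    Module.rank D (BalancedTensor ι H) = Module.rank E H := by
  classical
  let b := Module.Basis.ofVectorSpace E H
  let f : H →+ (Module.Basis.ofVectorSpaceIndex E H →₀ D) :=
    (Finsupp.mapRange.addMonoidHom ι.toAddMonoidHom).comp b.repr.toLinearMap.toAddMonoidHom
  have hf (r : E) (x : H) : f (r • x) = ι r • f x := by
    ext k
    change ι (b.repr (r • x) k) = ι r * ι (b.repr x k)
    simp
  have hfb (k) : f (b k) = Finsupp.single k 1 := by
    ext l
    change ι (b.repr (b k) l) = _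
    rw [b.repr_self, Finsupp.single_apply, Finsupp.single_apply]
    split_ifs <;> simp
  let e : BalancedTensor ι H ≃ₗ[D] (Module.Basis.ofVectorSpaceIndex E H →₀ D) :=
    LinearEquiv.ofLinearMap (BalancedTensor.lift ι f hf)
      (Finsupp.lift _ D _ fun k ↦ BalancedTensor.unit ι (b k))
      (Finsupp.lhom_ext fun k d ↦ by
        rw [LinearMap.comp_apply, Finsupp.lift_apply, Finsupp.sum_single_index (by exact zero_smul _ _),
          map_smul, BalancedTensor.lift_unit, hfb]
        simp)
      (BalancedTensor.hom_ext_unit ι fun x ↦ by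
        rw [LinearMap.comp_apply, BalancedTensor.lift_unit, LinearMap.id_apply]
        induction b.mem_span x using Submodule.span_induction with
        | mem x hx =>
          obtain ⟨k, rfl⟩ := hx
          rw [hfb, Finsupp.lift_apply, Finsupp.sum_single_index (by exact zero_smul _ _), one_smul]
        | zero => simp
        | add x y _ _ hx hy => rw [_root_.map_add, _root_.map_add, _root_.map_add, hx, hy]
        | smul r x _ hx => rw [hf, map_smul, hx, BalancedTensor.unit_smul])
  rw [e.rank_eq, rank_finsupp_self', b.mk_eq_rank'']

/-- The canonical map from the extension of scalars along a first map to the one along a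
composition. -/
noncomputable def BalancedTensor.extend (M : Type u) [AddCommGroup M] [Module R M] :
    BalancedTensor β M →+ BalancedTensor (ι.comp β) M :=
  let _ : Module E (BalancedTensor (ι.comp β) M) := Module.compHom _ ι
  (BalancedTensor.lift β (BalancedTensor.unit (ι.comp β))
    (BalancedTensor.unit_smul (ι.comp β))).toAddMonoidHom

lemma BalancedTensor.extend_smul {M : Type u} [AddCommGroup M] [Module R M] (r : E)
    (x : BalancedTensor β M) : extend β ι M (r • x) = ι r • extend β ι M x :=
  let _ : Module E (BalancedTensor (ι.comp β) M) := Module.compHom _ ι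
  (BalancedTensor.lift β (BalancedTensor.unit (ι.comp β))
    (BalancedTensor.unit_smul (ι.comp β))).map_smul r x

lemma BalancedTensor.extend_unit {M : Type u} [AddCommGroup M] [Module R M] (m : M) :
    extend β ι M (unit β m) = unit (ι.comp β) m :=
  let _ : Module E (BalancedTensor (ι.comp β) M) := Module.compHom _ ι
  BalancedTensor.lift_unit β (BalancedTensor.unit (ι.comp β)) (BalancedTensor.unit_smul (ι.comp β)) m

/-- Every element of `E ⊗_R M` is a combination of the elements `1 ⊗ m`. -/
lemma BalancedTensor.unit_induction {M : Type u} [AddCommGroup M] [Module R M]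
    {p : BalancedTensor β M → Prop} (unit : ∀ m, p (unit β m)) (add : ∀ x y, p x → p y → p (x + y))
    (smul : ∀ (r : E) x, p x → p (r • x)) (x : BalancedTensor β M) : p x := by
  let N : Submodule E (BalancedTensor β M) :=
    { carrier := {x | p x}
      add_mem' := add _ _
      zero_mem' := by simpa using unit 0
      smul_mem' := fun r x ↦ smul r x }
  have hN : N.mkQ = 0 := hom_ext_unit β fun m ↦ (Submodule.Quotient.mk_eq_zero N).2 (unit m)
  exact (Submodule.Quotient.mk_eq_zero N).1 (LinearMap.congr_fun hN x)

/-- Extension of scalars in two steps. -/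
noncomputable def BalancedTensor.compEquiv (M : Type u) [AddCommGroup M] [Module R M] :
    BalancedTensor (ι.comp β) M ≃ₗ[D] BalancedTensor ι (BalancedTensor β M) :=
  have h (r : R) (m : M) : ((unit ι).comp (unit β)) (r • m) = ι.comp β r • (unit ι).comp (unit β) m := by
    rw [AddMonoidHom.comp_apply, unit_smul, unit_smul]; rfl
  LinearEquiv.ofLinearMap (lift (ι.comp β) ((unit ι).comp (unit β)) h)
    (lift ι (extend β ι M) (extend_smul β ι))
    (hom_ext_unit ι fun x ↦ by
      rw [LinearMap.comp_apply, lift_unit, LinearMap.id_apply]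
      induction x using unit_induction with
      | unit m => rw [extend_unit, lift_unit]; rfl
      | add x y hx hy => rw [_root_.map_add, _root_.map_add, _root_.map_add, hx, hy]
      | smul r x hx => rw [extend_smul, map_smul, hx, unit_smul])
    (hom_ext_unit _ fun m ↦ by
      rw [LinearMap.comp_apply, lift_unit, AddMonoidHom.comp_apply, lift_unit, extend_unit]; rfl)

lemma BalancedTensor.compEquiv_unit {M : Type u} [AddCommGroup M] [Module R M] (m : M) :
    compEquiv β ι M (unit (ι.comp β) m) = unit ι (unit β m) :=
  lift_unit (ι.comp β) ((unit ι).comp (unit β)) (fun r m ↦ by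
    rw [AddMonoidHom.comp_apply, unit_smul, unit_smul]; rfl) m

lemma BalancedTensor.compEquiv_map {M N : Type u} [AddCommGroup M] [Module R M] [AddCommGroup N]
    [Module R N] (f : M →ₗ[R] N) : (compEquiv β ι N).toLinearMap ∘ₗ map (ι.comp β) f =
      map ι (map β f) ∘ₗ (compEquiv β ι M).toLinearMap :=
  hom_ext_unit _ fun m ↦ by
    rw [LinearMap.comp_apply, LinearMap.comp_apply, map_unit, LinearEquiv.coe_coe, LinearEquiv.coe_coe,
      compEquiv_unit, compEquiv_unit, map_unit, map_unit]

/-- Splittings are preserved by extension of scalars. -/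
noncomputable def ComplexSplitting.baseChange {U V W H U' V' W' : Type u} [AddCommGroup U] [Module E U]
    [AddCommGroup V] [Module E V] [AddCommGroup W] [Module E W] [AddCommGroup H] [Module E H]
    [AddCommGroup U'] [Module D U'] [AddCommGroup V'] [Module D V'] [AddCommGroup W'] [Module D W']
    {f : U →ₗ[E] V} {g : V →ₗ[E] W} (S : ComplexSplitting f g H) {f' : U' →ₗ[D] V'} {g' : V' →ₗ[D] W'}
    (eU : U' ≃ₗ[D] BalancedTensor ι U) (eV : V' ≃ₗ[D] BalancedTensor ι V)
    (eW : W' ≃ₗ[D] BalancedTensor ι W) (hf : ∀ x, eV (f' x) = BalancedTensor.map ι f (eU x))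
    (hg : ∀ x, eW (g' x) = BalancedTensor.map ι g (eV x)) :
    ComplexSplitting f' g' (BalancedTensor ι H) :=
  have hcomp {A B C : Type u} [AddCommGroup A] [Module E A] [AddCommGroup B] [Module E B]
      [AddCommGroup C] [Module E C] (g : B →ₗ[E] C) (f : A →ₗ[E] B) (x) :
      BalancedTensor.map ι g (BalancedTensor.map ι f x) = BalancedTensor.map ι (g ∘ₗ f) x :=
    (LinearMap.congr_fun (BalancedTensor.map_comp ι g f) x).symm
  have hzero {A B : Type u} [AddCommGroup A] [Module E A] [AddCommGroup B] [Module E B] (x) :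
      BalancedTensor.map ι (0 : A →ₗ[E] B) x = 0 :=
    LinearMap.congr_fun (g := 0) (BalancedTensor.hom_ext_unit ι fun m ↦ by
      rw [BalancedTensor.map_unit, LinearMap.zero_apply, LinearMap.zero_apply, map_zero]) x
  { i := eV.symm.toLinearMap ∘ₗ BalancedTensor.map ι S.i
    p := BalancedTensor.map ι S.p ∘ₗ eV.toLinearMap
    s := eU.symm.toLinearMap ∘ₗ BalancedTensor.map ι S.s ∘ₗ eV.toLinearMap
    t := eV.symm.toLinearMap ∘ₗ BalancedTensor.map ι S.t ∘ₗ eW.toLinearMap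
    g_comp_i := LinearMap.ext fun x ↦ eW.injective (by
      change eW (g' (eV.symm (BalancedTensor.map ι S.i x))) = eW 0
      rw [hg, eV.apply_symm_apply, hcomp, S.g_comp_i, hzero, map_zero])
    p_comp_f := LinearMap.ext fun x ↦ by
      change BalancedTensor.map ι S.p (eV (f' x)) = 0
      rw [hf, hcomp, S.p_comp_f, hzero]
    p_comp_i := LinearMap.ext fun x ↦ by
      change BalancedTensor.map ι S.p (eV (eV.symm (BalancedTensor.map ι S.i x))) = x
      rw [eV.apply_symm_apply, hcomp, S.p_comp_i, BalancedTensor.map_id, LinearMap.id_apply]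
    decomp := LinearMap.ext fun x ↦ eV.injective (by
      change eV (eV.symm (BalancedTensor.map ι S.i (BalancedTensor.map ι S.p (eV x))) +
        f' (eU.symm (BalancedTensor.map ι S.s (eV x))) +
        eV.symm (BalancedTensor.map ι S.t (eW (g' x)))) = eV x
      rw [map_add, map_add, eV.apply_symm_apply, eV.apply_symm_apply, hf, hg, eU.apply_symm_apply,
        hcomp, hcomp, hcomp, ← LinearMap.add_apply, ← LinearMap.add_apply, ← BalancedTensor.map_add,
        ← BalancedTensor.map_add, S.decomp, BalancedTensor.map_id, LinearMap.id_apply]) }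

/-- Betti numbers do not change under extensions of the skew field. -/
lemma bettiNumber_comp (C : ChainComplex (ModuleCat.{u} R) ℕ) (n : ℕ) :
    bettiNumber (ι.comp β) C n = bettiNumber β C n := by
  obtain ⟨S⟩ := exists_complexSplitting _ _ (map_d_map_d β C ((ComplexShape.down ℕ).prev n) n
    ((ComplexShape.down ℕ).next n))
  let T := S.baseChange ι (BalancedTensor.compEquiv β ι (C.X ((ComplexShape.down ℕ).prev n)))
    (BalancedTensor.compEquiv β ι (C.X n))
    (BalancedTensor.compEquiv β ι (C.X ((ComplexShape.down ℕ).next n)))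
    (LinearMap.congr_fun (BalancedTensor.compEquiv_map β ι _))
    (LinearMap.congr_fun (BalancedTensor.compEquiv_map β ι _))
  rw [bettiNumber_eq_toENat_rank (ι.comp β) C (j := n) rfl rfl (map_d_map_d _ C _ _ _),
    bettiNumber_eq_toENat_rank β C (j := n) rfl rfl (map_d_map_d _ C _ _ _), T.rank_eq,
    BalancedTensor.rank_eq]

end BaseChange

/-! ### Betti numbers and the uniqueness of epic agrarian embeddings -/

theorem mainTheorem3 (G : Type u) [Group G] [Group.FG G] (hG : IsAgrarian G) :
    (∀ (X : Type u) [TopologicalSpace X] [T2Space X] [MulAction G X]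
        [CWComplex (Set.univ : Set X)] [IsGCWComplex G X], ConnectedSpace X → IsFreeGSpace G X → IsFiniteGCWComplex G X →
        ∀ (D₁ D₂ : Type u) [DivisionRing D₁] [DivisionRing D₂]
          (α₁ : AgrarianMap G D₁) (α₂ : AgrarianMap G D₂),
          IsAgrarianEmbedding α₁ → IsAgrarianEmbedding α₂ →
          ∀ p : ℕ, agrarianBetti G X α₁ p = agrarianBetti G X α₂ p) ↔
      ∃ (D : Type u) (_ : DivisionRing D) (α : AgrarianMap G D),
        IsAgrarianEmbedding α ∧ IsEpic α ∧
        ∀ (D' : Type u) [DivisionRing D'] (α' : AgrarianMap G D'),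
          IsAgrarianEmbedding α' → IsEpic α' → AgrarianIso α α' := by
  constructor
  · intro h
    obtain ⟨D, _, α, hα⟩ := hG
    -- the epic embedding is obtained by restricting the target to the generated skew field
    have hα' : IsAgrarianEmbedding (α.codRestrict (Subfield.closure (Set.range α)) fun r ↦
        Subfield.subset_closure ⟨r, rfl⟩) := fun a b hab ↦ hα (congrArg Subtype.val hab)
    refine ⟨_, inferInstance, _, hα', isEpic_codRestrict_closure α, fun D' _ α' h1 h2 ↦ ?_⟩
    exact exists_ringEquiv_of_isUnit_iff (fun n A ↦ isUnit_map_iff_of_betti _ _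
      (fun X _ _ _ _ _ hc hf hX ↦ h X hc hf hX _ _ _ _ hα' h1) A)
      (isEpic_codRestrict_closure α).closure_range_eq_top h2.closure_range_eq_top
  · rintro ⟨D, _, α, -, -, huniq⟩ X _ _ _ _ _ - - - D₁ D₂ _ _ α₁ α₂ h₁ h₂ p
    -- every embedding factors through the universal one
    have key (D' : Type u) [DivisionRing D'] (α' : AgrarianMap G D') (h' : IsAgrarianEmbedding α') :
        agrarianBetti G X α' p = agrarianBetti G X α p := by
      obtain ⟨e, he⟩ := huniq _ (α'.codRestrict (Subfield.closure (Set.range α')) fun r ↦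
        Subfield.subset_closure ⟨r, rfl⟩) (fun a b hab ↦ h' (congrArg Subtype.val hab))
        (isEpic_codRestrict_closure α')
      have : α' = ((Subfield.closure (Set.range α')).subtype.comp e.toRingHom).comp α := by
        rw [RingHom.comp_assoc, he]; rfl
      rw [this]
      exact bettiNumber_comp α _ _ p
    rw [key D₁ α₁ h₁, key D₂ α₂ h₂]
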